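/- Let $X$ be $c_0(\mathbb R)$ or $\ell^p(\mathbb R)$ with $1\le p<\infty$, let $0<\alpha\le 1$, and let $L:X\to X$, $L(x_1,x_2,\dots)=(\alpha_1x_2,\alpha_2x_3,\dots)$, be a weighted shift with weights $\alpha_n\in(c,c')$ for some $0<c<c'$. Put $\beta_k^n=\alpha_k\cdots\alpha_{k+n-1}$, $d_n=\inf_{k\ge1}\beta_k^n$, and assume $\sum_{n\ge1}d_n^{-\alpha}<\infty$. Let $m$ be a Borel probability measure on $\mathbb R$ with $\operatorname{supp}(m)=\mathbb R$. Let $\mathrm{Lip}_b$ be the space of bounded $\alpha$-Hölder functions on $X$, with norm the sum of the supremum norm and the best $\alpha$-Hölder constant, and let $A\in\mathrm{Lip}_b$ be real-valued. For a bounded continuous potential $B:X\to\mathbb R$, the Ruelle operator is $$\mathcal L_B(\varphi)(x)=\int_{\mathbb R}e^{B(r,x_1/\alpha_1,x_2/\alpha_2,\dots)}\,\varphi(r,x_1/\alpha_1,x_2/\alpha_2,\dots)\,dm(r),$$ and its dual acts on $\sigma$-additive finite Borel measures by $\int\varphi\,d\mathcal L_B^*\mu=\int\mathcal L_B\varphi\,d\mu$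 for all bounded continuous $\varphi$. The potential $B$ is normalized if $\mathcal L_B(1)=1$. It has summable variation if $\sum_{n\ge1}V_n(B)<\infty$, where $V_n(B)=\sup\{|B(x)-B(y)|: x_i=y_i \text{ for } 1\le i\le n\}$. The measure $m$ has adapted tails if for every $\epsilon>0$ there is a sequence of positive numbers $(\kappa_n)_{n\ge1}\in X$ with $\sum_{n\ge1}m(\mathbb R\setminus[-\beta_1^n\kappa_n,\beta_1^n\kappa_n])<\epsilon$. (a) If $A$ has summable variation, there are $\lambda_A>0$ and a real-valued $\psi_A\in\mathrm{Lip}_b$ with $\inf_X\psi_A>0$ and $\mathcal L_A\psi_A=\lambda_A\psi_A$. Moreover $\lambda_A$ is the spectral radius of $\mathcal L_A$ acting on $\mathrm{Lip}_b$ (that is, $\lambda_A=\lim_n\|\mathcal L_A^n\|^{1/n}$ on real-valued $\mathrm{Lip}_b$, and $\lambda_A$ is the largest modulus of a point of the spectrum on complex-valued $\mathrm{Lip}_b$), and every everywhere positive eigenfunction of $\mathcal L_A$ in $\mathrm{Lip}_b$, for any eigenvalue, is a multiple of $\psi_A$. (b) If $m$ has adapted tails and $A$ is normalized, there is a unique $\sigma$-additive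 Borel probability measure $\mu_A$ on $X$ with $\mathcal L_A^*\mu_A=\mu_A$. For every Borel probability measure $\nu$ on $X$, $(\mathcal L_A^*)^n\nu\to\mu_A$ in the weak-$*$ topology (tested against bounded continuous functions). The measure $\mu_A$ is $L$-invariant and mixing, hence conservative and ergodic. (c) If $A$ has summable variation and $m$ has adapted tails, then $\overline A=A+\log\psi_A-\log(\psi_A\circ L)-\log\lambda_A$ is normalized, and all conclusions of (b) hold for $\overline A$; its unique fixed probability measure is denoted by $\mu_A$. (d) If $A$ has summable variation, then every Borel probability measure $\mu$ on $X$ with $\mathcal L_{\overline A}^*\mu=\mu$ (in particular $\mu_A$ of (c)) satisfies $\operatorname{supp}(\mu)\supseteq\pi_1^{-1}(\operatorname{supp}(m))$, where $\pi_1$ is the projection on the first coordinate, and hence $\operatorname{supp}(\mu)=X$. If moreover $A$ is itself normalized, the same holds for every Borel probability measure fixed by $\mathcal L_A^*$. -/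

import Mathlib

open Set Filter Topology MeasureTheory
open scoped ENNReal NNReal BoundedContinuousFunction

/-- The elements of `ℓ^p(ℕ, ℝ)` whose coordinates tend to `0`. For `p = ∞` this is the space
`c₀(ℝ)` with the supremum norm; for `1 ≤ p < ∞` it is all of `ℓ^p(ℝ)`, see
`seqSubmodule_eq_top`. -/
def seqSubmodule (p : ℝ≥0∞) : Submodule ℝ (lp (fun _ : ℕ => ℝ) p) where
  carrier := {x | Tendsto (fun n => x n) atTop (𝓝 0)}
  zero_mem' := by
    simp only [Set.mem_ofPred_eq, lp.coeFn_zero, Pi.zero_apply]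
    exact tendsto_const_nhds
  add_mem' := by
    intro x y hx hy
    simpa using Tendsto.add hx hy
  smul_mem' := by
    intro c x hx
    simpa using Tendsto.const_mul c hx

theorem seqSubmodule_eq_top {p : ℝ≥0∞} (h1 : 1 ≤ p) (hp : p ≠ ∞) : seqSubmodule p = ⊤ := by
  have hp' : 0 < p.toReal := ENNReal.toReal_pos (by positivity) hp
  refine eq_top_iff.2 fun x _ => ?_
  have hs := ((lp.memℓp x).summable hp').tendsto_atTop_zero
  have h := hs.rpow_const (p := p.toReal⁻¹) (Or.inr (by positivity))
  rw [Real.zero_rpow (by positivity)] at h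
  refine tendsto_zero_iff_norm_tendsto_zero.2 (h.congr fun n => ?_)
  rw [← Real.rpow_mul (norm_nonneg _), mul_inv_cancel₀ hp'.ne', Real.rpow_one]

/-- The Banach space `X`: `c₀(ℝ)` if `p = ∞` and `ℓ^p(ℝ)` if `1 ≤ p < ∞`, with its usual norm.
Coordinates are indexed from `0`. -/
def SeqSpace (p : ℝ≥0∞) : Type := seqSubmodule p

noncomputable instance SeqSpace.instNormedAddCommGroup (p : ℝ≥0∞) [Fact (1 ≤ p)] :
    NormedAddCommGroup (SeqSpace p) :=
  inferInstanceAs (NormedAddCommGroup (seqSubmodule p))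

noncomputable instance SeqSpace.instNormedSpace (p : ℝ≥0∞) [Fact (1 ≤ p)] :
    NormedSpace ℝ (SeqSpace p) :=
  inferInstanceAs (NormedSpace ℝ (seqSubmodule p))

/-- The `n`-th coordinate (counted from `0`) of a point of `X`. -/
def SeqSpace.coord {p : ℝ≥0∞} (x : SeqSpace p) (n : ℕ) : ℝ := x.1 n

noncomputable instance SeqSpace.instMeasurableSpace (p : ℝ≥0∞) [Fact (1 ≤ p)] : MeasurableSpace (SeqSpace p) :=
  borel _

instance SeqSpace.instBorelSpace (p : ℝ≥0∞) [Fact (1 ≤ p)] : BorelSpace (SeqSpace p) := ⟨rfl⟩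

theorem SeqSpace.ext_coord {p : ℝ≥0∞} {x y : SeqSpace p} (h : ∀ n, x.coord n = y.coord n) :
    x = y :=
  Subtype.ext (lp.ext (funext h))

theorem memℓp_of_le_succ {p : ℝ≥0∞} [hp : Fact (1 ≤ p)] {x y : ℕ → ℝ} (hx : Memℓp x p) (C : ℝ)
    (h : ∀ n, |y n| ≤ C * |x (n + 1)|) : Memℓp y p := by
  rcases eq_or_ne p ∞ with rfl | hpt
  · obtain ⟨B, hB⟩ := hx.bddAbove
    refine memℓp_infty ⟨|C| * B, ?_⟩
    rintro _ ⟨n, rfl⟩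
    have h1 : |x (n + 1)| ≤ B := hB ⟨n + 1, rfl⟩
    calc ‖y n‖ ≤ C * |x (n + 1)| := h n
      _ ≤ |C| * |x (n + 1)| := by gcongr; exact le_abs_self C
      _ ≤ |C| * B := by gcongr
  · have hp' : 0 < p.toReal := ENNReal.toReal_pos (by have := hp.1; positivity) hpt
    refine memℓp_gen ?_
    have hs := (((summable_nat_add_iff 1).2 (hx.summable hp')).mul_left (|C| ^ p.toReal))
    refine Summable.of_nonneg_of_le (fun n => by positivity) (fun n => ?_) hs
    rw [← Real.mul_rpow (abs_nonneg C) (norm_nonneg _)]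
    gcongr
    calc ‖y n‖ ≤ C * |x (n + 1)| := h n
      _ ≤ |C| * ‖x (n + 1)‖ := by
        rw [Real.norm_eq_abs]; gcongr; exact le_abs_self C

theorem memℓp_of_succ_le {p : ℝ≥0∞} [hp : Fact (1 ≤ p)] {x y : ℕ → ℝ} (hx : Memℓp x p) (C : ℝ)
    (h : ∀ n, |y (n + 1)| ≤ C * |x n|) : Memℓp y p := by
  rcases eq_or_ne p ∞ with rfl | hpt
  · obtain ⟨B, hB⟩ := hx.bddAbove
    refine memℓp_infty ⟨max |y 0| (|C| * B), ?_⟩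
    rintro _ ⟨n, rfl⟩
    cases n with
    | zero => exact le_max_left _ _
    | succ n =>
      refine le_max_of_le_right ?_
      have h1 : |x n| ≤ B := hB ⟨n, rfl⟩
      calc ‖y (n + 1)‖ ≤ C * |x n| := h n
        _ ≤ |C| * |x n| := by gcongr; exact le_abs_self C
        _ ≤ |C| * B := by gcongr
  · have hp' : 0 < p.toReal := ENNReal.toReal_pos (by have := hp.1; positivity) hpt
    refine memℓp_gen ?_
    have hs := (hx.summable hp').mul_left (|C| ^ p.toReal)
    rw [← summable_nat_add_iff 1]
    refine Summable.of_nonneg_of_le (fun n => by positivity) (fun n => ?_) hs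
    rw [← Real.mul_rpow (abs_nonneg C) (norm_nonneg _)]
    gcongr
    calc ‖y (n + 1)‖ ≤ C * |x n| := h n
      _ ≤ |C| * ‖x n‖ := by
        rw [Real.norm_eq_abs]; gcongr; exact le_abs_self C

theorem norm_le_of_le_succ {p : ℝ≥0∞} [hp : Fact (1 ≤ p)] {x y : lp (fun _ : ℕ => ℝ) p} {C : ℝ}
    (hC : 0 ≤ C) (h : ∀ n, |y n| ≤ C * |x (n + 1)|) : ‖y‖ ≤ C * ‖x‖ := by
  rcases eq_or_ne p ∞ with rfl | hpt
  · refine lp.norm_le_of_forall_le (by positivity) fun n => (h n).trans ?_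
    gcongr
    exact lp.norm_apply_le_norm (by simp) x (n + 1)
  · have hp' : 0 < p.toReal := ENNReal.toReal_pos (by have := hp.1; positivity) hpt
    refine lp.norm_le_of_tsum_le hp' (by positivity) ?_
    have hx := (lp.memℓp x).summable hp'
    have hs := ((summable_nat_add_iff 1).2 hx)
    rw [Real.mul_rpow hC (norm_nonneg _), lp.norm_rpow_eq_tsum hp' x]
    calc ∑' n, ‖y n‖ ^ p.toReal ≤ ∑' n, C ^ p.toReal * ‖x (n + 1)‖ ^ p.toReal := by
          refine Summable.tsum_le_tsum (fun n => ?_) ((lp.memℓp y).summable hp')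
            (hs.mul_left _)
          rw [← Real.mul_rpow hC (norm_nonneg _)]
          gcongr
          exact h n
      _ = C ^ p.toReal * ∑' n, ‖x (n + 1)‖ ^ p.toReal := tsum_mul_left
      _ ≤ C ^ p.toReal * ∑' n, ‖x n‖ ^ p.toReal := by
          refine mul_le_mul_of_nonneg_left ?_ (by positivity)
          rw [hx.tsum_eq_zero_add]
          have : 0 ≤ ‖x 0‖ ^ p.toReal := by positivity
          linarith

theorem norm_le_of_succ_le {p : ℝ≥0∞} [hp : Fact (1 ≤ p)] {x y : lp (fun _ : ℕ => ℝ) p} {C : ℝ}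
    (hC : 0 ≤ C) (h0 : y 0 = 0) (h : ∀ n, |y (n + 1)| ≤ C * |x n|) : ‖y‖ ≤ C * ‖x‖ := by
  rcases eq_or_ne p ∞ with rfl | hpt
  · refine lp.norm_le_of_forall_le (by positivity) fun n => ?_
    cases n with
    | zero => rw [h0, norm_zero]; positivity
    | succ n =>
      refine (h n).trans ?_
      gcongr
      exact lp.norm_apply_le_norm (by simp) x n
  · have hp' : 0 < p.toReal := ENNReal.toReal_pos (by have := hp.1; positivity) hpt
    refine lp.norm_le_of_tsum_le hp' (by positivity) ?_
    have hx := (lp.memℓp x).summable hp'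
    have hy := (lp.memℓp y).summable hp'
    rw [Real.mul_rpow hC (norm_nonneg _), lp.norm_rpow_eq_tsum hp' x, hy.tsum_eq_zero_add, h0,
      norm_zero, Real.zero_rpow hp'.ne', zero_add, ← tsum_mul_left]
    refine Summable.tsum_le_tsum (fun n => ?_) ((summable_nat_add_iff 1).2 hy) (hx.mul_left _)
    rw [← Real.mul_rpow hC (norm_nonneg _)]
    gcongr
    exact h n

/-- A weight sequence of a weighted shift: a real sequence with values in some interval `(c, c')`,
`0 < c < c'`. Here `val n` is the weight usually denoted `α_{n+1}`. -/
structure ShiftWeight where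
  val : ℕ → ℝ
  bounds : ∃ c c' : ℝ, 0 < c ∧ ∀ n, val n ∈ Set.Ioo c c'

theorem ShiftWeight.val_pos (w : ShiftWeight) (n : ℕ) : 0 < w.val n := by
  obtain ⟨c, c', hc, h⟩ := w.bounds
  exact hc.trans (h n).1

/-- The product of `n` consecutive weights starting with the one of index `k` (counted from `0`):
this is `β_{k+1}^n = α_{k+1} ⋯ α_{k+n}`. -/
noncomputable def ShiftWeight.beta (w : ShiftWeight) (k n : ℕ) : ℝ :=
  ∏ i ∈ Finset.range n, w.val (k + i)

/-- `d_n`, the infimum over all `k` of the products of `n` consecutive weights. -/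
noncomputable def ShiftWeight.d (w : ShiftWeight) (n : ℕ) : ℝ := ⨅ k, w.beta k n

theorem ShiftWeight.exists_upper (w : ShiftWeight) : ∃ C : ℝ, 0 ≤ C ∧ ∀ n, |w.val n| ≤ C := by
  obtain ⟨c, c', hc, h⟩ := w.bounds
  refine ⟨c', (hc.trans ((h 0).1.trans (h 0).2)).le, fun n => ?_⟩
  rw [abs_of_pos (w.val_pos n)]
  exact (h n).2.le

theorem ShiftWeight.exists_inv_upper (w : ShiftWeight) :
    ∃ C : ℝ≥0, ∀ n, |(w.val n)⁻¹| ≤ C := by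
  obtain ⟨c, c', hc, h⟩ := w.bounds
  refine ⟨⟨c⁻¹, by positivity⟩, fun n => ?_⟩
  rw [abs_of_pos (inv_pos.2 (w.val_pos n))]
  exact inv_anti₀ hc (h n).1.le

section Shift

variable {p : ℝ≥0∞} [Fact (1 ≤ p)]

/-- The weighted shift `L (x₁, x₂, …) = (α₁ x₂, α₂ x₃, …)`, a bounded operator on `X`. -/
noncomputable def weightedShift (w : ShiftWeight) : SeqSpace p →L[ℝ] SeqSpace p :=
  LinearMap.mkContinuousOfExistsBound
    { toFun := fun x =>
        ⟨⟨fun n => w.val n * x.coord (n + 1), by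
          obtain ⟨C, hC0, hC⟩ := w.exists_upper
          refine memℓp_of_le_succ (lp.memℓp x.1) C fun n => ?_
          rw [abs_mul]
          exact mul_le_mul_of_nonneg_right (hC n) (abs_nonneg _)⟩, by
          obtain ⟨C, hC0, hC⟩ := w.exists_upper
          have hx : Tendsto (fun n => x.coord (n + 1)) atTop (𝓝 0) :=
            (tendsto_add_atTop_iff_nat 1).2 x.2
          exact bdd_le_mul_tendsto_zero' C (Eventually.of_forall hC) hx⟩
      map_add' := fun x y => SeqSpace.ext_coord fun n => by
        change w.val n * (x.coord (n + 1) + y.coord (n + 1)) = _ + _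
        exact mul_add _ _ _
      map_smul' := fun c x => SeqSpace.ext_coord fun n => by
        change w.val n * (c * x.coord (n + 1)) = c * (w.val n * x.coord (n + 1))
        ring }
    (by
      obtain ⟨C, hC0, hC⟩ := w.exists_upper
      refine ⟨C, fun x => norm_le_of_le_succ hC0 fun n => ?_⟩
      change |w.val n * x.coord (n + 1)| ≤ C * |x.coord (n + 1)|
      rw [abs_mul]
      exact mul_le_mul_of_nonneg_right (hC n) (abs_nonneg _))

theorem weightedShift_coord (w : ShiftWeight) (x : SeqSpace p) (n : ℕ) :
    (weightedShift w x).coord n = w.val n * x.coord (n + 1) := rfl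

/-- The point `(r, x₁/α₁, x₂/α₂, …)` of `X`. -/
noncomputable def branch (w : ShiftWeight) (r : ℝ) (x : SeqSpace p) : SeqSpace p :=
  ⟨⟨fun n => Nat.casesOn n r fun k => x.coord k / w.val k, by
    obtain ⟨C, hC⟩ := w.exists_inv_upper
    refine memℓp_of_succ_le (lp.memℓp x.1) C fun n => ?_
    change |x.coord n / w.val n| ≤ C * |x.coord n|
    rw [div_eq_inv_mul, abs_mul]
    exact mul_le_mul_of_nonneg_right (hC n) (abs_nonneg _)⟩, by
    obtain ⟨C, hC⟩ := w.exists_inv_upper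
    refine (tendsto_add_atTop_iff_nat 1).1 ?_
    change Tendsto (fun n => x.coord n / w.val n) atTop (𝓝 0)
    simp only [div_eq_inv_mul]
    exact bdd_le_mul_tendsto_zero' C (Eventually.of_forall hC) x.2⟩

theorem branch_coord_zero (w : ShiftWeight) (r : ℝ) (x : SeqSpace p) :
    (branch w r x).coord 0 = r := rfl

theorem branch_coord_succ (w : ShiftWeight) (r : ℝ) (x : SeqSpace p) (n : ℕ) :
    (branch w r x).coord (n + 1) = x.coord n / w.val n := rfl

/-- The points `branch w r x`, `r ∈ ℝ`, are exactly the solutions `v` of `L v = x`. -/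
theorem weightedShift_eq_iff (w : ShiftWeight) (v x : SeqSpace p) :
    weightedShift w v = x ↔ ∃ r, v = branch w r x := by
  constructor
  · rintro rfl
    refine ⟨v.coord 0, SeqSpace.ext_coord fun n => ?_⟩
    cases n with
    | zero => rfl
    | succ n =>
      rw [branch_coord_succ, weightedShift_coord, mul_div_cancel_left₀ _ (w.val_pos n).ne']
  · rintro ⟨r, rfl⟩
    refine SeqSpace.ext_coord fun n => ?_
    rw [weightedShift_coord, branch_coord_succ, mul_div_cancel₀ _ (w.val_pos n).ne']

theorem exists_lipschitz_branch (w : ShiftWeight) :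
    ∃ C : ℝ≥0, ∀ r, LipschitzWith C (branch (p := p) w r) := by
  obtain ⟨C, hC⟩ := w.exists_inv_upper
  refine ⟨C, fun r => LipschitzWith.of_dist_le_mul fun x y => ?_⟩
  rw [dist_eq_norm, dist_eq_norm]
  refine norm_le_of_succ_le (x := (x - y).1) C.2 ?_ fun n => ?_
  · exact sub_self r
  · change |x.coord n / w.val n - y.coord n / w.val n| ≤ C * |x.coord n - y.coord n|
    rw [← sub_div, div_eq_inv_mul, abs_mul]
    exact mul_le_mul_of_nonneg_right (hC n) (abs_nonneg _)

theorem branch_eq (w : ShiftWeight) (r : ℝ) (x : SeqSpace p) :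
    branch w r x = r • branch w 1 0 + branch w 0 x := by
  refine SeqSpace.ext_coord fun n => ?_
  cases n with
  | zero =>
    change r = r * 1 + 0
    ring
  | succ n =>
    change x.coord n / w.val n = r * (0 / w.val n) + x.coord n / w.val n
    ring

theorem continuous_branch_left (w : ShiftWeight) (x : SeqSpace p) :
    Continuous fun r => branch w r x := by
  rw [show (fun r => branch w r x) = fun r : ℝ => r • branch w 1 0 + branch w 0 x from
    funext fun r => branch_eq w r x]
  fun_prop

theorem continuous_branch_right (w : ShiftWeight) (r : ℝ) :
    Continuous fun x : SeqSpace p => branch w r x := by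
  obtain ⟨C, hC⟩ := exists_lipschitz_branch (p := p) w
  exact (hC r).continuous

theorem measurable_branch (w : ShiftWeight) :
    Measurable fun z : SeqSpace p × ℝ => branch w z.2 z.1 :=
  (measurable_uncurry_of_continuous_of_measurable (u := fun (r : ℝ) (x : SeqSpace p) =>
    branch w r x) (continuous_branch_left w) fun r =>
      (continuous_branch_right w r).measurable).comp measurable_swap

end Shift

section Holder

variable (X : Type*) [MetricSpace X] (α : ℝ≥0) (𝕜 : Type*) [RCLike 𝕜]

/-- The bounded continuous functions on `X` that are `α`-Hölder continuous. -/
def lipSubmodule : Submodule 𝕜 (X →ᵇ 𝕜) where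
  carrier := {f | MemHolder α f}
  zero_mem' := memHolder_zero
  add_mem' := fun hf hg => MemHolder.add hf hg
  smul_mem' := fun _ _ hf => MemHolder.smul hf

/-- The space `Lip_b(D^α, X)` of bounded `α`-Hölder functions `X → 𝕜`, normed by the sum of the
supremum norm and the best Hölder constant. -/
def LipB : Type _ := lipSubmodule X α 𝕜

namespace LipB

noncomputable instance : AddCommGroup (LipB X α 𝕜) :=
  inferInstanceAs (AddCommGroup (lipSubmodule X α 𝕜))

noncomputable instance : Module 𝕜 (LipB X α 𝕜) :=
  inferInstanceAs (Module 𝕜 (lipSubmodule X α 𝕜))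

variable {X α 𝕜}

/-- The underlying bounded continuous function. -/
def toBCF (f : LipB X α 𝕜) : X →ᵇ 𝕜 := f.1

instance : CoeFun (LipB X α 𝕜) fun _ => X → 𝕜 := ⟨fun f => f.toBCF⟩

noncomputable instance : Norm (LipB X α 𝕜) := ⟨fun f => ‖f.toBCF‖ + nnHolderNorm α f⟩

theorem memHolder (f : LipB X α 𝕜) : MemHolder α f := f.2

theorem norm_def (f : LipB X α 𝕜) : ‖f‖ = ‖f.toBCF‖ + nnHolderNorm α f := rfl

variable (X α 𝕜) in
theorem core : NormedSpace.Core 𝕜 (LipB X α 𝕜) where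
  norm_nonneg f := by rw [norm_def]; positivity
  norm_smul c f := by
    have h1 : ‖c • f.toBCF‖ = ‖c‖ * ‖f.toBCF‖ := norm_smul _ _
    have h2 := f.memHolder.nnHolderNorm_smul c
    change ‖c • f.toBCF‖ + (nnHolderNorm α (c • (f : X → 𝕜)) : ℝ) = _
    rw [h1, h2, norm_def, NNReal.coe_mul, coe_nnnorm]
    ring
  norm_triangle f g := by
    have h1 : ‖f.toBCF + g.toBCF‖ ≤ ‖f.toBCF‖ + ‖g.toBCF‖ := norm_add_le _ _
    have h2 := NNReal.coe_le_coe.2 (f.memHolder.nnHolderNorm_add_le g.memHolder)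
    change ‖f.toBCF + g.toBCF‖ + (nnHolderNorm α ((f : X → 𝕜) + (g : X → 𝕜)) : ℝ) ≤ _
    rw [norm_def, norm_def]
    rw [NNReal.coe_add] at h2
    linarith
  norm_eq_zero_iff f := by
    constructor
    · intro h
      rw [norm_def] at h
      have h1 : ‖f.toBCF‖ = 0 := by
        have := norm_nonneg f.toBCF
        have := (nnHolderNorm α f).coe_nonneg
        linarith
      exact Subtype.ext (norm_eq_zero.1 h1)
    · rintro rfl
      change ‖(0 : X →ᵇ 𝕜)‖ + (nnHolderNorm α (0 : X → 𝕜) : ℝ) = 0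
      simp

noncomputable instance : NormedAddCommGroup (LipB X α 𝕜) := NormedAddCommGroup.ofCore (core X α 𝕜)

noncomputable instance : NormedSpace 𝕜 (LipB X α 𝕜) := NormedSpace.ofCore (core X α 𝕜)

theorem norm_apply_le (f : LipB X α 𝕜) (x : X) : ‖f x‖ ≤ ‖f‖ :=
  (f.toBCF.norm_coe_le_norm x).trans (by rw [norm_def]; simp)

theorem norm_sub_le (f : LipB X α 𝕜) (x y : X) : ‖f x - f y‖ ≤ ‖f‖ * dist x y ^ (α : ℝ) := by
  have h := f.memHolder.holderWith.dist_le x y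
  rw [dist_eq_norm] at h
  refine h.trans ?_
  gcongr
  rw [norm_def]
  simp

/-- The element of `Lip_b` given by a function with a bound and a Hölder constant. -/
noncomputable def mk' (f : X → 𝕜) (hf : Continuous f) (M H : ℝ≥0) (hM : ∀ x, ‖f x‖ ≤ M)
    (hH : HolderWith H α f) : LipB X α 𝕜 :=
  ⟨BoundedContinuousFunction.ofNormedAddCommGroup f hf M hM, hH.memHolder⟩

theorem norm_mk'_le (f : X → 𝕜) (hf : Continuous f) (M H : ℝ≥0) (hM : ∀ x, ‖f x‖ ≤ M)
    (hH : HolderWith H α f) : ‖mk' f hf M H hM hH‖ ≤ M + H := by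
  have h1 := BoundedContinuousFunction.norm_ofNormedAddCommGroup_le hf M.2 hM
  have h2 : nnHolderNorm α f ≤ H := hH.nnholderNorm_le
  exact add_le_add h1 (NNReal.coe_le_coe.2 h2)

end LipB

end Holder

section Ruelle

variable {p : ℝ≥0∞} [Fact (1 ≤ p)]

/-- The Ruelle operator with a priori measure `m` and potential `A`:
`(L_A φ)(x) = ∫ e^{A(r, x₁/α₁, x₂/α₂, …)} φ(r, x₁/α₁, x₂/α₂, …) dm(r)`. -/
noncomputable def ruelle {E : Type*} [NormedAddCommGroup E] [NormedSpace ℝ E] (w : ShiftWeight)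
    (m : Measure ℝ) (A : SeqSpace p → ℝ) (φ : SeqSpace p → E) (x : SeqSpace p) : E :=
  ∫ r, Real.exp (A (branch w r x)) • φ (branch w r x) ∂m

/-- The potential `A` is normalized: `L_A 1 = 1`. -/
def IsNormalized (w : ShiftWeight) (m : Measure ℝ) (A : SeqSpace p → ℝ) : Prop :=
  ∀ x, ruelle w m A (fun _ => (1 : ℝ)) x = 1

variable {α : ℝ≥0} {𝕜 : Type*} [RCLike 𝕜]

theorem exp_bound (A : LipB (SeqSpace p) α ℝ) (x : SeqSpace p) :
    Real.exp (A x) ≤ Real.exp ‖A‖ :=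
  Real.exp_le_exp.2 ((le_abs_self _).trans (A.norm_apply_le x))

theorem abs_exp_sub_exp_le {K a b : ℝ} (ha : a ≤ K) (hb : b ≤ K) :
    |Real.exp a - Real.exp b| ≤ Real.exp K * |a - b| := by
  wlog h : b ≤ a generalizing a b
  · rw [abs_sub_comm, abs_sub_comm a b]
    exact this hb ha (le_of_not_ge h)
  rw [abs_of_nonneg (sub_nonneg.2 (Real.exp_le_exp.2 h)), abs_of_nonneg (sub_nonneg.2 h)]
  have h1 := Real.add_one_le_exp (b - a)
  have h2 : Real.exp b = Real.exp a * Real.exp (b - a) := by rw [← Real.exp_add]; ring_nf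
  have h3 : Real.exp a ≤ Real.exp K := Real.exp_le_exp.2 ha
  calc Real.exp a - Real.exp b = Real.exp a * (1 - Real.exp (b - a)) := by rw [h2]; ring
    _ ≤ Real.exp a * (a - b) := mul_le_mul_of_nonneg_left (by linarith) (Real.exp_pos a).le
    _ ≤ Real.exp K * (a - b) := mul_le_mul_of_nonneg_right h3 (sub_nonneg.2 h)

theorem ruelle_integrand_norm_le (A : LipB (SeqSpace p) α ℝ)
    (φ : LipB (SeqSpace p) α 𝕜) (v : SeqSpace p) :
    ‖Real.exp (A v) • φ v‖ ≤ Real.exp ‖A‖ * ‖φ‖ := by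
  rw [norm_smul, Real.norm_eq_abs, Real.abs_exp]
  exact mul_le_mul (exp_bound A v) (φ.norm_apply_le v) (norm_nonneg _) (Real.exp_pos _).le

theorem ruelle_integrand_continuous (A : LipB (SeqSpace p) α ℝ) (φ : LipB (SeqSpace p) α 𝕜) :
    Continuous fun v => Real.exp (A v) • φ v :=
  (Real.continuous_exp.comp A.toBCF.continuous).smul φ.toBCF.continuous

theorem ruelle_integrable (w : ShiftWeight) (m : Measure ℝ) [IsProbabilityMeasure m]
    (A : LipB (SeqSpace p) α ℝ) (φ : LipB (SeqSpace p) α 𝕜) (x : SeqSpace p) :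
    Integrable (fun r => Real.exp (A (branch w r x)) • φ (branch w r x)) m :=
  Integrable.of_bound
    ((ruelle_integrand_continuous A φ).comp (continuous_branch_left w x)).aestronglyMeasurable
    (Real.exp ‖A‖ * ‖φ‖) (Eventually.of_forall fun _ => ruelle_integrand_norm_le A φ _)

theorem ruelle_continuous (w : ShiftWeight) (m : Measure ℝ) [IsProbabilityMeasure m]
    (A : LipB (SeqSpace p) α ℝ) (φ : LipB (SeqSpace p) α 𝕜) : Continuous (ruelle w m A φ) :=
  continuous_of_dominated (fun x => (ruelle_integrable w m A φ x).aestronglyMeasurable)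
    (fun _ => Eventually.of_forall fun _ => ruelle_integrand_norm_le A φ _)
    (integrable_const _)
    (Eventually.of_forall fun r =>
      (ruelle_integrand_continuous A φ).comp (continuous_branch_right w r))

theorem ruelle_norm_le (w : ShiftWeight) (m : Measure ℝ) [IsProbabilityMeasure m]
    (A : LipB (SeqSpace p) α ℝ) (φ : LipB (SeqSpace p) α 𝕜) (x : SeqSpace p) :
    ‖ruelle w m A φ x‖ ≤ Real.exp ‖A‖ * ‖φ‖ := by
  have h := norm_integral_le_of_norm_le_const (μ := m)
    (f := fun r => Real.exp (A (branch w r x)) • φ (branch w r x))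
    (Eventually.of_forall fun _ => ruelle_integrand_norm_le A φ _)
  simpa [ruelle] using h

theorem ruelle_sub_le (w : ShiftWeight) (m : Measure ℝ) [IsProbabilityMeasure m]
    (A : LipB (SeqSpace p) α ℝ) (φ : LipB (SeqSpace p) α 𝕜) {C : ℝ≥0}
    (hC : ∀ r, LipschitzWith C (branch (p := p) w r)) (x y : SeqSpace p) :
    ‖ruelle w m A φ x - ruelle w m A φ y‖ ≤
      Real.exp ‖A‖ * (1 + ‖A‖) * C ^ (α : ℝ) * ‖φ‖ * dist x y ^ (α : ℝ) := by
  have key : ∀ u v : SeqSpace p, ‖Real.exp (A u) • φ u - Real.exp (A v) • φ v‖ ≤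
      Real.exp ‖A‖ * (1 + ‖A‖) * ‖φ‖ * dist u v ^ (α : ℝ) := by
    intro u v
    have hA : ∀ z, A z ≤ ‖A‖ := fun z => (le_abs_self _).trans (A.norm_apply_le z)
    have e : Real.exp (A u) • φ u - Real.exp (A v) • φ v =
        Real.exp (A u) • (φ u - φ v) + (Real.exp (A u) - Real.exp (A v)) • φ v := by
      rw [smul_sub, sub_smul]; abel
    rw [e]
    refine (norm_add_le _ _).trans ?_
    rw [norm_smul, norm_smul, Real.norm_eq_abs, Real.norm_eq_abs, Real.abs_exp]
    have h1 : Real.exp (A u) * ‖φ u - φ v‖ ≤ Real.exp ‖A‖ * (‖φ‖ * dist u v ^ (α : ℝ)) :=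
      mul_le_mul (exp_bound A u) (φ.norm_sub_le u v) (norm_nonneg _) (Real.exp_pos _).le
    have h2 : |Real.exp (A u) - Real.exp (A v)| ≤
        Real.exp ‖A‖ * (‖A‖ * dist u v ^ (α : ℝ)) :=
      (abs_exp_sub_exp_le (hA u) (hA v)).trans
        (mul_le_mul_of_nonneg_left (A.norm_sub_le u v) (Real.exp_pos _).le)
    have h3 := mul_le_mul h2 (φ.norm_apply_le v) (norm_nonneg _) (by positivity)
    linarith
  have hx := ruelle_integrable w m A φ x
  have hy := ruelle_integrable w m A φ y
  unfold ruelle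
  rw [← integral_sub hx hy]
  have h := norm_integral_le_of_norm_le_const (μ := m)
    (f := fun r => Real.exp (A (branch w r x)) • φ (branch w r x) -
      Real.exp (A (branch w r y)) • φ (branch w r y))
    (C := Real.exp ‖A‖ * (1 + ‖A‖) * C ^ (α : ℝ) * ‖φ‖ * dist x y ^ (α : ℝ))
    (Eventually.of_forall fun r => by
      refine (key _ _).trans ?_
      have h1 : dist (branch w r x) (branch w r y) ^ (α : ℝ) ≤
          (C : ℝ) ^ (α : ℝ) * dist x y ^ (α : ℝ) := by
        rw [← Real.mul_rpow (NNReal.coe_nonneg C) dist_nonneg]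
        exact Real.rpow_le_rpow dist_nonneg ((hC r).dist_le_mul x y) (NNReal.coe_nonneg α)
      calc _ ≤ Real.exp ‖A‖ * (1 + ‖A‖) * ‖φ‖ * ((C : ℝ) ^ (α : ℝ) * dist x y ^ (α : ℝ)) :=
            mul_le_mul_of_nonneg_left h1 (by positivity)
        _ = _ := by ring)
  simpa using h

theorem holderWith_of_norm_sub_le {X : Type*} [MetricSpace X] {f : X → 𝕜} {H : ℝ≥0}
    (h : ∀ x y, ‖f x - f y‖ ≤ H * dist x y ^ (α : ℝ)) : HolderWith H α f := by
  intro x y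
  rw [edist_dist, edist_dist, ENNReal.ofReal_rpow_of_nonneg dist_nonneg (NNReal.coe_nonneg α),
    dist_eq_norm]
  rw [← ENNReal.ofReal_coe_nnreal, ← ENNReal.ofReal_mul (NNReal.coe_nonneg H)]
  exact ENNReal.ofReal_le_ofReal (h x y)

/-- The Ruelle operator of a bounded `α`-Hölder potential, acting as a bounded operator on
`Lip_b(D_X^α, X)`. -/
noncomputable def ruelleLip (𝕜 : Type*) [RCLike 𝕜] (w : ShiftWeight) (m : Measure ℝ)
    [IsProbabilityMeasure m] (A : LipB (SeqSpace p) α ℝ) :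
    LipB (SeqSpace p) α 𝕜 →L[𝕜] LipB (SeqSpace p) α 𝕜 :=
  LinearMap.mkContinuousOfExistsBound
    { toFun := fun φ =>
        LipB.mk' (ruelle w m A φ) (ruelle_continuous w m A φ)
          ⟨Real.exp ‖A‖ * ‖φ‖, by positivity⟩
          ⟨Real.exp ‖A‖ * (1 + ‖A‖) * (exists_lipschitz_branch (p := p) w).choose ^ (α : ℝ) * ‖φ‖,
            by positivity⟩
          (ruelle_norm_le w m A φ)
          (holderWith_of_norm_sub_le
            (ruelle_sub_le w m A φ (exists_lipschitz_branch (p := p) w).choose_spec))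
      map_add' := fun φ ψ => Subtype.ext <| BoundedContinuousFunction.ext fun x => by
        change ∫ r, Real.exp (A (branch w r x)) • (φ (branch w r x) + ψ (branch w r x)) ∂m =
          ∫ r, Real.exp (A (branch w r x)) • φ (branch w r x) ∂m +
            ∫ r, Real.exp (A (branch w r x)) • ψ (branch w r x) ∂m
        rw [← integral_add (ruelle_integrable w m A φ x) (ruelle_integrable w m A ψ x)]
        simp only [smul_add]
      map_smul' := fun c φ => Subtype.ext <| BoundedContinuousFunction.ext fun x => by
        change ∫ r, Real.exp (A (branch w r x)) • (c • φ (branch w r x)) ∂m =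
          c • ∫ r, Real.exp (A (branch w r x)) • φ (branch w r x) ∂m
        rw [← integral_smul]
        simp only [smul_comm c] }
    (by
      refine ⟨Real.exp ‖A‖ + Real.exp ‖A‖ * (1 + ‖A‖) *
        (exists_lipschitz_branch (p := p) w).choose ^ (α : ℝ), fun φ => ?_⟩
      refine (LipB.norm_mk'_le _ (ruelle_continuous w m A φ)
          ⟨Real.exp ‖A‖ * ‖φ‖, by positivity⟩
          ⟨Real.exp ‖A‖ * (1 + ‖A‖) * (exists_lipschitz_branch (p := p) w).choose ^ (α : ℝ) * ‖φ‖,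
            by positivity⟩
          (ruelle_norm_le w m A φ)
          (holderWith_of_norm_sub_le
            (ruelle_sub_le w m A φ (exists_lipschitz_branch (p := p) w).choose_spec))).trans
        (le_of_eq ?_)
      change Real.exp ‖A‖ * ‖φ‖ + Real.exp ‖A‖ * (1 + ‖A‖) *
        ((exists_lipschitz_branch (p := p) w).choose : ℝ) ^ (α : ℝ) * ‖φ‖ = _
      ring)

theorem ruelleLip_apply (w : ShiftWeight) (m : Measure ℝ) [IsProbabilityMeasure m]
    (A : LipB (SeqSpace p) α ℝ) (φ : LipB (SeqSpace p) α 𝕜) (x : SeqSpace p) :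
    ruelleLip 𝕜 w m A φ x = ruelle w m A φ x := rfl

/-- The dual Ruelle operator on (σ-additive) measures: `L_A^* μ` is the measure with
`∫ φ d(L_A^* μ) = ∫ L_A φ dμ` for all bounded continuous `φ`, see `integral_dualRuelle`. -/
noncomputable def dualRuelle (w : ShiftWeight) (m : Measure ℝ) (A : SeqSpace p → ℝ)
    (μ : Measure (SeqSpace p)) : Measure (SeqSpace p) :=
  ((μ.prod m).map fun z => branch w z.2 z.1).withDensity fun v => ENNReal.ofReal (Real.exp (A v))

theorem integral_dualRuelle (w : ShiftWeight) (m : Measure ℝ) [IsProbabilityMeasure m]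
    (A : SeqSpace p →ᵇ ℝ) (μ : Measure (SeqSpace p)) [IsFiniteMeasure μ] (φ : SeqSpace p →ᵇ ℝ) :
    ∫ v, φ v ∂(dualRuelle w m A μ) = ∫ x, ruelle w m A φ x ∂μ := by
  have hA : Measurable fun v => Real.exp (A v) :=
    (Real.continuous_exp.comp A.continuous).measurable
  have hm : Measurable fun v => Real.exp (A v) • φ v := hA.smul φ.continuous.measurable
  have hb : ∀ v, ‖Real.exp (A v) • φ v‖ ≤ Real.exp ‖A‖ * ‖φ‖ := by
    intro v
    rw [norm_smul, Real.norm_eq_abs, Real.abs_exp]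
    exact mul_le_mul (Real.exp_le_exp.2 ((le_abs_self _).trans (A.norm_coe_le_norm v)))
      (φ.norm_coe_le_norm v) (norm_nonneg _) (Real.exp_pos _).le
  unfold dualRuelle ruelle
  rw [integral_withDensity_eq_integral_toReal_smul hA.ennreal_ofReal
    (Eventually.of_forall fun _ => ENNReal.ofReal_lt_top)]
  simp only [ENNReal.toReal_ofReal (Real.exp_pos _).le]
  rw [integral_map (measurable_branch w).aemeasurable hm.aestronglyMeasurable,
    integral_prod]
  exact Integrable.of_bound (hm.comp (measurable_branch w)).aestronglyMeasurable _
    (Eventually.of_forall fun z => hb _)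

/-- `V_n(A)`, the supremum of `|A x - A y|` over all `x, y` with the same first `n` coordinates. -/
noncomputable def variation (A : SeqSpace p → ℝ) (n : ℕ) : ℝ≥0∞ :=
  ⨆ (x : SeqSpace p) (y : SeqSpace p) (_ : ∀ i < n, x.coord i = y.coord i),
    ENNReal.ofReal |A x - A y|

/-- The potential `A` has summable variation: `∑_{n ≥ 1} V_n(A) < ∞`. -/
def SummableVariation (A : SeqSpace p → ℝ) : Prop := ∑' n : ℕ, variation A (n + 1) < ∞

/-- The normalization `A + log ψ - log (ψ ∘ L) - log lam` of a potential `A`. -/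
noncomputable def normalization (w : ShiftWeight) (A ψ : SeqSpace p → ℝ) (lam : ℝ) :
    SeqSpace p → ℝ :=
  fun x => A x + Real.log (ψ x) - Real.log (ψ (weightedShift w x)) - Real.log lam

variable (p) in
/-- The measure `m` on `ℝ` has adapted tails, with respect to the weights and the space `X`. The
number `κ_n` of the sequence is `κ.coord (n - 1)`, for `n ≥ 1`. -/
def AdaptedTails (w : ShiftWeight) (m : Measure ℝ) : Prop :=
  ∀ ε : ℝ≥0∞, 0 < ε → ∃ κ : SeqSpace p, (∀ n, 0 < κ.coord n) ∧
    ∑' n : ℕ, m (Set.Icc (-(w.beta 0 (n + 1) * κ.coord n)) (w.beta 0 (n + 1) * κ.coord n))ᶜ < ε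

/-- A `σ`-additive Borel probability measure that is fixed by the dual Ruelle operator. -/
def IsGibbs (w : ShiftWeight) (m : Measure ℝ) (A : SeqSpace p → ℝ) (μ : Measure (SeqSpace p)) :
    Prop :=
  IsProbabilityMeasure μ ∧ dualRuelle w m A μ = μ

end Ruelle

/-- (Strong) mixing of a measure preserving map. -/
def IsMixing {Ω : Type*} [MeasurableSpace Ω] (T : Ω → Ω) (μ : Measure Ω) : Prop :=
  MeasurePreserving T μ μ ∧ ∀ S U : Set Ω, MeasurableSet S → MeasurableSet U →
    Tendsto (fun n : ℕ => μ (S ∩ T^[n] ⁻¹' U)) atTop (𝓝 (μ S * μ U))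

section Gibbs

variable {p : ℝ≥0∞} [Fact (1 ≤ p)]

/-- The dual Ruelle operator of the potential `A` has exactly one fixed Borel probability measure
`μ`; the images of every Borel probability measure `ν` under its iterates converge to `μ` in the
weak-* topology; and `μ` is `L`-invariant and mixing, hence conservative and ergodic. -/
def HasAttractingMixingGibbs (w : ShiftWeight) (m : Measure ℝ) (A : SeqSpace p → ℝ) : Prop :=
  ∃ μ : Measure (SeqSpace p), IsGibbs w m A μ ∧
    (∀ ν : Measure (SeqSpace p), IsGibbs w m A ν → ν = μ) ∧
    (∀ ν : Measure (SeqSpace p), IsProbabilityMeasure ν → ∀ f : SeqSpace p →ᵇ ℝ,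
      Tendsto (fun n : ℕ => ∫ x, f x ∂((dualRuelle w m A)^[n] ν)) atTop (𝓝 (∫ x, f x ∂μ))) ∧
    MeasurePreserving (weightedShift w : SeqSpace p → SeqSpace p) μ μ ∧
    IsMixing (weightedShift w : SeqSpace p → SeqSpace p) μ ∧
    Conservative (weightedShift w : SeqSpace p → SeqSpace p) μ ∧
    Ergodic (weightedShift w : SeqSpace p → SeqSpace p) μ

/-- Every Borel probability measure `μ` fixed by the dual Ruelle operator of `A` satisfies
`supp μ ⊇ π₁⁻¹(supp m)` and `supp μ = X`, where `π₁` is the projection on the first coordinate. -/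
def GibbsFullSupport (w : ShiftWeight) (m : Measure ℝ) (A : SeqSpace p → ℝ) : Prop :=
  ∀ μ : Measure (SeqSpace p), IsGibbs w m A μ →
    (fun x : SeqSpace p => x.coord 0) ⁻¹' m.support ⊆ μ.support ∧ μ.support = Set.univ

end Gibbs

/-!
The Ruelle operator `L_A` averages over the inverse branches `x ↦ (r, x₁/α₁, x₂/α₂, …)` of the
shift `L`. After `n` steps two points `x, y` that follow the same branches agree in `n` coordinates
and are at distance at most `d_n⁻¹ ‖x - y‖` (`IsDescendant.norm_sub_le`). A bound `E` for the
oscillation of the Birkhoff sums of `A` along such pairs (`DistortionBound`) therefore compares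
`L_A^n f (x)` with `e^E L_A^n f (y)` (`ruelleENN_iterate_le`). The summability of `d_n^{-α}` gives
a bound of order `‖x - y‖^α`; summable variation gives a bound `V` that is uniform in `x` and `y`.

*Eigenfunction.* With a uniform bound, `log L_A^n 1 (0)` is almost additive, so that `L_A^n 1` is
comparable to `λ^n` (`exists_growth_rate`). The function `ψ₀ = limsup λ^{-n} L_A^n 1` satisfies
`ψ₀ ≤ λ⁻¹ L_A ψ₀` by the reverse Fatou lemma; hence `λ^{-k} L_A^k ψ₀` increases, and its limit is an
eigenfunction, Hölder and bounded away from `0` by the distortion bounds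
(`exists_eigenfunction_ennreal`). The same bounds give `‖L_A^n‖ ≤ C λ^n` on real or complex Hölder
functions, hence the spectral radius. A positive eigenfunction `φ` has eigenvalue `λ`: it is at
most `λ` as `φ` is bounded, and at least `λ` because compact boxes are left by the inverse branches
only with small probability (`eigenvalue_le_of_pos_eigenfunction`). Subtracting from `φ` the
largest multiple of `ψ` leaves a nonnegative eigenfunction with ratio infimum `0`, which vanishes
by a Harnack inequality (`eigenfunction_harnack`).

*Gibbs measure of a normalized potential.* Here `L_A` is a Markov operator and the iterates of its
dual are the laws of a chain of inverse branches. Adapted tails keep this chain, up to probability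
`ε`, close to a compact box `{|x_n| ≤ κ_n}` (`exists_box_of_adaptedTails`). This makes the laws of
the chain started at `0` tight, and it makes one fixed ball recurrent. On this ball the distortion
bound acts as a Doeblin condition: every asymptotic bound for the oscillation of `L_A^n f` on
bounded sets can be improved by a fixed factor (`OscillationBound.contract`), so that the
oscillation tends to `0`, even without summable variation. With Prokhorov's theorem, existence,
uniqueness and attraction follow. Mixing is attraction applied to the conditional measures
`μ(· | U)`, whose images under the dual operator are the conditional measures `μ(· | L^{-n} U)`
(`IsGibbs.isMixing`).

*Support.* The support of a fixed measure is closed and invariant under all inverse branches, whose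
orbits are dense (`dense_of_branch_mem`).
-/

/-! ### Geometry of the sequence space -/

namespace SeqSpace

variable {p : ℝ≥0∞}

theorem coord_sub [Fact (1 ≤ p)] (x y : SeqSpace p) (n : ℕ) :
    (x - y).coord n = x.coord n - y.coord n := rfl

theorem coord_add [Fact (1 ≤ p)] (x y : SeqSpace p) (n : ℕ) :
    (x + y).coord n = x.coord n + y.coord n := rfl

theorem coord_zero [Fact (1 ≤ p)] (n : ℕ) : (0 : SeqSpace p).coord n = 0 := rfl

theorem norm_coord_le [hp : Fact (1 ≤ p)] (x : SeqSpace p) (n : ℕ) : |x.coord n| ≤ ‖x‖ :=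
  lp.norm_apply_le_norm (zero_lt_one.trans_le hp.1).ne' x.1 n

theorem continuous_coord [Fact (1 ≤ p)] (n : ℕ) : Continuous fun x : SeqSpace p => x.coord n :=
  (LipschitzWith.of_dist_le_mul (K := 1) fun x y => by
    rw [dist_eq_norm, dist_eq_norm, NNReal.coe_one, one_mul, Real.norm_eq_abs, ← coord_sub]
    exact norm_coord_le _ n).continuous

/-- Shifting a sequence `n` places to the right, with factors of modulus at most `C`, multiplies
the norm by at most `C`. -/
theorem norm_le_of_shift [hp : Fact (1 ≤ p)] {x y : SeqSpace p} {C : ℝ} (hC : 0 ≤ C) (n : ℕ)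
    (h0 : ∀ i < n, y.coord i = 0) (h : ∀ k, |y.coord (n + k)| ≤ C * |x.coord k|) :
    ‖y‖ ≤ C * ‖x‖ := by
  change ‖y.1‖ ≤ C * ‖x.1‖
  rcases eq_or_ne p ∞ with rfl | hpt
  · refine lp.norm_le_of_forall_le (by positivity) fun i => ?_
    rcases lt_or_ge i n with hi | hi
    · have : y.1.1 i = 0 := h0 i hi
      change ‖y.1.1 i‖ ≤ _
      rw [this, norm_zero]; positivity
    · obtain ⟨k, rfl⟩ := Nat.exists_eq_add_of_le hi
      refine (h k).trans ?_
      gcongr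
      exact norm_coord_le x k
  · have hp' : 0 < p.toReal := ENNReal.toReal_pos (by have := hp.1; positivity) hpt
    refine lp.norm_le_of_tsum_le hp' (by positivity) ?_
    have hx := (lp.memℓp x.1).summable hp'
    have hy := (lp.memℓp y.1).summable hp'
    have hz : ∑ i ∈ Finset.range n, ‖y.1 i‖ ^ p.toReal = 0 := by
      refine Finset.sum_eq_zero fun i hi => ?_
      have : y.1 i = 0 := h0 i (Finset.mem_range.1 hi)
      rw [this, norm_zero, Real.zero_rpow hp'.ne']
    rw [Real.mul_rpow hC (norm_nonneg _), lp.norm_rpow_eq_tsum hp' x.1,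
      ← hy.sum_add_tsum_nat_add n, hz, zero_add, ← tsum_mul_left]
    refine Summable.tsum_le_tsum (fun k => ?_) ((summable_nat_add_iff n).2 hy) (hx.mul_left _)
    rw [← Real.mul_rpow hC (norm_nonneg _), add_comm k n]
    gcongr
    exact h k

theorem norm_le_of_coord_le [Fact (1 ≤ p)] {x y : SeqSpace p} {C : ℝ} (hC : 0 ≤ C)
    (h : ∀ k, |y.coord k| ≤ C * |x.coord k|) : ‖y‖ ≤ C * ‖x‖ :=
  norm_le_of_shift hC 0 (by simp) (by simpa using h)

/-- A sequence dominated by a point of `X`, as a point of `X`. -/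
def ofDominated (x : SeqSpace p) (y : ℕ → ℝ) (h : ∀ n, |y n| ≤ |x.coord n|) : SeqSpace p :=
  ⟨⟨y, (lp.memℓp x.1).mono' h⟩, squeeze_zero_norm h (by simpa using! x.2.abs)⟩

/-- The sequence `x` with its first `n` coordinates replaced by `0`. -/
noncomputable def tail (n : ℕ) (x : SeqSpace p) : SeqSpace p :=
  ofDominated x (fun i => if i < n then 0 else x.coord i) fun i => by
    split_ifs <;> simp

theorem tail_coord (n : ℕ) (x : SeqSpace p) (i : ℕ) :
    (tail n x).coord i = if i < n then 0 else x.coord i := rfl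

theorem tendsto_norm_tail [hp : Fact (1 ≤ p)] (x : SeqSpace p) :
    Tendsto (fun n => ‖tail n x‖) atTop (𝓝 0) := by
  rcases eq_or_ne p ∞ with rfl | hpt
  · rw [Metric.tendsto_atTop]
    intro ε hε
    obtain ⟨N, hN⟩ := Metric.tendsto_atTop.1 x.2 (ε / 2) (by positivity)
    refine ⟨N, fun n hn => ?_⟩
    rw [dist_zero_right, norm_norm]
    refine lt_of_le_of_lt ?_ (half_lt_self hε)
    change ‖(tail n x).1‖ ≤ _
    refine lp.norm_le_of_forall_le (by positivity) fun i => ?_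
    change ‖(tail n x).coord i‖ ≤ _
    rw [tail_coord]
    split_ifs with hi
    · rw [norm_zero]; positivity
    · have := hN i (hn.trans (not_lt.1 hi))
      rw [dist_zero_right] at this
      exact this.le
  · have hp' : 0 < p.toReal := ENNReal.toReal_pos (by have := hp.1; positivity) hpt
    have hx := (lp.memℓp x.1).summable hp'
    have key : ∀ n, ‖tail n x‖ = (∑' i, ‖x.1 (i + n)‖ ^ p.toReal) ^ (1 / p.toReal) := by
      intro n
      change ‖(tail n x).1‖ = _
      rw [lp.norm_eq_tsum_rpow hp']
      congr 1
      have hy := (lp.memℓp (tail n x).1).summable hp'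
      rw [← hy.sum_add_tsum_nat_add n]
      have hz : ∑ i ∈ Finset.range n, ‖(tail n x).1 i‖ ^ p.toReal = 0 := by
        refine Finset.sum_eq_zero fun i hi => ?_
        have : (tail n x).1 i = 0 := by
          change (tail n x).coord i = 0
          rw [tail_coord, if_pos (Finset.mem_range.1 hi)]
        rw [this, norm_zero, Real.zero_rpow hp'.ne']
      rw [hz, zero_add]
      refine tsum_congr fun i => ?_
      have : (tail n x).1 (i + n) = x.1 (i + n) := by
        change (tail n x).coord (i + n) = x.coord (i + n)
        rw [tail_coord, if_neg (by omega)]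
      rw [this]
    simp only [key]
    have h0 := tendsto_sum_nat_add fun i => ‖x.1 i‖ ^ p.toReal
    have h1 := h0.rpow_const (p := 1 / p.toReal) (Or.inr (by positivity))
    rwa [Real.zero_rpow (by positivity)] at h1

/-- The basis vector `e_n`. -/
noncomputable def basisVec [Fact (1 ≤ p)] (n : ℕ) : SeqSpace p :=
  ⟨lp.single (E := fun _ : ℕ => ℝ) p n 1, by
    refine tendsto_const_nhds.congr' ?_
    filter_upwards [eventually_gt_atTop n] with i hi
    simp [hi.ne']⟩

theorem basisVec_coord [hp : Fact (1 ≤ p)] (n i : ℕ) :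
    (basisVec n : SeqSpace p).coord i = if i = n then 1 else 0 := by
  change (lp.single (E := fun _ : ℕ => ℝ) p n 1) i = _
  simp [Pi.single_apply]

theorem norm_basisVec_le [hp : Fact (1 ≤ p)] (n : ℕ) : ‖(basisVec n : SeqSpace p)‖ ≤ 1 := by
  change ‖lp.single (E := fun _ : ℕ => ℝ) p n 1‖ ≤ 1
  rw [lp.norm_single (zero_lt_one.trans_le hp.1)]
  simp

theorem coord_sum [Fact (1 ≤ p)] {ι : Type*} (s : Finset ι) (f : ι → SeqSpace p) (n : ℕ) :
    (∑ i ∈ s, f i).coord n = ∑ i ∈ s, (f i).coord n := by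
  classical
  induction s using Finset.induction_on with
  | empty => simp [coord_zero]
  | insert a s ha ih => rw [Finset.sum_insert ha, Finset.sum_insert ha, coord_add, ih]

theorem coord_smul [Fact (1 ≤ p)] (c : ℝ) (x : SeqSpace p) (n : ℕ) :
    (c • x).coord n = c * x.coord n := rfl

theorem eq_sum_add_tail [Fact (1 ≤ p)] (n : ℕ) (x : SeqSpace p) :
    x = ∑ i ∈ Finset.range n, x.coord i • (basisVec i : SeqSpace p) + tail n x := by
  refine ext_coord fun k => ?_
  rw [coord_add, coord_sum, tail_coord]
  simp only [coord_smul, basisVec_coord]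
  split_ifs with h
  · simp [h]
  · simp [h]

theorem norm_le_sum_add_tail [Fact (1 ≤ p)] (n : ℕ) (x : SeqSpace p) :
    ‖x‖ ≤ ∑ i ∈ Finset.range n, |x.coord i| + ‖tail n x‖ := by
  conv_lhs => rw [eq_sum_add_tail n x]
  refine (norm_add_le _ _).trans (add_le_add_left ?_ _)
  refine (norm_sum_le _ _).trans (Finset.sum_le_sum fun i _ => ?_)
  rw [norm_smul, Real.norm_eq_abs]
  exact mul_le_of_le_one_right (abs_nonneg _) (norm_basisVec_le i)

instance instSeparableSpace [Fact (1 ≤ p)] : TopologicalSpace.SeparableSpace (SeqSpace p) := by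
  have hs : TopologicalSpace.IsSeparable
      (⋃ n : ℕ, range fun a : Fin n → ℝ => ∑ i, a i • (basisVec (i : ℕ) : SeqSpace p)) := by
    refine TopologicalSpace.IsSeparable.iUnion fun n => ?_
    exact TopologicalSpace.isSeparable_range (by fun_prop)
  rw [← TopologicalSpace.isSeparable_univ_iff]
  refine hs.closure.mono fun x _ => ?_
  refine mem_closure_of_tendsto (f := fun n => x - tail n x) (b := atTop) ?_
    (Eventually.of_forall fun n => mem_iUnion.2 ⟨n, fun i => x.coord i, ?_⟩)
  · have := (tendsto_zero_iff_norm_tendsto_zero.2 (tendsto_norm_tail x)).const_sub x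
    simpa using this
  · rw [eq_sub_iff_add_eq]
    conv_rhs => rw [eq_sum_add_tail n x]
    rw [Finset.sum_range]

instance instSecondCountable [Fact (1 ≤ p)] : SecondCountableTopology (SeqSpace p) :=
  UniformSpace.secondCountable_of_separable _

/-- The set of the points of `X` dominated coordinatewise by a given point of `X`. -/
def orderBox (κ : SeqSpace p) : Set (SeqSpace p) := {x | ∀ n, |x.coord n| ≤ |κ.coord n|}

/-- On a box, the norm topology is the product topology, since the tails are uniformly small. -/
theorem isCompact_orderBox [Fact (1 ≤ p)] (κ : SeqSpace p) : IsCompact (orderBox κ) := by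
  let S : Set (ℕ → ℝ) := Set.pi univ fun n => Icc (-|κ.coord n|) |κ.coord n|
  have hS : IsCompact S := isCompact_univ_pi fun n => isCompact_Icc
  have hmem : ∀ y : S, ∀ n, |y.1 n| ≤ |κ.coord n| := fun y n => abs_le.2 (y.2 n (mem_univ n))
  let Φ : S → SeqSpace p := fun y => ofDominated κ y.1 (hmem y)
  have hΦ : Continuous Φ := by
    refine continuous_iff_continuousAt.2 fun y => ?_
    rw [ContinuousAt, tendsto_iff_norm_sub_tendsto_zero, Metric.tendsto_nhds]
    intro ε hε
    have ht := tendsto_norm_tail κ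
    obtain ⟨n, hn⟩ := (ht.eventually (gt_mem_nhds (show 0 < ε / 4 by positivity))).exists
    have hc : Tendsto (fun z : S => ∑ i ∈ Finset.range n, |z.1 i - y.1 i|) (𝓝 y) (𝓝 0) := by
      have : Continuous fun z : S => ∑ i ∈ Finset.range n, |z.1 i - y.1 i| :=
        continuous_finsetSum _ fun i _ =>
          (((continuous_apply i).comp continuous_subtype_val).sub continuous_const).abs
      simpa using this.tendsto y
    filter_upwards [hc.eventually (gt_mem_nhds (show 0 < ε / 2 by positivity))] with z hz
    rw [dist_zero_right, norm_norm]
    have h1 := norm_le_sum_add_tail n (Φ z - Φ y)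
    have h2 : ‖tail n (Φ z - Φ y)‖ ≤ 2 * ‖tail n κ‖ := by
      refine norm_le_of_coord_le (by norm_num) fun k => ?_
      rw [tail_coord, tail_coord]
      split_ifs
      · simp
      · have a1 := hmem z k
        have a2 := hmem y k
        calc |(Φ z - Φ y).coord k| = |z.1 k - y.1 k| := rfl
          _ ≤ |z.1 k| + |y.1 k| := abs_sub _ _
          _ ≤ _ := by linarith
    have h3 : ∑ i ∈ Finset.range n, |(Φ z - Φ y).coord i| =
      ∑ i ∈ Finset.range n, |z.1 i - y.1 i| := rfl
    linarith
  have hr : orderBox κ = range Φ := by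
    ext x
    constructor
    · intro hx
      exact ⟨⟨fun n => x.coord n, fun n _ => abs_le.1 (hx n)⟩, rfl⟩
    · rintro ⟨y, rfl⟩
      exact hmem y
  rw [hr]
  have := isCompact_iff_compactSpace.1 hS
  exact isCompact_range hΦ

theorem norm_le_of_mem_orderBox [Fact (1 ≤ p)] {κ x : SeqSpace p} (h : x ∈ orderBox κ) :
    ‖x‖ ≤ ‖κ‖ := by
  simpa using norm_le_of_coord_le (C := 1) zero_le_one (fun k => by simpa using h k)

end SeqSpace

namespace ShiftWeight

variable (w : ShiftWeight)

theorem beta_zero (k : ℕ) : w.beta k 0 = 1 := by simp [beta]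

theorem beta_succ (k n : ℕ) : w.beta k (n + 1) = w.beta k n * w.val (k + n) := by
  simp [beta, Finset.prod_range_succ]

theorem beta_pos (k n : ℕ) : 0 < w.beta k n := Finset.prod_pos fun _ _ => w.val_pos _

theorem d_le_beta (k n : ℕ) : w.d n ≤ w.beta k n :=
  ciInf_le ⟨0, by rintro _ ⟨j, rfl⟩; exact (w.beta_pos j n).le⟩ k

theorem d_pos (n : ℕ) : 0 < w.d n := by
  obtain ⟨c, c', hc, h⟩ := w.bounds
  refine (pow_pos hc n).trans_le (le_ciInf fun k => ?_)
  calc c ^ n = ∏ _i ∈ Finset.range n, c := by simp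
    _ ≤ _ := Finset.prod_le_prod (fun _ _ => hc.le) fun i _ => (h _).1.le

variable {w} {α : ℝ≥0}

theorem tendsto_d_inv (hα : 0 < α) (hd : Summable fun n : ℕ => w.d (n + 1) ^ (-(α : ℝ))) :
    Tendsto (fun n => (w.d n)⁻¹) atTop (𝓝 0) := by
  rw [← tendsto_add_atTop_iff_nat 1]
  have hα' : (0 : ℝ) < α := hα
  have h := hd.tendsto_atTop_zero.rpow_const (p := (α : ℝ)⁻¹) (Or.inr (by positivity))
  rw [Real.zero_rpow (by positivity)] at h
  refine h.congr fun n => ?_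
  rw [← Real.rpow_mul (w.d_pos _).le, neg_mul, mul_inv_cancel₀ hα'.ne', Real.rpow_neg_one]

theorem exists_d_inv_le (hα : 0 < α) (hd : Summable fun n : ℕ => w.d (n + 1) ^ (-(α : ℝ))) :
    ∃ C : ℝ, 0 ≤ C ∧ ∀ n, (w.d n)⁻¹ ≤ C := by
  obtain ⟨C, hC⟩ := (tendsto_d_inv hα hd).bddAbove_range
  have h : ∀ n, (w.d n)⁻¹ ≤ C := fun n => hC ⟨n, rfl⟩
  exact ⟨C, (inv_pos.2 (w.d_pos 0)).le.trans (h 0), h⟩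

/-- The sequence `(R / β_1^n)` lies in `X`: it is even in `ℓ^α`. -/
theorem exists_coord_eq_div_beta {p : ℝ≥0∞} [hp : Fact (1 ≤ p)] (hα : 0 < α) (hα1 : α ≤ 1)
    (hd : Summable fun n : ℕ => w.d (n + 1) ^ (-(α : ℝ))) (R : ℝ) :
    ∃ κ : SeqSpace p, ∀ n, κ.coord n = R / w.beta 0 n := by
  have hα' : (0 : ℝ) < α := hα
  have hle : ∀ n, (w.beta 0 n)⁻¹ ≤ (w.d n)⁻¹ := fun n => inv_anti₀ (w.d_pos n) (w.d_le_beta 0 n)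
  have h0 : ∀ n, 0 ≤ (w.beta 0 n)⁻¹ := fun n => (inv_pos.2 (w.beta_pos 0 n)).le
  have hm : Memℓp (fun n => (w.beta 0 n)⁻¹) (α : ℝ≥0∞) := by
    refine memℓp_gen ?_
    rw [← summable_nat_add_iff 1]
    refine Summable.of_nonneg_of_le (fun n => by positivity) (fun n => ?_) hd
    rw [ENNReal.coe_toReal, Real.norm_of_nonneg (h0 _), Real.rpow_neg (w.d_pos _).le,
      ← Real.inv_rpow (w.d_pos _).le]
    exact Real.rpow_le_rpow (h0 _) (hle _) hα'.le
  have hm' : Memℓp (fun n => R * (w.beta 0 n)⁻¹) p :=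
    (hm.of_exponent_ge ((ENNReal.coe_le_one_iff.2 hα1).trans hp.1)).const_mul R
  have ht : Tendsto (fun n => R * (w.beta 0 n)⁻¹) atTop (𝓝 0) := by
    simpa using (squeeze_zero h0 hle (tendsto_d_inv hα hd)).const_mul R
  exact ⟨⟨⟨_, hm'⟩, ht⟩, fun n => (div_eq_mul_inv _ _).symm⟩

end ShiftWeight

/-! ### The Ruelle operator on nonnegative functions -/

section RuelleENN

variable {p : ℝ≥0∞} [Fact (1 ≤ p)]

/-- The Ruelle operator acting on functions with values in `[0, ∞]`, through the Lebesgue integral,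
so that no integrability is needed. -/
noncomputable def ruelleENN (w : ShiftWeight) (m : Measure ℝ) (A : SeqSpace p → ℝ)
    (F : SeqSpace p → ℝ≥0∞) (x : SeqSpace p) : ℝ≥0∞ :=
  ∫⁻ r, ENNReal.ofReal (Real.exp (A (branch w r x))) * F (branch w r x) ∂m

variable {w : ShiftWeight} {m : Measure ℝ} {A : SeqSpace p → ℝ}

theorem ruelleENN_mono {F G : SeqSpace p → ℝ≥0∞} (h : F ≤ G) :
    ruelleENN w m A F ≤ ruelleENN w m A G :=
  fun _ => lintegral_mono fun _ => mul_le_mul_right (h _) _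

theorem monotone_ruelleENN : Monotone (ruelleENN w m A) := fun _ _ h => ruelleENN_mono h

theorem ruelleENN_iterate_mono {F G : SeqSpace p → ℝ≥0∞} (h : F ≤ G) (n : ℕ) :
    (ruelleENN w m A)^[n] F ≤ (ruelleENN w m A)^[n] G :=
  monotone_ruelleENN.iterate n h

theorem measurable_branch_left (w : ShiftWeight) (x : SeqSpace p) :
    Measurable fun r => branch w r x := (continuous_branch_left w x).measurable

theorem measurable_ruelleENN [SFinite m] (hA : Measurable A) {F : SeqSpace p → ℝ≥0∞}
    (hF : Measurable F) : Measurable (ruelleENN w m A F) := by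
  have h : Measurable fun z : SeqSpace p × ℝ =>
      ENNReal.ofReal (Real.exp (A (branch w z.2 z.1))) * F (branch w z.2 z.1) :=
    (hA.exp.ennreal_ofReal.mul hF).comp (measurable_branch w)
  exact h.lintegral_prod_right'

theorem measurable_ruelleENN_iterate [SFinite m] (hA : Measurable A) {F : SeqSpace p → ℝ≥0∞}
    (hF : Measurable F) (n : ℕ) : Measurable ((ruelleENN w m A)^[n] F) := by
  induction n with
  | zero => exact hF
  | succ n ih =>
    rw [Function.iterate_succ_apply']
    exact measurable_ruelleENN hA ih

theorem ruelleENN_const_mul (hA : Measurable A) {F : SeqSpace p → ℝ≥0∞}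
    (hF : Measurable F) (c : ℝ≥0∞) :
    ruelleENN w m A (fun x => c * F x) = fun x => c * ruelleENN w m A F x := by
  funext x
  unfold ruelleENN
  rw [← lintegral_const_mul]
  · exact lintegral_congr fun r => by ring
  · exact (hA.exp.ennreal_ofReal.mul hF).comp (measurable_branch_left w x)

theorem ruelleENN_iterate_const_mul [SFinite m] (hA : Measurable A) {F : SeqSpace p → ℝ≥0∞}
    (hF : Measurable F) (c : ℝ≥0∞) (n : ℕ) :
    (ruelleENN w m A)^[n] (fun x => c * F x) = fun x => c * (ruelleENN w m A)^[n] F x := by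
  induction n with
  | zero => rfl
  | succ n ih =>
    rw [Function.iterate_succ_apply', ih, Function.iterate_succ_apply',
      ruelleENN_const_mul hA (measurable_ruelleENN_iterate hA hF n)]

theorem weightedShift_branch (w : ShiftWeight) (r : ℝ) (x : SeqSpace p) :
    weightedShift w (branch w r x) = x := (weightedShift_eq_iff w _ x).2 ⟨r, rfl⟩

theorem ruelleENN_mul_comp_shift (hA : Measurable A) {F : SeqSpace p → ℝ≥0∞} (hF : Measurable F)
    (G : SeqSpace p → ℝ≥0∞) :
    ruelleENN w m A (fun x => G (weightedShift w x) * F x) =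
      fun x => G x * ruelleENN w m A F x := by
  rw [← funext fun x => congrFun (ruelleENN_const_mul (w := w) (m := m) hA hF (G x)) x]
  funext x
  simp only [ruelleENN, weightedShift_branch]

theorem lintegral_dualRuelle [SFinite m] (hA : Measurable A) (μ : Measure (SeqSpace p))
    [SFinite μ] {F : SeqSpace p → ℝ≥0∞} (hF : Measurable F) :
    ∫⁻ v, F v ∂(dualRuelle w m A μ) = ∫⁻ x, ruelleENN w m A F x ∂μ := by
  unfold dualRuelle ruelleENN
  have hm := hA.exp.ennreal_ofReal.mul hF
  rw [lintegral_withDensity_eq_lintegral_mul _ hA.exp.ennreal_ofReal hF,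
    lintegral_map hm (measurable_branch w)]
  exact lintegral_prod _ (hm.comp (measurable_branch w)).aemeasurable

end RuelleENN

/-! ### Distortion along inverse branches -/

section Distortion

variable {p : ℝ≥0∞}

/-- The pair `(u, v)` arises from `(x, y)` by applying one and the same composition of `j` inverse
branches to both points: `u` and `v` have the same first `j` coordinates, and their further
coordinates differ as those of `x` and `y`, divided by the weights. -/
def IsDescendant (w : ShiftWeight) (x y : SeqSpace p) (j : ℕ) (u v : SeqSpace p) : Prop :=
  (∀ i < j, u.coord i = v.coord i) ∧
    ∀ k, |u.coord (j + k) - v.coord (j + k)| = |x.coord k - y.coord k| / w.beta k j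

variable {w : ShiftWeight} {x y u v : SeqSpace p} {j : ℕ}

theorem isDescendant_zero (w : ShiftWeight) (x y : SeqSpace p) : IsDescendant w x y 0 x y :=
  ⟨by simp, by simp [ShiftWeight.beta_zero]⟩

/-- `E` bounds the oscillation of all Birkhoff sums of `A` along inverse orbits of `x` and `y`
that follow the same branches. -/
def DistortionBound (w : ShiftWeight) (A : SeqSpace p → ℝ) (x y : SeqSpace p) (E : ℝ) : Prop :=
  ∃ a : ℕ → ℝ, (∀ j u v, IsDescendant w x y (j + 1) u v → A u ≤ A v + a j) ∧
    ∀ n, ∑ i ∈ Finset.range n, a i ≤ E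

theorem DistortionBound.mono {A : SeqSpace p → ℝ} {E E' : ℝ}
    (h : DistortionBound w A x y E) (hE : E ≤ E') : DistortionBound w A x y E' := by
  obtain ⟨a, ha, haE⟩ := h
  exact ⟨a, ha, fun n => (haE n).trans hE⟩

/-- Summable variation gives a distortion bound that is uniform in all pairs of points. -/
theorem exists_distortionBound_of_summableVariation {A : SeqSpace p → ℝ}
    (h : SummableVariation A) (w : ShiftWeight) :
    ∃ V : ℝ, 0 ≤ V ∧ ∀ x y, DistortionBound w A x y V := by
  have hne : ∀ n : ℕ, variation A (n + 1) ≠ ∞ := ENNReal.ne_top_of_tsum_ne_top h.ne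
  have hs := ENNReal.summable_toReal h.ne
  refine ⟨∑' n : ℕ, (variation A (n + 1)).toReal, tsum_nonneg fun _ => ENNReal.toReal_nonneg,
    fun x y => ⟨fun n => (variation A (n + 1)).toReal, fun j u v huv => ?_,
      fun n => hs.sum_le_tsum _ fun _ _ => ENNReal.toReal_nonneg⟩⟩
  have h1 : ENNReal.ofReal |A u - A v| ≤ variation A (j + 1) :=
    le_iSup_of_le u (le_iSup_of_le v (le_iSup_of_le huv.1 le_rfl))
  have h2 := (ENNReal.ofReal_le_iff_le_toReal (hne j)).1 h1
  linarith [le_abs_self (A u - A v)]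

variable [Fact (1 ≤ p)]

theorem IsDescendant.branch (h : IsDescendant w x y j u v) (r : ℝ) :
    IsDescendant w x y (j + 1) (branch w r u) (branch w r v) := by
  refine ⟨fun i hi => ?_, fun k => ?_⟩
  · cases i with
    | zero => rfl
    | succ i => rw [branch_coord_succ, branch_coord_succ, h.1 i (by omega)]
  · rw [show j + 1 + k = (j + k) + 1 by ring, branch_coord_succ, branch_coord_succ, ← sub_div,
      abs_div, abs_of_pos (w.val_pos _), h.2 k, w.beta_succ, div_div, add_comm k j]

theorem IsDescendant.norm_sub_le (h : IsDescendant w x y j u v) :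
    ‖u - v‖ ≤ (w.d j)⁻¹ * ‖x - y‖ := by
  refine SeqSpace.norm_le_of_shift (inv_pos.2 (w.d_pos j)).le j (fun i hi => ?_) fun k => ?_
  · rw [SeqSpace.coord_sub, h.1 i hi, sub_self]
  · rw [SeqSpace.coord_sub, SeqSpace.coord_sub, h.2 k, div_eq_inv_mul]
    exact mul_le_mul_of_nonneg_right (inv_anti₀ (w.d_pos j) (w.d_le_beta k j)) (abs_nonneg _)

/-- The comparison of `L_A^n F (x)` with `L_A^n G (y)` that carries the whole argument. -/
theorem ruelleENN_iterate_le {m : Measure ℝ} [SFinite m] {A : SeqSpace p → ℝ} (hA : Measurable A)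
    {E : ℝ} (hE : DistortionBound w A x y E) {F G : SeqSpace p → ℝ≥0∞} (hG : Measurable G) (n : ℕ)
    (h : ∀ u v, IsDescendant w x y n u v → F u ≤ G v) :
    (ruelleENN w m A)^[n] F x ≤ ENNReal.ofReal (Real.exp E) * (ruelleENN w m A)^[n] G y := by
  obtain ⟨a, ha, haE⟩ := hE
  have key : ∀ n k, (∀ u v, IsDescendant w x y (k + n) u v → F u ≤ G v) →
      ∀ u v, IsDescendant w x y k u v → (ruelleENN w m A)^[n] F u ≤
        ENNReal.ofReal (Real.exp (∑ i ∈ Finset.range n, a (k + i))) *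
          (ruelleENN w m A)^[n] G v := by
    intro n
    induction n with
    | zero =>
      intro k h u v huv
      simpa using h u v huv
    | succ n ih =>
      intro k h u v huv
      rw [Function.iterate_succ_apply', Function.iterate_succ_apply']
      have hm : Measurable fun r => ENNReal.ofReal (Real.exp (A (branch w r v))) *
          (ruelleENN w m A)^[n] G (branch w r v) :=
        (hA.exp.ennreal_ofReal.mul (measurable_ruelleENN_iterate hA hG n)).comp
          (measurable_branch_left w v)
      unfold ruelleENN at *
      rw [← lintegral_const_mul _ hm]
      refine lintegral_mono fun r => ?_
      have h1 := ih (k + 1) (fun u v huv => h u v (by rwa [show k + (n + 1) = k + 1 + n by ring]))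
        _ _ (huv.branch r)
      have h2 : ENNReal.ofReal (Real.exp (A (branch w r u))) ≤
          ENNReal.ofReal (Real.exp (a k)) * ENNReal.ofReal (Real.exp (A (branch w r v))) := by
        rw [← ENNReal.ofReal_mul (Real.exp_pos _).le, ← Real.exp_add]
        refine ENNReal.ofReal_le_ofReal (Real.exp_le_exp.2 ?_)
        have := ha k _ _ (huv.branch r)
        linarith
      refine (mul_le_mul' h2 h1).trans (le_of_eq ?_)
      rw [Finset.sum_range_succ', add_zero, Real.exp_add,
        ENNReal.ofReal_mul (Real.exp_pos _).le]
      simp only [add_assoc, add_comm 1]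
      ring
  refine (key n 0 (by simpa using h) x y (isDescendant_zero w x y)).trans ?_
  gcongr
  simpa using haE n

variable {α : ℝ≥0}

/-- The distortion of a Hölder potential is summable along inverse orbits, because these contract at
the rate `d_n⁻¹`. The bound depends on the distance of `x` and `y`. -/
theorem distortionBound_holder (A : LipB (SeqSpace p) α ℝ)
    (hd : Summable fun n : ℕ => w.d (n + 1) ^ (-(α : ℝ))) (x y : SeqSpace p) :
    DistortionBound w A x y (‖A‖ * (∑' n : ℕ, w.d (n + 1) ^ (-(α : ℝ))) * ‖x - y‖ ^ (α : ℝ)) := by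
  refine ⟨fun j => ‖A‖ * ‖x - y‖ ^ (α : ℝ) * w.d (j + 1) ^ (-(α : ℝ)), fun j u v h => ?_,
    fun n => ?_⟩
  · have h1 := A.norm_sub_le u v
    rw [dist_eq_norm] at h1
    have h2 : ‖u - v‖ ^ (α : ℝ) ≤ w.d (j + 1) ^ (-(α : ℝ)) * ‖x - y‖ ^ (α : ℝ) := by
      rw [Real.rpow_neg (w.d_pos _).le, ← Real.inv_rpow (w.d_pos _).le,
        ← Real.mul_rpow (inv_pos.2 (w.d_pos _)).le (norm_nonneg _)]
      exact Real.rpow_le_rpow (norm_nonneg _) h.norm_sub_le (NNReal.coe_nonneg α)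
    have h3 := mul_le_mul_of_nonneg_left h2 (norm_nonneg A)
    have h4 := (le_abs_self _).trans (h1.trans h3)
    linarith
  · rw [← Finset.mul_sum]
    have := hd.sum_le_tsum (Finset.range n) fun i _ => Real.rpow_nonneg (w.d_pos _).le _
    calc _ ≤ ‖A‖ * ‖x - y‖ ^ (α : ℝ) * ∑' n : ℕ, w.d (n + 1) ^ (-(α : ℝ)) := by gcongr
      _ = _ := by ring

end Distortion

/-! ### Bounded Hölder functions -/

namespace LipB

variable {X : Type*} [MetricSpace X] {α : ℝ≥0} {𝕜 : Type*} [RCLike 𝕜]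

theorem ext_apply {f g : LipB X α 𝕜} (h : ∀ x, f x = g x) : f = g :=
  Subtype.ext (BoundedContinuousFunction.ext h)

theorem add_apply (f g : LipB X α 𝕜) (x : X) : (f + g) x = f x + g x := rfl

theorem sub_apply (f g : LipB X α 𝕜) (x : X) : (f - g) x = f x - g x := rfl

theorem smul_apply (c : 𝕜) (f : LipB X α 𝕜) (x : X) : (c • f) x = c * f x := rfl

theorem continuous (f : LipB X α 𝕜) : Continuous f := f.toBCF.continuous

/-- The element of `Lip_b` given by a function with real bounds for its values and its
`α`-Hölder constant. -/
noncomputable def of (hα : 0 < α) (f : X → 𝕜) (M H : ℝ) (hM : ∀ x, ‖f x‖ ≤ M)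
    (hH : ∀ x y, ‖f x - f y‖ ≤ H * dist x y ^ (α : ℝ)) : LipB X α 𝕜 :=
  have h : HolderWith H.toNNReal α f := holderWith_of_norm_sub_le fun x y =>
    (hH x y).trans (mul_le_mul_of_nonneg_right (Real.le_coe_toNNReal H)
      (Real.rpow_nonneg dist_nonneg _))
  mk' f (h.continuous hα) M.toNNReal H.toNNReal (fun x => (hM x).trans (Real.le_coe_toNNReal M)) h

theorem of_apply (hα : 0 < α) (f : X → 𝕜) (M H : ℝ) (hM : ∀ x, ‖f x‖ ≤ M)
    (hH : ∀ x y, ‖f x - f y‖ ≤ H * dist x y ^ (α : ℝ)) (x : X) : of hα f M H hM hH x = f x := rfl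

theorem norm_of_le (hα : 0 < α) (f : X → 𝕜) {M H : ℝ} (hM : ∀ x, ‖f x‖ ≤ M)
    (hH : ∀ x y, ‖f x - f y‖ ≤ H * dist x y ^ (α : ℝ)) (hM0 : 0 ≤ M) (hH0 : 0 ≤ H) :
    ‖of hα f M H hM hH‖ ≤ M + H := by
  have h : HolderWith H.toNNReal α f := holderWith_of_norm_sub_le fun x y =>
    (hH x y).trans (mul_le_mul_of_nonneg_right (Real.le_coe_toNNReal H)
      (Real.rpow_nonneg dist_nonneg _))
  refine (norm_mk'_le f (h.continuous hα) M.toNNReal H.toNNReal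
    (fun x => (hM x).trans (Real.le_coe_toNNReal M)) h).trans (le_of_eq ?_)
  rw [Real.coe_toNNReal _ hM0, Real.coe_toNNReal _ hH0]

theorem norm_le_of_forall (hα : 0 < α) (f : LipB X α 𝕜) {M H : ℝ} (hM0 : 0 ≤ M) (hH0 : 0 ≤ H)
    (hM : ∀ x, ‖f x‖ ≤ M) (hH : ∀ x y, ‖f x - f y‖ ≤ H * dist x y ^ (α : ℝ)) :
    ‖f‖ ≤ M + H := by
  have : f = of hα f M H hM hH := ext_apply fun _ => rfl
  rw [this]
  exact norm_of_le hα f hM hH hM0 hH0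

variable (X α 𝕜) in
/-- The constant function. -/
noncomputable def const (c : 𝕜) : LipB X α 𝕜 :=
  ⟨BoundedContinuousFunction.const X c, memHolder_const⟩

theorem const_apply (c : 𝕜) (x : X) : const X α 𝕜 c x = c := rfl

theorem completeSpace (hα : 0 < α) : CompleteSpace (LipB X α 𝕜) := by
  refine Metric.complete_of_cauchySeq_tendsto fun u hu => ?_
  have hC : CauchySeq fun n => (u n).toBCF := by
    refine Metric.cauchySeq_iff.2 fun ε hε => ?_
    obtain ⟨N, hN⟩ := Metric.cauchySeq_iff.1 hu ε hε
    refine ⟨N, fun n hn k hk => lt_of_le_of_lt ?_ (hN n hn k hk)⟩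
    rw [dist_eq_norm, dist_eq_norm, norm_def]
    exact le_add_of_nonneg_right (NNReal.coe_nonneg _)
  obtain ⟨g, hg⟩ := cauchySeq_tendsto_of_complete hC
  have hgx : ∀ x, Tendsto (fun n => u n x) atTop (𝓝 (g x)) := fun x =>
    ((BoundedContinuousFunction.lipschitz_eval_const x).continuous.tendsto g).comp hg
  -- the limit inherits sup and Hölder bounds of `u n - u k`
  have key : ∀ ε > 0, ∃ N, ∀ n ≥ N, (∀ x, ‖u n x - g x‖ ≤ ε) ∧
      ∀ x y, ‖(u n x - g x) - (u n y - g y)‖ ≤ ε * dist x y ^ (α : ℝ) := by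
    intro ε hε
    obtain ⟨N, hN⟩ := Metric.cauchySeq_iff.1 hu ε hε
    refine ⟨N, fun n hn => ⟨fun x => ?_, fun x y => ?_⟩⟩
    · refine le_of_tendsto ((hgx x).const_sub (u n x)).norm ?_
      filter_upwards [eventually_ge_atTop N] with k hk
      have h := hN n hn k hk
      rw [dist_eq_norm] at h
      exact ((u n - u k).norm_apply_le x).trans h.le
    · refine le_of_tendsto (((hgx x).const_sub (u n x)).sub ((hgx y).const_sub (u n y))).norm ?_
      filter_upwards [eventually_ge_atTop N] with k hk
      have h := hN n hn k hk
      rw [dist_eq_norm] at h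
      refine ((u n - u k).norm_sub_le x y).trans ?_
      gcongr
  obtain ⟨N, hN⟩ := key 1 one_pos
  obtain ⟨h1, h2⟩ := hN N le_rfl
  obtain ⟨v, hv⟩ : ∃ v : LipB X α 𝕜, ∀ x, v x = g x :=
    ⟨u N - of hα (fun x => u N x - g x) 1 1 h1 h2, fun x => by
      rw [sub_apply, of_apply, sub_sub_cancel]⟩
  refine ⟨v, Metric.tendsto_atTop.2 fun ε hε => ?_⟩
  obtain ⟨N', hN'⟩ := key (ε / 3) (by positivity)
  refine ⟨N', fun n hn => ?_⟩
  obtain ⟨h3, h4⟩ := hN' n hn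
  rw [dist_eq_norm]
  refine (norm_le_of_forall hα (u n - v) (M := ε / 3) (H := ε / 3) (by positivity) (by positivity)
    (fun x => ?_) fun x y => ?_).trans_lt (by linarith)
  · rw [sub_apply, hv]; exact h3 x
  · rw [sub_apply, sub_apply, hv, hv]; exact h4 x y

/-- The real-valued function `Re (c f)`. -/
noncomputable def reMul (hα : 0 < α) (c : 𝕜) (f : LipB X α 𝕜) : LipB X α ℝ :=
  of hα (fun x => RCLike.re (c * f x)) (‖c‖ * ‖f‖) (‖c‖ * ‖f‖)
    (fun x => (RCLike.norm_re_le_norm _).trans (by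
      rw [norm_mul]
      exact mul_le_mul_of_nonneg_left (f.norm_apply_le x) (norm_nonneg c)))
    (fun x y => by
      rw [← map_sub, ← mul_sub]
      refine (RCLike.norm_re_le_norm _).trans ?_
      rw [norm_mul, mul_assoc]
      exact mul_le_mul_of_nonneg_left (f.norm_sub_le x y) (norm_nonneg c))

theorem reMul_apply (hα : 0 < α) (c : 𝕜) (f : LipB X α 𝕜) (x : X) :
    reMul hα c f x = RCLike.re (c * f x) := rfl

/-- A real-valued function, regarded as a `𝕜`-valued one. -/
noncomputable def ofRealLip (𝕜 : Type*) [RCLike 𝕜] (hα : 0 < α) (f : LipB X α ℝ) : LipB X α 𝕜 :=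
  of hα (fun x => (f x : 𝕜)) ‖f‖ ‖f‖
    (fun x => by rw [RCLike.norm_ofReal]; exact f.norm_apply_le x)
    (fun x y => by rw [← RCLike.ofReal_sub, RCLike.norm_ofReal]; exact f.norm_sub_le x y)

theorem ofRealLip_apply (hα : 0 < α) (f : LipB X α ℝ) (x : X) :
    ofRealLip 𝕜 hα f x = (f x : 𝕜) := rfl

end LipB

/-! ### Iterates of the Ruelle operator on Hölder functions -/

section Iterates

variable {p : ℝ≥0∞} [Fact (1 ≤ p)] {α : ℝ≥0} {𝕜 : Type*} [RCLike 𝕜]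
  (w : ShiftWeight) (m : Measure ℝ) [IsProbabilityMeasure m] (A : LipB (SeqSpace p) α ℝ)

variable {A} in
theorem LipB.measurable (A : LipB (SeqSpace p) α ℝ) : Measurable A := A.continuous.measurable

variable {w m A}

theorem ruelleLip_nonneg {f : LipB (SeqSpace p) α ℝ} (hf : ∀ x, 0 ≤ f x) (x : SeqSpace p) :
    0 ≤ ruelleLip ℝ w m A f x :=
  integral_nonneg fun _ => mul_nonneg (Real.exp_pos _).le (hf _)

theorem ruelleLip_pow_succ (n : ℕ) (f : LipB (SeqSpace p) α 𝕜) :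
    (ruelleLip 𝕜 w m A ^ (n + 1)) f = ruelleLip 𝕜 w m A ((ruelleLip 𝕜 w m A ^ n) f) := by
  rw [pow_succ']; rfl

theorem ruelleLip_pow_add (n k : ℕ) (f : LipB (SeqSpace p) α 𝕜) :
    (ruelleLip 𝕜 w m A ^ (n + k)) f = (ruelleLip 𝕜 w m A ^ n) ((ruelleLip 𝕜 w m A ^ k) f) := by
  rw [pow_add]; rfl

theorem ruelleLip_pow_nonneg {f : LipB (SeqSpace p) α ℝ} (hf : ∀ x, 0 ≤ f x) (n : ℕ)
    (x : SeqSpace p) : 0 ≤ (ruelleLip ℝ w m A ^ n) f x := by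
  induction n generalizing x with
  | zero => exact hf x
  | succ n ih =>
    rw [ruelleLip_pow_succ]
    exact ruelleLip_nonneg ih x

theorem ofReal_ruelleLip {f : LipB (SeqSpace p) α ℝ} (hf : ∀ x, 0 ≤ f x) (x : SeqSpace p) :
    ENNReal.ofReal (ruelleLip ℝ w m A f x) =
      ruelleENN w m A (fun x => ENNReal.ofReal (f x)) x := by
  rw [ruelleLip_apply, ruelle, ofReal_integral_eq_lintegral_ofReal (ruelle_integrable w m A f x)
    (Eventually.of_forall fun _ => mul_nonneg (Real.exp_pos _).le (hf _))]
  exact lintegral_congr fun r => ENNReal.ofReal_mul (Real.exp_pos _).le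

theorem ofReal_ruelleLip_pow {f : LipB (SeqSpace p) α ℝ} (hf : ∀ x, 0 ≤ f x) (n : ℕ)
    (x : SeqSpace p) :
    ENNReal.ofReal ((ruelleLip ℝ w m A ^ n) f x) =
      (ruelleENN w m A)^[n] (fun x => ENNReal.ofReal (f x)) x := by
  induction n generalizing x with
  | zero => rfl
  | succ n ih =>
    rw [ruelleLip_pow_succ, ofReal_ruelleLip (ruelleLip_pow_nonneg hf n),
      Function.iterate_succ_apply', funext ih]

theorem ruelleLip_pow_mono {f g : LipB (SeqSpace p) α ℝ} (h : ∀ x, f x ≤ g x) (n : ℕ)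
    (x : SeqSpace p) : (ruelleLip ℝ w m A ^ n) f x ≤ (ruelleLip ℝ w m A ^ n) g x := by
  have := ruelleLip_pow_nonneg (w := w) (m := m) (A := A) (f := g - f)
    (fun x => sub_nonneg.2 (h x)) n x
  rw [map_sub, LipB.sub_apply] at this
  exact sub_nonneg.1 this

theorem ruelleLip_pow_const (n : ℕ) (c : ℝ) (x : SeqSpace p) :
    (ruelleLip ℝ w m A ^ n) (LipB.const _ α ℝ c) x =
      c * (ruelleLip ℝ w m A ^ n) (LipB.const _ α ℝ 1) x := by
  have : LipB.const (SeqSpace p) α ℝ c = c • LipB.const _ α ℝ 1 :=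
    LipB.ext_apply fun x => (mul_one c).symm
  rw [this, map_smul, LipB.smul_apply]

theorem ruelleLip_pow_le_of_le {f : LipB (SeqSpace p) α ℝ} {c : ℝ} (h : ∀ x, f x ≤ c) (n : ℕ)
    (x : SeqSpace p) :
    (ruelleLip ℝ w m A ^ n) f x ≤ c * (ruelleLip ℝ w m A ^ n) (LipB.const _ α ℝ 1) x := by
  rw [← ruelleLip_pow_const]
  exact ruelleLip_pow_mono h n x

theorem le_ruelleLip_pow_of_le {f : LipB (SeqSpace p) α ℝ} {c : ℝ} (h : ∀ x, c ≤ f x) (n : ℕ)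
    (x : SeqSpace p) :
    c * (ruelleLip ℝ w m A ^ n) (LipB.const _ α ℝ 1) x ≤ (ruelleLip ℝ w m A ^ n) f x := by
  rw [← ruelleLip_pow_const]
  exact ruelleLip_pow_mono h n x

theorem ruelleLip_pow_le_of_descendant {x y : SeqSpace p} {E : ℝ}
    (hE : DistortionBound w A x y E) {f g : LipB (SeqSpace p) α ℝ} (hf : ∀ x, 0 ≤ f x)
    (hg : ∀ x, 0 ≤ g x) (n : ℕ) (h : ∀ u v, IsDescendant w x y n u v → f u ≤ g v) :
    (ruelleLip ℝ w m A ^ n) f x ≤ Real.exp E * (ruelleLip ℝ w m A ^ n) g y := by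
  have h1 := ruelleENN_iterate_le (m := m) A.measurable hE g.measurable.ennreal_ofReal n
    (F := fun x => ENNReal.ofReal (f x)) fun u v huv => ENNReal.ofReal_le_ofReal (h u v huv)
  rw [← ofReal_ruelleLip_pow hf, ← ofReal_ruelleLip_pow hg,
    ← ENNReal.ofReal_mul (Real.exp_pos _).le] at h1
  exact (ENNReal.ofReal_le_ofReal_iff
    (mul_nonneg (Real.exp_pos _).le (ruelleLip_pow_nonneg hg n y))).1 h1

/-- Distortion estimate for a function of arbitrary sign: `f` is made nonnegative by adding a
constant, before `ruelleLip_pow_le_of_descendant` is applied. -/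
theorem ruelleLip_pow_sub_le {x y : SeqSpace p} {E : ℝ} (hE0 : 0 ≤ E)
    (hE : DistortionBound w A x y E) (hE' : DistortionBound w A y x E)
    {f : LipB (SeqSpace p) α ℝ} {K η : ℝ} (hη : 0 ≤ η) (hK : ∀ x, |f x| ≤ K) (n : ℕ)
    (h : ∀ u v, IsDescendant w x y n u v → |f u - f v| ≤ η) :
    (ruelleLip ℝ w m A ^ n) f x - (ruelleLip ℝ w m A ^ n) f y ≤
      (3 * K * (Real.exp E - 1) + Real.exp E * η) *
        (ruelleLip ℝ w m A ^ n) (LipB.const _ α ℝ 1) y := by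
  have hK0 : 0 ≤ K := (abs_nonneg _).trans (hK x)
  have h1 := ruelleLip_pow_le_of_descendant (m := m) hE (f := f + LipB.const _ α ℝ K)
    (g := f + LipB.const _ α ℝ (K + η))
    (fun x => by
      rw [LipB.add_apply, LipB.const_apply]
      linarith [(abs_le.1 (hK x)).1])
    (fun x => by
      rw [LipB.add_apply, LipB.const_apply]
      linarith [(abs_le.1 (hK x)).1]) n
    (fun u v huv => by
      rw [LipB.add_apply, LipB.const_apply, LipB.add_apply, LipB.const_apply]
      linarith [(abs_le.1 (h u v huv)).2])
  have h2 := ruelleLip_pow_le_of_descendant (m := m) hE' (f := LipB.const _ α ℝ 1)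
    (g := LipB.const _ α ℝ 1) (fun _ => zero_le_one) (fun _ => zero_le_one) n
    (fun u v huv => le_rfl)
  rw [map_add, map_add, LipB.add_apply, LipB.add_apply, ruelleLip_pow_const,
    ruelleLip_pow_const n (K + η)] at h1
  have h3 := ruelleLip_pow_le_of_le (w := w) (m := m) (A := A) (f := f)
    (fun x => (abs_le.1 (hK x)).2) n y
  have h4 := ruelleLip_pow_nonneg (w := w) (m := m) (A := A) (f := LipB.const _ α ℝ 1)
    (fun _ => zero_le_one) n x
  have h5 := ruelleLip_pow_nonneg (w := w) (m := m) (A := A) (f := LipB.const _ α ℝ 1)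
    (fun _ => zero_le_one) n y
  set gx := (ruelleLip ℝ w m A ^ n) (LipB.const _ α ℝ 1) x
  set gy := (ruelleLip ℝ w m A ^ n) (LipB.const _ α ℝ 1) y
  set fx := (ruelleLip ℝ w m A ^ n) f x
  set fy := (ruelleLip ℝ w m A ^ n) f y
  have he : 1 ≤ Real.exp E := Real.one_le_exp hE0
  -- `gx ≥ e^{-E} gy ≥ (2 - e^E) gy`
  have h6 : (2 - Real.exp E) * gy ≤ gx := by
    have h7 : (2 - Real.exp E) * Real.exp E ≤ 1 := by nlinarith [sq_nonneg (Real.exp E - 1)]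
    rcases le_or_gt 0 (2 - Real.exp E) with h8 | h8
    · calc (2 - Real.exp E) * gy ≤ (2 - Real.exp E) * (Real.exp E * gx) :=
          mul_le_mul_of_nonneg_left h2 h8
        _ = ((2 - Real.exp E) * Real.exp E) * gx := by ring
        _ ≤ 1 * gx := mul_le_mul_of_nonneg_right h7 h4
        _ = gx := one_mul _
    · exact (mul_nonpos_of_nonpos_of_nonneg h8.le h5).trans h4
  have h9 := mul_le_mul_of_nonneg_left h6 hK0
  have h10 := mul_le_mul_of_nonneg_left h3 (sub_nonneg.2 he)
  nlinarith

theorem re_mul_ruelleLip_pow (hα : 0 < α) (c : 𝕜) (f : LipB (SeqSpace p) α 𝕜) (n : ℕ)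
    (x : SeqSpace p) :
    RCLike.re (c * (ruelleLip 𝕜 w m A ^ n) f x) =
      (ruelleLip ℝ w m A ^ n) (LipB.reMul hα c f) x := by
  induction n generalizing x with
  | zero => rfl
  | succ n ih =>
    rw [ruelleLip_pow_succ, ruelleLip_pow_succ, ruelleLip_apply, ruelleLip_apply, ruelle, ruelle,
      ← smul_eq_mul, ← integral_smul, ← integral_re]
    · refine integral_congr_ae (Eventually.of_forall fun r => ?_)
      dsimp only
      rw [← ih, smul_comm, RCLike.smul_re, smul_eq_mul, smul_eq_mul]
    · exact (ruelle_integrable w m A _ x).smul c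

theorem ruelleLip_ofRealLip (hα : 0 < α) (f : LipB (SeqSpace p) α ℝ) :
    ruelleLip 𝕜 w m A (LipB.ofRealLip 𝕜 hα f) = LipB.ofRealLip 𝕜 hα (ruelleLip ℝ w m A f) := by
  refine LipB.ext_apply fun x => ?_
  rw [ruelleLip_apply, LipB.ofRealLip_apply, ruelleLip_apply, ruelle, ruelle, ← integral_ofReal]
  refine integral_congr_ae (Eventually.of_forall fun r => ?_)
  simp [LipB.ofRealLip_apply, RCLike.real_smul_eq_coe_mul]

end Iterates

/-! ### The eigenvalue and the eigenfunction -/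

/-- An almost additive sequence has bounded distance from a linear one. -/
theorem exists_abs_sub_mul_le_of_almost_additive {u : ℕ → ℝ} {V : ℝ}
    (h : ∀ n k, |u (n + k) - u n - u k| ≤ V) : ∃ Λ : ℝ, ∀ n : ℕ, |u n - n * Λ| ≤ V := by
  have hV : 0 ≤ V := (abs_nonneg _).trans (h 0 0)
  have hs : Subadditive fun n => u n + V := fun n k => by
    have := (abs_le.1 (h n k)).2
    dsimp only
    linarith
  have ht : Subadditive fun n => -u n + V := fun n k => by
    have := (abs_le.1 (h n k)).1
    dsimp only
    linarith
  have bound : ∀ v : ℕ → ℝ, Subadditive v → ∀ n : ℕ, v n ≤ n * v 1 + v 0 := by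
    intro v hv n
    have := hv.apply_mul_add_le n 1 0
    simpa using this
  have hu0 := abs_le.1 (h 0 0)
  have bdd : ∀ v v' : ℕ → ℝ, Subadditive v' → (∀ n, v n + v' n = 2 * V) → v' 0 ≤ 2 * V →
      BddBelow (range fun n : ℕ => v n / n) := by
    intro v v' hv' hvv h0
    refine ⟨min 0 (-v' 1), ?_⟩
    rintro _ ⟨n, rfl⟩
    rcases Nat.eq_zero_or_pos n with rfl | hn
    · simp
    · refine (min_le_right _ _).trans ?_
      have hn' : (0 : ℝ) < n := by exact_mod_cast hn
      rw [le_div_iff₀ hn']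
      linarith [bound v' hv' n, hvv n]
  have hbs := bdd (fun n => u n + V) _ ht (fun n => by ring)
    (by simp only [zero_add] at hu0; linarith [hu0.1, hu0.2])
  have hbt := bdd (fun n => -u n + V) _ hs (fun n => by ring)
    (by simp only [zero_add] at hu0; linarith [hu0.1, hu0.2])
  have l1 := hs.tendsto_lim hbs
  have l2 := ht.tendsto_lim hbt
  -- both `u + V` and `-u + V` are subadditive; their Fekete limits are opposite
  have l3 : hs.lim + ht.lim = 0 := by
    refine tendsto_nhds_unique (l1.add l2) ?_
    refine (tendsto_const_div_atTop_nhds_zero_nat (2 * V)).congr fun n => ?_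
    rw [← add_div]
    congr 1
    ring
  refine ⟨hs.lim, fun n => ?_⟩
  rcases Nat.eq_zero_or_pos n with rfl | hn
  · simp only [zero_add] at hu0
    simp only [Nat.cast_zero, zero_mul, sub_zero]
    exact abs_le.2 ⟨by linarith [hu0.2], by linarith [hu0.1]⟩
  · have hn' : (0 : ℝ) < n := by exact_mod_cast hn
    have a1 := hs.lim_le_div hbs hn.ne'
    have a2 := ht.lim_le_div hbt hn.ne'
    rw [le_div_iff₀ hn'] at a1 a2
    have a3 : ht.lim = -hs.lim := by linarith
    rw [a3] at a2
    exact abs_le.2 ⟨by linarith, by linarith⟩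

theorem exp_sub_one_le_mul_exp (E : ℝ) : Real.exp E - 1 ≤ E * Real.exp E := by
  have h1 := mul_le_mul_of_nonneg_right (Real.add_one_le_exp (-E)) (Real.exp_pos E).le
  rw [← Real.exp_add, neg_add_cancel, Real.exp_zero] at h1
  linarith

section Eigen

variable {p : ℝ≥0∞} [Fact (1 ≤ p)] {α : ℝ≥0} {w : ShiftWeight} {m : Measure ℝ}
  [IsProbabilityMeasure m] {A : LipB (SeqSpace p) α ℝ} {V : ℝ}

theorem ruelleLip_pow_one_pos (n : ℕ) (x : SeqSpace p) :
    0 < (ruelleLip ℝ w m A ^ n) (LipB.const _ α ℝ 1) x := by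
  induction n generalizing x with
  | zero => exact one_pos
  | succ n ih =>
    have h : ∀ x, Real.exp (-‖A‖) ≤ ruelleLip ℝ w m A (LipB.const _ α ℝ 1) x := by
      intro x
      have hi := ruelle_integrable w m A (LipB.const _ α ℝ 1) x
      have : ∫ _r, Real.exp (-‖A‖) ∂m ≤
          ∫ r, Real.exp (A (branch w r x)) • LipB.const (SeqSpace p) α ℝ 1 (branch w r x) ∂m := by
        refine integral_mono (integrable_const _) hi fun r => ?_
        rw [LipB.const_apply, smul_eq_mul, mul_one]
        exact Real.exp_le_exp.2 (neg_le.1 ((neg_le_abs _).trans (A.norm_apply_le _)))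
      rwa [integral_const, probReal_univ, one_smul] at this
    rw [ruelleLip_pow_add n 1, pow_one]
    exact (mul_pos (Real.exp_pos _) (ih x)).trans_le (le_ruelleLip_pow_of_le h n x)

theorem ruelleLip_pow_one_le {x y : SeqSpace p} {E : ℝ} (hE : DistortionBound w A x y E) (n : ℕ) :
    (ruelleLip ℝ w m A ^ n) (LipB.const _ α ℝ 1) x ≤
      Real.exp E * (ruelleLip ℝ w m A ^ n) (LipB.const _ α ℝ 1) y :=
  ruelleLip_pow_le_of_descendant hE (fun _ => zero_le_one) (fun _ => zero_le_one) n
    fun _ _ _ => le_rfl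

/-- Under a global distortion bound `L_A^n 1` grows like an exact power of the eigenvalue. -/
theorem exists_growth_rate (hV : ∀ x y, DistortionBound w A x y V) :
    ∃ lam : ℝ, 0 < lam ∧ ∀ n x,
      Real.exp (-(2 * V)) * lam ^ n ≤ (ruelleLip ℝ w m A ^ n) (LipB.const _ α ℝ 1) x ∧
      (ruelleLip ℝ w m A ^ n) (LipB.const _ α ℝ 1) x ≤ Real.exp (2 * V) * lam ^ n := by
  set g : ℕ → SeqSpace p → ℝ := fun n x => (ruelleLip ℝ w m A ^ n) (LipB.const _ α ℝ 1) x with hg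
  have hpos : ∀ n x, 0 < g n x := ruelleLip_pow_one_pos
  have hle : ∀ n x y, g n x ≤ Real.exp V * g n y := fun n x y => ruelleLip_pow_one_le (hV x y) n
  obtain ⟨Λ, hΛ⟩ := exists_abs_sub_mul_le_of_almost_additive (u := fun n => Real.log (g n 0))
    (V := V) fun n k => by
      have e : g (n + k) 0 = (ruelleLip ℝ w m A ^ n) ((ruelleLip ℝ w m A ^ k)
        (LipB.const _ α ℝ 1)) 0 := by rw [hg, ← ruelleLip_pow_add]
      have h1 : g (n + k) 0 ≤ Real.exp V * g k 0 * g n 0 := by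
        rw [e]
        exact ruelleLip_pow_le_of_le (fun x => hle k x 0) n 0
      have h2 : Real.exp (-V) * g k 0 * g n 0 ≤ g (n + k) 0 := by
        rw [e]
        refine le_ruelleLip_pow_of_le (fun x => ?_) n 0
        rw [Real.exp_neg, inv_mul_le_iff₀ (Real.exp_pos _)]
        exact hle k 0 x
      have l1 := Real.log_le_log (hpos _ _) h1
      have l2 := Real.log_le_log
        (mul_pos (mul_pos (Real.exp_pos _) (hpos _ _)) (hpos _ _)) h2
      rw [Real.log_mul (mul_pos (Real.exp_pos _) (hpos _ _)).ne' (hpos _ _).ne',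
        Real.log_mul (Real.exp_pos _).ne' (hpos _ _).ne', Real.log_exp] at l1 l2
      exact abs_le.2 ⟨by linarith, by linarith⟩
  refine ⟨Real.exp Λ, Real.exp_pos _, fun n x => ?_⟩
  have h3 := abs_le.1 (hΛ n)
  rw [← Real.exp_nat_mul, ← Real.exp_add, ← Real.exp_add]
  have h4 := Real.log_le_log (hpos n x) (hle n x 0)
  have h5 := Real.log_le_log (hpos n 0) (hle n 0 x)
  rw [Real.log_mul (Real.exp_pos _).ne' (hpos _ _).ne', Real.log_exp] at h4 h5
  exact ⟨(Real.le_log_iff_exp_le (hpos n x)).1 (by linarith),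
    (Real.log_le_iff_le_exp (hpos n x)).1 (by linarith)⟩

theorem distortionBound_min (hd : Summable fun n : ℕ => w.d (n + 1) ^ (-(α : ℝ)))
    (hV : ∀ x y, DistortionBound w A x y V) (x y : SeqSpace p) :
    DistortionBound w A x y
      (min (‖A‖ * (∑' n : ℕ, w.d (n + 1) ^ (-(α : ℝ))) * ‖x - y‖ ^ (α : ℝ)) V) := by
  rcases min_choice (‖A‖ * (∑' n : ℕ, w.d (n + 1) ^ (-(α : ℝ))) * ‖x - y‖ ^ (α : ℝ)) V with h | h
  · rw [h]; exact distortionBound_holder A hd x y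
  · rw [h]; exact hV x y

/-- The eigenfunction is the increasing limit of `λ^{-k} L_A^k ψ₀`, where
`ψ₀ = limsup_n λ^{-n} L_A^n 1` satisfies `ψ₀ ≤ λ^{-1} L_A ψ₀` by the reverse Fatou lemma. -/
theorem exists_eigenfunction_ennreal (hα : 0 < α)
    (hd : Summable fun n : ℕ => w.d (n + 1) ^ (-(α : ℝ)))
    (hV : ∀ x y, DistortionBound w A x y V) {lam : ℝ} (hlam : 0 < lam)
    (hg : ∀ n x,
      Real.exp (-(2 * V)) * lam ^ n ≤ (ruelleLip ℝ w m A ^ n) (LipB.const _ α ℝ 1) x ∧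
      (ruelleLip ℝ w m A ^ n) (LipB.const _ α ℝ 1) x ≤ Real.exp (2 * V) * lam ^ n) :
    ∃ (ψ : SeqSpace p → ℝ≥0∞) (C : ℝ), 0 ≤ C ∧
      (∀ x, ENNReal.ofReal (Real.exp (-(2 * V))) ≤ ψ x ∧ ψ x ≤ ENNReal.ofReal (Real.exp (4 * V))) ∧
      (∀ x y, ψ x ≤ ENNReal.ofReal (Real.exp (min (C * ‖x - y‖ ^ (α : ℝ)) (2 * V))) * ψ y) ∧
      ∀ x, ENNReal.ofReal lam⁻¹ * ruelleENN w m A ψ x = ψ x := by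
  set g : ℕ → SeqSpace p → ℝ := fun n x => (ruelleLip ℝ w m A ^ n) (LipB.const _ α ℝ 1) x with hgdef
  set C₁ : ℝ := ‖A‖ * ∑' n : ℕ, w.d (n + 1) ^ (-(α : ℝ)) with hC₁
  have hC₁0 : 0 ≤ C₁ := mul_nonneg (norm_nonneg _)
    (tsum_nonneg fun _ => Real.rpow_nonneg (w.d_pos _).le _)
  obtain ⟨D, hD0, hD⟩ := w.exists_d_inv_le hα hd
  have hα' : (0 : ℝ) ≤ α := NNReal.coe_nonneg α
  have hA := A.measurable
  set c : ℝ≥0∞ := ENNReal.ofReal lam⁻¹ with hc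
  have hctop : c ≠ ∞ := ENNReal.ofReal_ne_top
  -- `h n = λ^{-n} L_A^n 1`
  set h : ℕ → SeqSpace p → ℝ≥0∞ := fun n x => ENNReal.ofReal (g n x / lam ^ n) with hh
  have hhm : ∀ n, Measurable (h n) := fun n =>
    ((LipB.measurable _).div_const _).ennreal_ofReal
  have hle : ∀ n x, h n x ≤ ENNReal.ofReal (Real.exp (2 * V)) := fun n x =>
    ENNReal.ofReal_le_ofReal ((div_le_iff₀ (pow_pos hlam n)).2 (hg n x).2)
  have hge : ∀ n x, ENNReal.ofReal (Real.exp (-(2 * V))) ≤ h n x := fun n x =>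
    ENNReal.ofReal_le_ofReal ((le_div_iff₀ (pow_pos hlam n)).2 (hg n x).1)
  have hiter : ∀ n x, h n x = c ^ n * (ruelleENN w m A)^[n] (fun _ => 1) x := by
    intro n x
    rw [hh, hgdef]
    dsimp only
    rw [div_eq_inv_mul, ENNReal.ofReal_mul (by positivity), ← inv_pow,
      ENNReal.ofReal_pow (by positivity), ofReal_ruelleLip_pow (fun _ => zero_le_one)]
    simp only [LipB.const_apply, ENNReal.ofReal_one, hc]
  have hstep : ∀ n x, h (n + 1) x = c * ruelleENN w m A (h n) x := by
    intro n x
    rw [funext (hiter n), ruelleENN_const_mul hA (measurable_ruelleENN_iterate hA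
      measurable_const n), hiter, Function.iterate_succ_apply', pow_succ']
    ring
  have hdist : ∀ n x y, h n x ≤
      ENNReal.ofReal (Real.exp (min (C₁ * ‖x - y‖ ^ (α : ℝ)) V)) * h n y := by
    intro n x y
    rw [hh]
    dsimp only
    rw [← ENNReal.ofReal_mul (Real.exp_pos _).le, ← mul_div_assoc]
    exact ENNReal.ofReal_le_ofReal (div_le_div_of_nonneg_right
      (ruelleLip_pow_one_le (distortionBound_min hd hV x y) n) (pow_pos hlam n).le)
  set ψ₀ : SeqSpace p → ℝ≥0∞ := fun x => limsup (fun n => h n x) atTop with hψ₀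
  have hψ₀m : Measurable ψ₀ := .limsup hhm
  have hψ₀ge : ∀ x, ENNReal.ofReal (Real.exp (-(2 * V))) ≤ ψ₀ x := fun x =>
    le_limsup_of_frequently_le (Frequently.of_forall fun n => hge n x)
  have hψ₀le : ∀ x, ψ₀ x ≤ ENNReal.ofReal (Real.exp (2 * V)) := fun x =>
    limsup_le_of_le (h := Eventually.of_forall fun n => hle n x)
  have hψ₀dist : ∀ x y, ψ₀ x ≤
      ENNReal.ofReal (Real.exp (min (C₁ * ‖x - y‖ ^ (α : ℝ)) V)) * ψ₀ y := by
    intro x y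
    rw [hψ₀]
    dsimp only
    rw [← ENNReal.limsup_const_mul_of_ne_top ENNReal.ofReal_ne_top]
    exact limsup_le_limsup (Eventually.of_forall fun n => hdist n x y)
  have hψ₀step : ∀ x, ψ₀ x ≤ c * ruelleENN w m A ψ₀ x := by
    intro x
    have h1 : ψ₀ x = limsup (fun n => c * ruelleENN w m A (h n) x) atTop := by
      simp only [← hstep]
      exact (limsup_nat_add (fun n => h n x) 1).symm
    rw [h1, ENNReal.limsup_const_mul_of_ne_top hctop]
    refine mul_le_mul_right ?_ c
    have h2 : ∀ r, ψ₀ (branch w r x) = limsup (fun n => h n (branch w r x)) atTop := fun r => rfl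
    unfold ruelleENN
    simp only [h2, ← ENNReal.limsup_const_mul_of_ne_top ENNReal.ofReal_ne_top]
    refine limsup_lintegral_le
      (fun _ => ENNReal.ofReal (Real.exp ‖A‖) * ENNReal.ofReal (Real.exp (2 * V)))
      (fun n => (hA.exp.ennreal_ofReal.mul (hhm n)).comp (measurable_branch_left w x))
      (fun n => Eventually.of_forall fun r => ?_) ?_
    · exact mul_le_mul' (ENNReal.ofReal_le_ofReal (exp_bound A _)) (hle n _)
    · rw [lintegral_const, measure_univ, mul_one]
      exact ENNReal.mul_ne_top ENNReal.ofReal_ne_top ENNReal.ofReal_ne_top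
  set φ : ℕ → SeqSpace p → ℝ≥0∞ := fun k x => c ^ k * (ruelleENN w m A)^[k] ψ₀ x with hφ
  have hφm : ∀ k, Measurable (φ k) := fun k =>
    (measurable_ruelleENN_iterate hA hψ₀m k).const_mul _
  have hφstep : ∀ k x, φ (k + 1) x = c * ruelleENN w m A (φ k) x := by
    intro k x
    rw [hφ]
    dsimp only
    rw [ruelleENN_const_mul hA (measurable_ruelleENN_iterate hA hψ₀m k),
      Function.iterate_succ_apply', pow_succ']
    ring
  have hmono : Monotone φ := by
    refine monotone_nat_of_le_succ fun k => ?_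
    induction k with
    | zero =>
      intro x
      rw [hφstep]
      simpa [hφ] using hψ₀step x
    | succ k ih =>
      intro x
      rw [hφstep, hφstep]
      exact mul_le_mul_right (ruelleENN_mono ih x) c
  refine ⟨fun x => ⨆ k, φ k x, C₁ + C₁ * D ^ (α : ℝ), by positivity, fun x => ⟨?_, ?_⟩,
    fun x y => ?_, fun x => ?_⟩
  · refine (hψ₀ge x).trans (le_iSup_of_le 0 ?_)
    simp [hφ]
  · refine iSup_le fun k => ?_
    have h1 : (ruelleENN w m A)^[k] ψ₀ x ≤
        ENNReal.ofReal (Real.exp (2 * V)) * (ruelleENN w m A)^[k] (fun _ => 1) x := by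
      rw [← congrFun (ruelleENN_iterate_const_mul (w := w) (m := m) hA measurable_const _ k) x]
      exact ruelleENN_iterate_mono (fun x => by simpa using hψ₀le x) k x
    calc φ k x ≤ c ^ k * (ENNReal.ofReal (Real.exp (2 * V)) *
          (ruelleENN w m A)^[k] (fun _ => 1) x) := mul_le_mul_right h1 _
      _ = ENNReal.ofReal (Real.exp (2 * V)) * h k x := by rw [hiter]; ring
      _ ≤ ENNReal.ofReal (Real.exp (2 * V)) * ENNReal.ofReal (Real.exp (2 * V)) :=
          mul_le_mul_right (hle k x) _
      _ = _ := by
        rw [← ENNReal.ofReal_mul (Real.exp_pos _).le, ← Real.exp_add]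
        ring_nf
  · refine iSup_le fun k => ?_
    have hb := distortionBound_min hd hV x y
    set E := min (C₁ * ‖x - y‖ ^ (α : ℝ)) V with hE
    set E' := min (C₁ * D ^ (α : ℝ) * ‖x - y‖ ^ (α : ℝ)) V with hE'
    have h1 := ruelleENN_iterate_le (m := m) hA hb (F := ψ₀)
      (G := fun v => ENNReal.ofReal (Real.exp E') * ψ₀ v) (hψ₀m.const_mul _) k fun u v huv => by
        refine (hψ₀dist u v).trans (mul_le_mul_left (ENNReal.ofReal_le_ofReal
          (Real.exp_le_exp.2 (min_le_min_right V ?_))) _)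
        rw [mul_assoc C₁, ← Real.mul_rpow hD0 (norm_nonneg _)]
        refine mul_le_mul_of_nonneg_left (Real.rpow_le_rpow (norm_nonneg _) ?_ hα') hC₁0
        exact huv.norm_sub_le.trans (mul_le_mul_of_nonneg_right (hD k) (norm_nonneg _))
    rw [ruelleENN_iterate_const_mul hA hψ₀m] at h1
    dsimp only at h1
    rw [← mul_assoc, ← ENNReal.ofReal_mul (Real.exp_pos _).le, ← Real.exp_add] at h1
    have h2 : E + E' ≤ min ((C₁ + C₁ * D ^ (α : ℝ)) * ‖x - y‖ ^ (α : ℝ)) (2 * V) := by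
      refine le_min ?_ ?_
      · rw [add_mul]
        exact add_le_add (min_le_left _ _) (min_le_left _ _)
      · rw [two_mul]
        exact add_le_add (min_le_right _ _) (min_le_right _ _)
    have h3 := h1.trans (mul_le_mul_left (ENNReal.ofReal_le_ofReal (Real.exp_le_exp.2 h2)) _)
    calc φ k x ≤ _ := mul_le_mul_right h3 (c ^ k)
      _ = ENNReal.ofReal (Real.exp (min ((C₁ + C₁ * D ^ (α : ℝ)) * ‖x - y‖ ^ (α : ℝ)) (2 * V))) *
          φ k y := by rw [hφ]; ring
      _ ≤ _ := mul_le_mul_right (le_iSup (fun k => φ k y) k) _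
  · have h1 : ruelleENN w m A (fun x => ⨆ k, φ k x) x = ⨆ k, ruelleENN w m A (φ k) x := by
      unfold ruelleENN
      exact (lintegral_congr fun r => ENNReal.mul_iSup _ _).trans (lintegral_iSup
        (fun k => (hA.exp.ennreal_ofReal.mul (hφm k)).comp (measurable_branch_left w x))
        fun i j hij r => mul_le_mul_right (hmono hij _) _)
    rw [h1, ENNReal.mul_iSup]
    simp only [← hφstep]
    exact (hmono.iSup_nat_add 1 |> congrFun <| x) |> fun h => by simpa using h

theorem exists_eigenfunction (hα : 0 < α)
    (hd : Summable fun n : ℕ => w.d (n + 1) ^ (-(α : ℝ)))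
    (hV0 : 0 ≤ V) (hV : ∀ x y, DistortionBound w A x y V) :
    ∃ (lam : ℝ) (ψ : LipB (SeqSpace p) α ℝ), 0 < lam ∧ (∃ δ : ℝ, 0 < δ ∧ ∀ x, δ ≤ ψ x) ∧
      ruelleLip ℝ w m A ψ = lam • ψ := by
  obtain ⟨lam, hlam, hg⟩ := exists_growth_rate (m := m) hV
  obtain ⟨Ψ, C, hC0, hb, hdist, heig⟩ := exists_eigenfunction_ennreal hα hd hV hlam hg
  have htop : ∀ x, Ψ x ≠ ∞ := fun x => ne_top_of_le_ne_top ENNReal.ofReal_ne_top (hb x).2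
  set f : SeqSpace p → ℝ := fun x => (Ψ x).toReal with hf
  have hfΨ : ∀ x, ENNReal.ofReal (f x) = Ψ x := fun x => ENNReal.ofReal_toReal (htop x)
  have hfle : ∀ x, f x ≤ Real.exp (4 * V) := fun x =>
    ENNReal.toReal_le_of_le_ofReal (Real.exp_pos _).le (hb x).2
  have hfge : ∀ x, Real.exp (-(2 * V)) ≤ f x := fun x =>
    (ENNReal.ofReal_le_iff_le_toReal (htop x)).1 (hb x).1
  have hf0 : ∀ x, 0 ≤ f x := fun x => ENNReal.toReal_nonneg
  have hsub : ∀ x y, f x - f y ≤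
      Real.exp (4 * V) * (C * Real.exp (2 * V)) * dist x y ^ (α : ℝ) := by
    intro x y
    have ht : 0 ≤ ‖x - y‖ ^ (α : ℝ) := Real.rpow_nonneg (norm_nonneg _) _
    have h1 := hdist x y
    set E := min (C * ‖x - y‖ ^ (α : ℝ)) (2 * V) with hE
    have hE0 : 0 ≤ E := le_min (by positivity) (by positivity)
    rw [← hfΨ, ← hfΨ, ← ENNReal.ofReal_mul (Real.exp_pos _).le,
      ENNReal.ofReal_le_ofReal_iff (mul_nonneg (Real.exp_pos _).le (hf0 y))] at h1
    have h2 : Real.exp E - 1 ≤ C * ‖x - y‖ ^ (α : ℝ) * Real.exp (2 * V) :=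
      (exp_sub_one_le_mul_exp E).trans (mul_le_mul (min_le_left _ _)
        (Real.exp_le_exp.2 (min_le_right _ _)) (Real.exp_pos _).le (by positivity))
    rw [dist_eq_norm]
    calc f x - f y ≤ (Real.exp E - 1) * f y := by linarith
      _ ≤ (C * ‖x - y‖ ^ (α : ℝ) * Real.exp (2 * V)) * Real.exp (4 * V) :=
        mul_le_mul h2 (hfle y) (hf0 y) (by positivity)
      _ = _ := by ring
  set ψ : LipB (SeqSpace p) α ℝ := LipB.of hα f (Real.exp (4 * V))
    (Real.exp (4 * V) * (C * Real.exp (2 * V)))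
    (fun x => by rw [Real.norm_of_nonneg (hf0 x)]; exact hfle x)
    (fun x y => abs_sub_le_iff.2 ⟨hsub x y, by rw [dist_comm]; exact hsub y x⟩) with hψ
  have hψf : ∀ x, ψ x = f x := fun x => rfl
  refine ⟨lam, ψ, hlam, ⟨_, Real.exp_pos _, hfge⟩, LipB.ext_apply fun x => ?_⟩
  have h1 := ofReal_ruelleLip (w := w) (m := m) (A := A) (f := ψ) hf0 x
  have h2 : ENNReal.ofReal (ruelleLip ℝ w m A ψ x) = ENNReal.ofReal (lam * f x) := by
    rw [h1, ENNReal.ofReal_mul hlam.le, hfΨ, ← heig x, ← mul_assoc,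
      ← ENNReal.ofReal_mul hlam.le, mul_inv_cancel₀ hlam.ne', ENNReal.ofReal_one, one_mul]
    simp only [hψf, hfΨ]
  rw [LipB.smul_apply]
  exact (ENNReal.ofReal_eq_ofReal_iff (ruelleLip_nonneg hf0 x)
    (mul_nonneg hlam.le (hf0 x))).1 h2

end Eigen

/-! ### The spectral radius -/

section Spectral

variable {p : ℝ≥0∞} [Fact (1 ≤ p)] {α : ℝ≥0} {w : ShiftWeight} {m : Measure ℝ}
  [IsProbabilityMeasure m] {A : LipB (SeqSpace p) α ℝ} {V lam δ : ℝ} {ψ : LipB (SeqSpace p) α ℝ}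

theorem ruelleLip_pow_eigen {𝕜 : Type*} [RCLike 𝕜] {f : LipB (SeqSpace p) α 𝕜} {c : 𝕜}
    (h : ruelleLip 𝕜 w m A f = c • f) (n : ℕ) : (ruelleLip 𝕜 w m A ^ n) f = c ^ n • f := by
  induction n with
  | zero => simp
  | succ n ih => rw [ruelleLip_pow_succ, ih, map_smul, h, smul_smul, pow_succ]

theorem ruelleLip_pow_one_le_eigen (hδ : 0 < δ) (hψ : ∀ x, δ ≤ ψ x) (hlam : 0 < lam)
    (h : ruelleLip ℝ w m A ψ = lam • ψ) (n : ℕ) (x : SeqSpace p) :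
    (ruelleLip ℝ w m A ^ n) (LipB.const _ α ℝ 1) x ≤ ‖ψ‖ / δ * lam ^ n := by
  have h1 := le_ruelleLip_pow_of_le (w := w) (m := m) (A := A) hψ n x
  rw [ruelleLip_pow_eigen h, LipB.smul_apply] at h1
  have h2 : lam ^ n * ψ x ≤ lam ^ n * ‖ψ‖ :=
    mul_le_mul_of_nonneg_left ((le_abs_self _).trans (ψ.norm_apply_le x)) (pow_pos hlam n).le
  rw [div_mul_eq_mul_div, le_div_iff₀ hδ]
  linarith

/-- The norms of `L_A^n` grow at most like `λ^n`. For complex values the sup and Hölder bounds are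
reduced to the real operator by turning the value, or the difference of two values, to the positive
real axis. -/
theorem exists_norm_ruelleLip_pow_le (𝕜 : Type*) [RCLike 𝕜] (hα : 0 < α)
    (hd : Summable fun n : ℕ => w.d (n + 1) ^ (-(α : ℝ)))
    (hV0 : 0 ≤ V) (hV : ∀ x y, DistortionBound w A x y V) (hδ : 0 < δ) (hψ : ∀ x, δ ≤ ψ x)
    (hlam : 0 < lam) (h : ruelleLip ℝ w m A ψ = lam • ψ) :
    ∃ C : ℝ, ∀ n, ‖ruelleLip 𝕜 w m A ^ n‖ ≤ C * lam ^ n := by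
  obtain ⟨D, hD0, hD⟩ := w.exists_d_inv_le hα hd
  have hα' : (0 : ℝ) ≤ α := NNReal.coe_nonneg α
  set M := ‖ψ‖ / δ with hM
  have hM0 : 0 ≤ M := by positivity
  have hone := fun n x => ruelleLip_pow_one_le_eigen (w := w) (m := m) (A := A) hδ hψ hlam h n x
  set C₁ : ℝ := ‖A‖ * ∑' n : ℕ, w.d (n + 1) ^ (-(α : ℝ)) with hC₁
  have hC₁0 : 0 ≤ C₁ := mul_nonneg (norm_nonneg _)
    (tsum_nonneg fun _ => Real.rpow_nonneg (w.d_pos _).le _)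
  set H := (3 * C₁ + D ^ (α : ℝ)) * Real.exp V * M with hH
  refine ⟨M + H, fun n => ContinuousLinearMap.opNorm_le_bound _ (by positivity) fun φ => ?_⟩
  have hre : ∀ c : 𝕜, ‖c‖ = 1 → ∀ x, |LipB.reMul hα c φ x| ≤ ‖φ‖ := by
    intro c hc x
    rw [LipB.reMul_apply]
    refine (RCLike.abs_re_le_norm _).trans ?_
    rw [norm_mul, hc, one_mul]
    exact φ.norm_apply_le x
  have hre' : ∀ c : 𝕜, ‖c‖ = 1 → ∀ x y,
      |LipB.reMul hα c φ x - LipB.reMul hα c φ y| ≤ ‖φ‖ * dist x y ^ (α : ℝ) := by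
    intro c hc x y
    rw [LipB.reMul_apply, LipB.reMul_apply, ← map_sub, ← mul_sub]
    refine (RCLike.abs_re_le_norm _).trans ?_
    rw [norm_mul, hc, one_mul]
    exact φ.norm_sub_le x y
  refine (LipB.norm_le_of_forall hα _ (M := M * lam ^ n * ‖φ‖) (H := H * lam ^ n * ‖φ‖)
    (by positivity) (by positivity) (fun x => ?_) fun x y => ?_).trans (le_of_eq (by ring))
  · obtain ⟨c, hc, hcz⟩ := RCLike.exists_norm_eq_mul_self ((ruelleLip 𝕜 w m A ^ n) φ x)
    have h1 := re_mul_ruelleLip_pow (w := w) (m := m) (A := A) hα c φ n x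
    rw [← hcz, RCLike.ofReal_re] at h1
    rw [h1]
    refine (ruelleLip_pow_le_of_le (fun x => (abs_le.1 (hre c hc x)).2) n x).trans ?_
    calc _ ≤ ‖φ‖ * (M * lam ^ n) := mul_le_mul_of_nonneg_left (hone n x) (norm_nonneg _)
      _ = _ := by ring
  · obtain ⟨c, hc, hcz⟩ := RCLike.exists_norm_eq_mul_self
      ((ruelleLip 𝕜 w m A ^ n) φ x - (ruelleLip 𝕜 w m A ^ n) φ y)
    have h1 : ‖(ruelleLip 𝕜 w m A ^ n) φ x - (ruelleLip 𝕜 w m A ^ n) φ y‖ =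
        (ruelleLip ℝ w m A ^ n) (LipB.reMul hα c φ) x -
          (ruelleLip ℝ w m A ^ n) (LipB.reMul hα c φ) y := by
      have h2 := congrArg RCLike.re hcz
      rw [RCLike.ofReal_re, mul_sub, map_sub] at h2
      rw [← re_mul_ruelleLip_pow, ← re_mul_ruelleLip_pow, h2]
    rw [h1]
    have ht : 0 ≤ ‖x - y‖ ^ (α : ℝ) := Real.rpow_nonneg (norm_nonneg _) _
    have hE := distortionBound_min hd hV x y
    have hE' := distortionBound_min hd hV y x
    rw [norm_sub_rev y x] at hE'
    set E := min (C₁ * ‖x - y‖ ^ (α : ℝ)) V with hEdef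
    have hE0 : 0 ≤ E := le_min (by positivity) hV0
    have hEV : Real.exp E ≤ Real.exp V := Real.exp_le_exp.2 (min_le_right _ _)
    have h2 : Real.exp E - 1 ≤ C₁ * ‖x - y‖ ^ (α : ℝ) * Real.exp V :=
      (exp_sub_one_le_mul_exp E).trans (mul_le_mul (min_le_left _ _) hEV (Real.exp_pos _).le
        (by positivity))
    refine (ruelleLip_pow_sub_le hE0 hE hE' (η := ‖φ‖ * (D ^ (α : ℝ) * ‖x - y‖ ^ (α : ℝ)))
      (by positivity) (hre c hc) n fun u v huv => ?_).trans ?_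
    · refine (hre' c hc u v).trans (mul_le_mul_of_nonneg_left ?_ (norm_nonneg _))
      rw [← Real.mul_rpow hD0 (norm_nonneg _), dist_eq_norm]
      exact Real.rpow_le_rpow (norm_nonneg _) (huv.norm_sub_le.trans
        (mul_le_mul_of_nonneg_right (hD n) (norm_nonneg _))) hα'
    · rw [dist_eq_norm]
      calc _ ≤ (3 * ‖φ‖ * (C₁ * ‖x - y‖ ^ (α : ℝ) * Real.exp V) +
            Real.exp V * (‖φ‖ * (D ^ (α : ℝ) * ‖x - y‖ ^ (α : ℝ)))) * (M * lam ^ n) := by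
            refine mul_le_mul ?_ (hone n y) (ruelleLip_pow_one_pos n y).le (by positivity)
            gcongr
        _ = _ := by rw [hH]; ring

theorem pow_le_norm_ruelleLip_pow (𝕜 : Type*) [RCLike 𝕜] (hα : 0 < α) (hδ : 0 < δ)
    (hψ : ∀ x, δ ≤ ψ x) (hlam : 0 < lam) (h : ruelleLip ℝ w m A ψ = lam • ψ) (n : ℕ) :
    lam ^ n ≤ ‖ruelleLip 𝕜 w m A ^ n‖ := by
  set Ψ := LipB.ofRealLip 𝕜 hα ψ with hΨ
  have h1 : ruelleLip 𝕜 w m A Ψ = (lam : 𝕜) • Ψ := by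
    rw [hΨ, ruelleLip_ofRealLip, h]
    refine LipB.ext_apply fun x => ?_
    rw [LipB.ofRealLip_apply, LipB.smul_apply, LipB.smul_apply, LipB.ofRealLip_apply]
    exact RCLike.ofReal_mul _ _
  have h2 := (ruelleLip 𝕜 w m A ^ n).le_opNorm Ψ
  rw [ruelleLip_pow_eigen h1, norm_smul, norm_pow, RCLike.norm_ofReal, abs_of_pos hlam] at h2
  refine le_of_mul_le_mul_right h2 ?_
  have h3 := Ψ.norm_apply_le 0
  rw [hΨ, LipB.ofRealLip_apply, RCLike.norm_ofReal] at h3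
  exact (hδ.trans_le ((hψ 0).trans (le_abs_self _))).trans_le h3

theorem tendsto_norm_ruelleLip_pow (𝕜 : Type*) [RCLike 𝕜] (hα : 0 < α)
    (hd : Summable fun n : ℕ => w.d (n + 1) ^ (-(α : ℝ)))
    (hV0 : 0 ≤ V) (hV : ∀ x y, DistortionBound w A x y V) (hδ : 0 < δ) (hψ : ∀ x, δ ≤ ψ x)
    (hlam : 0 < lam) (h : ruelleLip ℝ w m A ψ = lam • ψ) :
    Tendsto (fun n : ℕ => ‖ruelleLip 𝕜 w m A ^ n‖ ^ (1 / (n : ℝ))) atTop (𝓝 lam) := by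
  obtain ⟨C, hC⟩ := exists_norm_ruelleLip_pow_le 𝕜 hα hd hV0 hV hδ hψ hlam h
  have hlow := pow_le_norm_ruelleLip_pow (w := w) (m := m) (A := A) 𝕜 hα hδ hψ hlam h
  have hC0 : 0 < C := by
    have := (hlow 0).trans (hC 0)
    rw [pow_zero, mul_one] at this
    exact one_pos.trans_le this
  have hroot : ∀ n : ℕ, n ≠ 0 → (lam ^ n) ^ (1 / (n : ℝ)) = lam := by
    intro n hn
    rw [one_div, Real.pow_rpow_inv_natCast hlam.le hn]
  have hlim : Tendsto (fun n : ℕ => C ^ (1 / (n : ℝ)) * lam) atTop (𝓝 lam) := by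
    have h1 : Tendsto (fun n : ℕ => C ^ (1 / (n : ℝ))) atTop (𝓝 (C ^ (0 : ℝ))) :=
      tendsto_const_nhds.rpow tendsto_one_div_atTop_nhds_zero_nat (Or.inl hC0.ne')
    rw [Real.rpow_zero] at h1
    simpa using h1.mul_const lam
  refine tendsto_of_tendsto_of_tendsto_of_le_of_le' tendsto_const_nhds hlim ?_ ?_
  · filter_upwards [eventually_ne_atTop 0] with n hn
    have := Real.rpow_le_rpow (z := 1 / (n : ℝ)) (pow_pos hlam n).le (hlow n) (by positivity)
    rwa [hroot n hn] at this
  · filter_upwards [eventually_ne_atTop 0] with n hn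
    have := Real.rpow_le_rpow (z := 1 / (n : ℝ)) (norm_nonneg _) (hC n) (by positivity)
    rwa [Real.mul_rpow hC0.le (pow_pos hlam n).le, hroot n hn] at this

theorem spectralRadius_ruelleLip (hα : 0 < α)
    (hd : Summable fun n : ℕ => w.d (n + 1) ^ (-(α : ℝ)))
    (hV0 : 0 ≤ V) (hV : ∀ x y, DistortionBound w A x y V) (hδ : 0 < δ) (hψ : ∀ x, δ ≤ ψ x)
    (hlam : 0 < lam) (h : ruelleLip ℝ w m A ψ = lam • ψ) :
    spectralRadius ℂ (ruelleLip ℂ w m A) = ENNReal.ofReal lam := by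
  have : CompleteSpace (LipB (SeqSpace p) α ℂ) := LipB.completeSpace hα
  exact tendsto_nhds_unique (spectrum.pow_norm_pow_one_div_tendsto_nhds_spectralRadius _)
    (ENNReal.tendsto_ofReal (tendsto_norm_ruelleLip_pow ℂ hα hd hV0 hV hδ hψ hlam h))

/-! ### Uniqueness of the positive eigenfunction -/

theorem le_of_forall_pow_mul_le {a b c B : ℝ} (hb : 0 ≤ b) (hc : 0 < c)
    (h : ∀ n : ℕ, a ^ n * c ≤ B * b ^ n) : a ≤ b := by
  by_contra! hab
  rcases hb.eq_or_lt with rfl | hb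
  · have := h 1
    simp only [pow_one, mul_zero] at this
    exact (mul_pos hab hc).not_ge this
  · have h1 : 1 < a / b := (one_lt_div hb).2 hab
    obtain ⟨n, hn⟩ := pow_unbounded_of_one_lt (B / c) h1
    rw [div_pow, div_lt_div_iff₀ hc (pow_pos hb n)] at hn
    exact hn.not_ge (h n)

theorem exists_measure_compl_Icc_le (m : Measure ℝ) [IsFiniteMeasure m] {ε : ℝ≥0∞} (hε : 0 < ε) :
    ∃ R : ℝ, 0 ≤ R ∧ m (Icc (-R) R)ᶜ ≤ ε := by
  obtain ⟨K, hK, hm⟩ := isTightMeasureSet_iff_exists_isCompact_measure_compl_le.1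
    (isTightMeasureSet_singleton (μ := m)) ε hε
  obtain ⟨R, hR⟩ := hK.isBounded.subset_closedBall 0
  refine ⟨max R 0, le_max_right _ _, (measure_mono (compl_subset_compl.2 fun x hx => ?_)).trans
    (hm m rfl)⟩
  have := hR hx
  rw [mem_closedBall_zero_iff, Real.norm_eq_abs] at this
  exact abs_le.1 (this.trans (le_max_left _ _))

/-- The eigenvalue of a positive eigenfunction `φ` is at least `λ`, although `φ` need not be bounded
away from `0`: the chain of inverse branches stays in a box `{|x_n| ≤ R / β_1^n}` with a
probability that decays at a rate as close to `1` as one wishes, and `φ` is bounded away from `0`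
on this compact box. -/
theorem eigenvalue_le_of_pos_eigenfunction (hα : 0 < α) (hα1 : α ≤ 1)
    (hd : Summable fun n : ℕ => w.d (n + 1) ^ (-(α : ℝ))) (hδ : 0 < δ) (hψ : ∀ x, δ ≤ ψ x)
    (hlam : 0 < lam) (h : ruelleLip ℝ w m A ψ = lam • ψ) {φ : LipB (SeqSpace p) α ℝ} {ρ : ℝ}
    (hρ : 0 ≤ ρ) (hφ : ∀ x, 0 < φ x) (hφρ : ruelleLip ℝ w m A φ = ρ • φ) : lam ≤ ρ := by
  have hA := A.measurable
  have hψ0 : ∀ x, 0 < ψ x := fun x => hδ.trans_le (hψ x)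
  have hψle : ∀ x, ψ x ≤ ‖ψ‖ := fun x => (le_abs_self _).trans (ψ.norm_apply_le x)
  have hψn : 0 < ‖ψ‖ := (hψ0 0).trans_le (hψle 0)
  suffices hε : ∀ ε : ℝ, 0 < ε → ε < 1 → lam * (1 - ε) ≤ ρ by
    refine le_of_forall_lt fun b hb => ?_
    obtain ⟨b', hb1, hb2⟩ := exists_between (max_lt hb hlam)
    have h1 := hε (1 - b' / lam) (sub_pos.2 ((div_lt_one hlam).2 hb2))
      (sub_lt_self _ (div_pos ((le_max_right _ _).trans_lt hb1) hlam))
    rw [sub_sub_cancel, mul_div_cancel₀ _ hlam.ne'] at h1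
    exact ((le_max_left _ _).trans_lt hb1).trans_le h1
  intro ε hε hε1
  have hb : 0 < Real.exp ‖A‖ * ‖ψ‖ := by positivity
  obtain ⟨R, hR0, hR⟩ := exists_measure_compl_Icc_le m
    (ε := ENNReal.ofReal (ε * lam * δ / (Real.exp ‖A‖ * ‖ψ‖)))
    (ENNReal.ofReal_pos.2 (by positivity))
  obtain ⟨κ, hκ⟩ := w.exists_coord_eq_div_beta (p := p) hα hα1 hd R
  have hκabs : ∀ n, |κ.coord n| = R / w.beta 0 n := fun n => by
    rw [hκ, abs_of_nonneg (div_nonneg hR0 (w.beta_pos 0 n).le)]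
  set K := SeqSpace.orderBox κ with hK
  have hKc : IsCompact K := SeqSpace.isCompact_orderBox κ
  have h0K : (0 : SeqSpace p) ∈ K := fun n => by
    rw [SeqSpace.coord_zero, abs_zero]
    exact abs_nonneg _
  have hstay : ∀ x ∈ K, ∀ r ∈ Icc (-R) R, branch w r x ∈ K := by
    intro x hx r hr n
    rw [hκabs]
    cases n with
    | zero =>
      rw [branch_coord_zero, w.beta_zero, div_one]
      exact abs_le.2 hr
    | succ n =>
      rw [branch_coord_succ, w.beta_succ, zero_add, abs_div, abs_of_pos (w.val_pos n), ← div_div]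
      have := hx n
      rw [hκabs] at this
      exact div_le_div_of_nonneg_right this (w.val_pos n).le
  set F : SeqSpace p → ℝ≥0∞ := K.indicator fun x => ENNReal.ofReal (ψ x) with hF
  have hFm : Measurable F := ψ.measurable.ennreal_ofReal.indicator hKc.isClosed.measurableSet
  set c := ENNReal.ofReal (lam * (1 - ε)) with hc
  have hFstep : (fun x => c * F x) ≤ ruelleENN w m A F := by
    intro x
    by_cases hx : x ∈ K
    · have e1 : c * F x = ENNReal.ofReal (lam * ψ x) - ENNReal.ofReal (ε * lam * ψ x) := by
        rw [hF, indicator_of_mem hx, hc,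
          ← ENNReal.ofReal_mul (mul_nonneg hlam.le (sub_nonneg.2 hε1.le)),
          ← ENNReal.ofReal_sub _ (mul_nonneg (mul_nonneg hε.le hlam.le) (hψ0 x).le)]
        ring_nf
      have e2 : ENNReal.ofReal (lam * ψ x) =
          ruelleENN w m A (fun x => ENNReal.ofReal (ψ x)) x := by
        rw [← ofReal_ruelleLip (fun x => (hψ0 x).le), h, LipB.smul_apply]
      dsimp only
      rw [e1, tsub_le_iff_right, e2]
      unfold ruelleENN
      rw [← lintegral_add_compl _ (measurableSet_Icc (a := -R) (b := R))]
      refine add_le_add ?_ ?_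
      · refine (setLIntegral_mono' measurableSet_Icc fun r hr => ?_).trans
          (setLIntegral_le_lintegral _ _)
        rw [hF, indicator_of_mem (hstay x hx r hr)]
      · calc _ ≤ ∫⁻ _r in (Icc (-R) R)ᶜ, ENNReal.ofReal (Real.exp ‖A‖ * ‖ψ‖) ∂m := by
              refine lintegral_mono fun r => ?_
              rw [← ENNReal.ofReal_mul (Real.exp_pos _).le]
              exact ENNReal.ofReal_le_ofReal (mul_le_mul (exp_bound A _) (hψle _) (hψ0 _).le
                (Real.exp_pos _).le)
          _ = ENNReal.ofReal (Real.exp ‖A‖ * ‖ψ‖) * m (Icc (-R) R)ᶜ := setLIntegral_const _ _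
          _ ≤ ENNReal.ofReal (Real.exp ‖A‖ * ‖ψ‖) *
              ENNReal.ofReal (ε * lam * δ / (Real.exp ‖A‖ * ‖ψ‖)) := mul_le_mul_right hR _
          _ = ENNReal.ofReal (ε * lam * δ) := by
              rw [← ENNReal.ofReal_mul hb.le, mul_div_cancel₀ _ hb.ne']
          _ ≤ ENNReal.ofReal (ε * lam * ψ x) :=
              ENNReal.ofReal_le_ofReal (mul_le_mul_of_nonneg_left (hψ x) (by positivity))
    · simp [hF, hx]
  have hFn : ∀ n x, c ^ n * F x ≤ (ruelleENN w m A)^[n] F x := by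
    intro n
    induction n with
    | zero => simp
    | succ n ih =>
      intro x
      rw [Function.iterate_succ_apply]
      refine le_trans ?_ (ruelleENN_iterate_mono hFstep n x)
      rw [ruelleENN_iterate_const_mul hA hFm]
      calc c ^ (n + 1) * F x = c * (c ^ n * F x) := by ring
        _ ≤ _ := mul_le_mul_right (ih x) c
  obtain ⟨z, hzK, hz⟩ := hKc.exists_isMinOn ⟨0, h0K⟩ φ.continuous.continuousOn
  have hFφ : F ≤ fun x => ENNReal.ofReal (‖ψ‖ / φ z) * ENNReal.ofReal (φ x) := by
    intro x
    by_cases hx : x ∈ K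
    · rw [hF, indicator_of_mem hx]
      dsimp only
      rw [← ENNReal.ofReal_mul (div_nonneg hψn.le (hφ z).le)]
      refine ENNReal.ofReal_le_ofReal ((hψle x).trans ?_)
      rw [div_mul_eq_mul_div, le_div_iff₀ (hφ z)]
      exact mul_le_mul_of_nonneg_left (hz hx) hψn.le
    · simp [hF, hx]
  refine le_of_forall_pow_mul_le (c := ψ 0) (B := ‖ψ‖ / φ z * φ 0) hρ (hψ0 0) fun n => ?_
  have h1 := (hFn n 0).trans (ruelleENN_iterate_mono hFφ n 0)
  rw [ruelleENN_iterate_const_mul hA φ.measurable.ennreal_ofReal] at h1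
  dsimp only at h1
  rw [← ofReal_ruelleLip_pow (fun x => (hφ x).le), ruelleLip_pow_eigen hφρ, hF,
    indicator_of_mem h0K, hc, ← ENNReal.ofReal_pow (mul_nonneg hlam.le (sub_nonneg.2 hε1.le)),
    ← ENNReal.ofReal_mul (pow_nonneg (mul_nonneg hlam.le (sub_nonneg.2 hε1.le)) n),
    ← ENNReal.ofReal_mul (div_nonneg hψn.le (hφ z).le), LipB.smul_apply,
    ENNReal.ofReal_le_ofReal_iff (mul_nonneg (div_nonneg hψn.le (hφ z).le)
      (mul_nonneg (pow_nonneg hρ n) (hφ 0).le))] at h1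
  exact h1.trans (le_of_eq (by ring))

/-- A Liouville property: nonnegative eigenfunctions for the eigenvalue `λ` satisfy a Harnack
inequality. -/
theorem eigenfunction_harnack (hα : 0 < α)
    (hd : Summable fun n : ℕ => w.d (n + 1) ^ (-(α : ℝ)))
    (hV : ∀ x y, DistortionBound w A x y V) (hδ : 0 < δ) (hψ : ∀ x, δ ≤ ψ x)
    (hlam : 0 < lam) (h : ruelleLip ℝ w m A ψ = lam • ψ) {f : LipB (SeqSpace p) α ℝ}
    (hf0 : ∀ x, 0 ≤ f x) (hf : ruelleLip ℝ w m A f = lam • f) (x y : SeqSpace p) :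
    f x ≤ Real.exp V * f y := by
  have hα' : (0 : ℝ) < α := hα
  set η : ℕ → ℝ := fun n => ‖f‖ * ((w.d n)⁻¹ * ‖x - y‖) ^ (α : ℝ) with hη
  have hη0 : ∀ n, 0 ≤ η n := fun n => mul_nonneg (norm_nonneg _)
    (Real.rpow_nonneg (mul_nonneg (inv_pos.2 (w.d_pos n)).le (norm_nonneg _)) _)
  have hlim : Tendsto η atTop (𝓝 0) := by
    have h1 := ((w.tendsto_d_inv hα hd).mul_const ‖x - y‖).rpow_const (p := (α : ℝ))
      (Or.inr hα'.le)
    rw [zero_mul, Real.zero_rpow hα'.ne'] at h1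
    simpa using h1.const_mul ‖f‖
  have key : ∀ n, f x ≤ Real.exp V * (f y + η n * (‖ψ‖ / δ)) := by
    intro n
    have h1 := ruelleLip_pow_le_of_descendant (m := m) (hV x y) (f := f)
      (g := f + LipB.const _ α ℝ (η n)) hf0
      (fun x => by
        rw [LipB.add_apply, LipB.const_apply]
        exact add_nonneg (hf0 x) (hη0 n)) n fun u v huv => by
        rw [LipB.add_apply, LipB.const_apply]
        have h2 := (le_abs_self _).trans (f.norm_sub_le u v)
        rw [dist_eq_norm] at h2
        have h3 : ‖f‖ * ‖u - v‖ ^ (α : ℝ) ≤ η n :=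
          mul_le_mul_of_nonneg_left (Real.rpow_le_rpow (norm_nonneg _) huv.norm_sub_le hα'.le)
            (norm_nonneg _)
        linarith
    rw [map_add, LipB.add_apply, ruelleLip_pow_const, ruelleLip_pow_eigen hf, LipB.smul_apply,
      LipB.smul_apply] at h1
    have h2 := mul_le_mul_of_nonneg_left
      (ruelleLip_pow_one_le_eigen (w := w) (m := m) (A := A) hδ hψ hlam h n y) (hη0 n)
    have h3 : lam ^ n * f x ≤ lam ^ n * (Real.exp V * (f y + η n * (‖ψ‖ / δ))) := by
      refine h1.trans ?_
      calc _ ≤ Real.exp V * (lam ^ n * f y + η n * (‖ψ‖ / δ * lam ^ n)) :=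
            mul_le_mul_of_nonneg_left (by linarith) (Real.exp_pos _).le
        _ = _ := by ring
    exact le_of_mul_le_mul_left h3 (pow_pos hlam n)
  have hlim' : Tendsto (fun n => Real.exp V * (f y + η n * (‖ψ‖ / δ))) atTop
      (𝓝 (Real.exp V * (f y + 0 * (‖ψ‖ / δ)))) :=
    ((hlim.mul_const _).const_add _).const_mul _
  simpa using ge_of_tendsto' hlim' key

theorem pos_eigenfunction_unique (hα : 0 < α) (hα1 : α ≤ 1)
    (hd : Summable fun n : ℕ => w.d (n + 1) ^ (-(α : ℝ)))
    (hV : ∀ x y, DistortionBound w A x y V) (hδ : 0 < δ) (hψ : ∀ x, δ ≤ ψ x)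
    (hlam : 0 < lam) (h : ruelleLip ℝ w m A ψ = lam • ψ) {φ : LipB (SeqSpace p) α ℝ} {ρ : ℝ}
    (hφ : ∀ x, 0 < φ x) (hφρ : ruelleLip ℝ w m A φ = ρ • φ) : ∃ t : ℝ, ∀ x, φ x = t * ψ x := by
  have hψ0 : ∀ x, 0 < ψ x := fun x => hδ.trans_le (hψ x)
  have hψle : ∀ x, ψ x ≤ ‖ψ‖ := fun x => (le_abs_self _).trans (ψ.norm_apply_le x)
  have hρ0 : 0 ≤ ρ := by
    have h1 := ruelleLip_nonneg (w := w) (m := m) (A := A) (fun x => (hφ x).le) 0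
    rw [hφρ, LipB.smul_apply] at h1
    exact nonneg_of_mul_nonneg_left h1 (hφ 0)
  have hρle : ρ ≤ lam := by
    refine le_of_forall_pow_mul_le (c := φ 0) (B := ‖φ‖ * (‖ψ‖ / δ)) hlam.le (hφ 0) fun n => ?_
    have h1 := ruelleLip_pow_le_of_le (w := w) (m := m) (A := A) (f := φ)
      (fun x => (le_abs_self _).trans (φ.norm_apply_le x)) n 0
    rw [ruelleLip_pow_eigen hφρ, LipB.smul_apply] at h1
    rw [mul_assoc]
    exact h1.trans (mul_le_mul_of_nonneg_left (ruelleLip_pow_one_le_eigen hδ hψ hlam h n 0)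
      (norm_nonneg _))
  obtain rfl : ρ = lam := hρle.antisymm
    (eigenvalue_le_of_pos_eigenfunction hα hα1 hd hδ hψ hlam h hρ0 hφ hφρ)
  -- subtract the largest multiple of `ψ` below `φ`
  set s := ⨅ x, φ x / ψ x with hs
  have hbdd : BddBelow (range fun x => φ x / ψ x) :=
    ⟨0, by rintro _ ⟨x, rfl⟩; exact (div_pos (hφ x) (hψ0 x)).le⟩
  set f := φ - s • ψ with hf
  have hfx : ∀ x, f x = φ x - s * ψ x := fun x => rfl
  have hf0 : ∀ x, 0 ≤ f x := fun x => by
    rw [hfx, sub_nonneg, ← le_div_iff₀ (hψ0 x)]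
    exact ciInf_le hbdd x
  have hfe : ruelleLip ℝ w m A f = ρ • f := by
    rw [hf, map_sub, map_smul, h, hφρ, smul_sub, smul_comm]
  refine ⟨s, fun x => sub_eq_zero.1 (le_antisymm ?_ (hf0 x))⟩
  refine le_of_forall_pos_le_add fun ε hε => ?_
  have hψn : 0 < ‖ψ‖ := (hψ0 0).trans_le (hψle 0)
  have hB : 0 < Real.exp V * ‖ψ‖ := by positivity
  obtain ⟨y, hy⟩ := exists_lt_of_ciInf_lt
    (show ⨅ x, φ x / ψ x < s + ε / (Real.exp V * ‖ψ‖) from lt_add_of_pos_right _ (by positivity))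
  rw [div_lt_iff₀ (hψ0 y)] at hy
  have h1 := eigenfunction_harnack hα hd hV hδ hψ hlam h hf0 hfe x y
  have h2 : f y ≤ ε / (Real.exp V * ‖ψ‖) * ‖ψ‖ := by
    rw [hfx]
    have := mul_le_mul_of_nonneg_left (hψle y) (show 0 ≤ ε / (Real.exp V * ‖ψ‖) by positivity)
    linarith
  rw [zero_add, ← hfx]
  refine h1.trans ((mul_le_mul_of_nonneg_left h2 (Real.exp_pos _).le).trans (le_of_eq ?_))
  field_simp

end Spectral

/-! ### The dual operator of a normalized potential -/

section Normalized

variable {p : ℝ≥0∞} [Fact (1 ≤ p)] {α : ℝ≥0} {w : ShiftWeight} {m : Measure ℝ}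
  [IsProbabilityMeasure m] {A : LipB (SeqSpace p) α ℝ}

theorem dualRuelle_apply (ν : Measure (SeqSpace p)) [SFinite ν] {S : Set (SeqSpace p)}
    (hS : MeasurableSet S) :
    dualRuelle w m A ν S = ∫⁻ x, ruelleENN w m A (S.indicator 1) x ∂ν := by
  rw [← lintegral_dualRuelle A.measurable ν (measurable_one.indicator hS),
    lintegral_indicator_one hS]

theorem measurable_weightedShift (w : ShiftWeight) :
    Measurable (weightedShift w : SeqSpace p → SeqSpace p) :=
  (weightedShift w : SeqSpace p →L[ℝ] SeqSpace p).continuous.measurable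

/-- Conditioning on `U` becomes conditioning on `L⁻¹ U`, since all mass of the dual operator at `x`
sits on the preimages of `x` under `L`. -/
theorem dualRuelle_restrict (ν : Measure (SeqSpace p)) [SFinite ν] {U : Set (SeqSpace p)}
    (hU : MeasurableSet U) :
    dualRuelle w m A (ν.restrict U) = (dualRuelle w m A ν).restrict (weightedShift w ⁻¹' U) := by
  ext S hS
  have hLU := measurable_weightedShift w hU
  have h1 : (fun x : SeqSpace p =>
      (U.indicator (1 : SeqSpace p → ℝ≥0∞) (weightedShift w x)) * S.indicator 1 x) =
      (S ∩ weightedShift w ⁻¹' U).indicator 1 := by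
    funext x
    by_cases hx : x ∈ S <;> by_cases hx' : weightedShift w x ∈ U <;> simp [hx, hx']
  rw [Measure.restrict_apply hS, dualRuelle_apply _ hS, dualRuelle_apply _ (hS.inter hLU), ← h1,
    ruelleENN_mul_comp_shift A.measurable (measurable_one.indicator hS), ← lintegral_indicator hU]
  refine lintegral_congr fun x => ?_
  by_cases hx : x ∈ U <;> simp [hx]

theorem ruelleENN_one (hN : IsNormalized w m A) :
    ruelleENN w m A (1 : SeqSpace p → ℝ≥0∞) = 1 := by
  funext x
  have h := ofReal_ruelleLip (w := w) (m := m) (A := A) (f := LipB.const _ α ℝ 1)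
    (fun _ => zero_le_one) x
  have h1 : ruelleLip ℝ w m A (LipB.const _ α ℝ 1) x = 1 := hN x
  rw [h1, ENNReal.ofReal_one] at h
  have h2 : (fun x : SeqSpace p => ENNReal.ofReal (LipB.const (SeqSpace p) α ℝ 1 x)) = 1 :=
    funext fun x => ENNReal.ofReal_one
  rw [h2] at h
  exact h.symm

theorem dualRuelle_preimage (hN : IsNormalized w m A) (ν : Measure (SeqSpace p)) [SFinite ν]
    {U : Set (SeqSpace p)} (hU : MeasurableSet U) :
    dualRuelle w m A ν (weightedShift w ⁻¹' U) = ν U := by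
  have h := congrArg (fun μ => μ univ) (dualRuelle_restrict (w := w) (m := m) (A := A) ν hU)
  rw [Measure.restrict_apply_univ, dualRuelle_apply _ MeasurableSet.univ, indicator_univ,
    ruelleENN_one hN] at h
  simpa using h.symm

theorem isProbabilityMeasure_dualRuelle (hN : IsNormalized w m A) (ν : Measure (SeqSpace p))
    [IsProbabilityMeasure ν] : IsProbabilityMeasure (dualRuelle w m A ν) :=
  ⟨by simpa using dualRuelle_preimage hN ν MeasurableSet.univ⟩

theorem isProbabilityMeasure_dualRuelle_iterate (hN : IsNormalized w m A)
    (ν : Measure (SeqSpace p)) [IsProbabilityMeasure ν] (n : ℕ) :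
    IsProbabilityMeasure ((dualRuelle w m A)^[n] ν) := by
  induction n with
  | zero => assumption
  | succ n ih =>
    rw [Function.iterate_succ_apply']
    exact isProbabilityMeasure_dualRuelle hN _

theorem dualRuelle_iterate_preimage (hN : IsNormalized w m A) (ν : Measure (SeqSpace p))
    [IsProbabilityMeasure ν] (n : ℕ) {U : Set (SeqSpace p)} (hU : MeasurableSet U) :
    (dualRuelle w m A)^[n] ν ((weightedShift w)^[n] ⁻¹' U) = ν U := by
  induction n with
  | zero => rfl
  | succ n ih =>
    have := isProbabilityMeasure_dualRuelle_iterate hN ν n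
    rw [Function.iterate_succ_apply', Function.iterate_succ, preimage_comp,
      dualRuelle_preimage hN _ ((measurable_weightedShift w).iterate n hU), ih]

theorem weightedShift_iterate_coord (w : ShiftWeight) (n k : ℕ) (x : SeqSpace p) :
    ((weightedShift w)^[n] x).coord k = w.beta k n * x.coord (k + n) := by
  induction n generalizing x with
  | zero => simp [ShiftWeight.beta_zero]
  | succ n ih =>
    rw [Function.iterate_succ_apply, ih, weightedShift_coord, w.beta_succ]
    ring_nf

/-- Deep coordinates are small: the shift expands by at least `d_n` in `n` steps. -/
theorem norm_tail_le (w : ShiftWeight) (n : ℕ) (x : SeqSpace p) :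
    ‖SeqSpace.tail n x‖ ≤ (w.d n)⁻¹ * ‖(weightedShift w)^[n] x‖ := by
  refine SeqSpace.norm_le_of_shift (inv_pos.2 (w.d_pos n)).le n (fun i hi => ?_) fun k => ?_
  · rw [SeqSpace.tail_coord, if_pos hi]
  · rw [SeqSpace.tail_coord, if_neg (by omega), weightedShift_iterate_coord, abs_mul,
      abs_of_pos (w.beta_pos k n), ← mul_assoc, add_comm n k]
    refine le_mul_of_one_le_left (abs_nonneg _) ?_
    rw [← div_eq_inv_mul, one_le_div (w.d_pos n)]
    exact w.d_le_beta k n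

theorem measurable_coord (n : ℕ) : Measurable fun x : SeqSpace p => x.coord n :=
  (SeqSpace.continuous_coord n).measurable

/-- The first coordinate of the chain has a law with density at most `e^{‖A‖}` with respect
to `m`, so that the tails of `m` control it. -/
theorem dualRuelle_coord_zero_le (ν : Measure (SeqSpace p)) [IsProbabilityMeasure ν] {S : Set ℝ}
    (hS : MeasurableSet S) :
    dualRuelle w m A ν ((fun z => z.coord 0) ⁻¹' S) ≤ ENNReal.ofReal (Real.exp ‖A‖) * m S := by
  rw [dualRuelle_apply _ (measurable_coord 0 hS)]
  calc _ ≤ ∫⁻ _x, ENNReal.ofReal (Real.exp ‖A‖) * m S ∂ν := by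
        refine lintegral_mono fun x => ?_
        rw [← lintegral_indicator_one hS, ← lintegral_const_mul _ (measurable_one.indicator hS)]
        refine lintegral_mono fun r => ?_
        exact mul_le_mul' (ENNReal.ofReal_le_ofReal (exp_bound A _)) le_rfl
    _ = _ := by simp

/-- Up to a set of measure `ε`, the chain of inverse branches started at `x` stays close to a
fixed compact box, at a distance that tends to `0` with the length of the chain. -/
theorem exists_box_of_adaptedTails (hT : AdaptedTails p w m) (hN : IsNormalized w m A) {ε : ℝ≥0∞}
    (hε : 0 < ε) : ∃ κ : SeqSpace p, ∀ (l : ℕ) (x : SeqSpace p),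
      (dualRuelle w m A)^[l] (Measure.dirac x)
        {z | ∃ y ∈ SeqSpace.orderBox κ, ‖z - y‖ ≤ (w.d l)⁻¹ * ‖x‖}ᶜ ≤ ε := by
  have hM0 : ENNReal.ofReal (Real.exp ‖A‖) ≠ 0 := (ENNReal.ofReal_pos.2 (Real.exp_pos _)).ne'
  obtain ⟨κ, hκ0, hκ⟩ := hT (ε / ENNReal.ofReal (Real.exp ‖A‖))
    (ENNReal.div_pos hε.ne' ENNReal.ofReal_ne_top)
  obtain ⟨C, hC0, hC⟩ := w.exists_upper
  refine ⟨C • κ, fun l x => ?_⟩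
  set I : ℕ → Set ℝ := fun j => Icc (-(w.beta 0 (j + 1) * κ.coord j)) (w.beta 0 (j + 1) * κ.coord j)
    with hI
  set bad : ℕ → Set (SeqSpace p) := fun j =>
    (weightedShift w)^[j] ⁻¹' ((fun u => u.coord 0) ⁻¹' (I j)ᶜ)
    with hbad
  have hsub : {z | ∃ y ∈ SeqSpace.orderBox (C • κ), ‖z - y‖ ≤ (w.d l)⁻¹ * ‖x‖}ᶜ ⊆
      ((weightedShift w)^[l] ⁻¹' {x}ᶜ) ∪ ⋃ j ∈ Finset.range l, bad j := by
    intro z hz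
    by_contra hcon
    simp only [mem_union, mem_preimage, mem_compl_iff, mem_singleton_iff, not_or, not_not,
      mem_iUnion, not_exists] at hcon
    obtain ⟨hx, hgood⟩ := hcon
    refine hz ⟨z - SeqSpace.tail l z, fun j => ?_, ?_⟩
    · rw [SeqSpace.coord_sub, SeqSpace.tail_coord]
      split_ifs with hj
      · have h1 : ((weightedShift w)^[j] z).coord 0 ∈ I j := by
          by_contra h
          exact hgood j (Finset.mem_range.2 hj) h
        rw [weightedShift_iterate_coord, zero_add] at h1
        have h2 := abs_le.2 h1
        rw [abs_mul, abs_of_pos (w.beta_pos 0 j), w.beta_succ, zero_add, mul_assoc] at h2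
        have h3 := le_of_mul_le_mul_left h2 (w.beta_pos 0 j)
        rw [sub_zero, SeqSpace.coord_smul, abs_of_nonneg (mul_nonneg hC0 (hκ0 j).le)]
        exact h3.trans (mul_le_mul_of_nonneg_right ((le_abs_self _).trans (hC j)) (hκ0 j).le)
      · rw [sub_self, abs_zero]
        exact abs_nonneg _
    · rw [sub_sub_cancel, ← hx]
      exact norm_tail_le w l z
  have h1 : (dualRuelle w m A)^[l] (Measure.dirac x) ((weightedShift w)^[l] ⁻¹' {x}ᶜ) = 0 := by
    rw [dualRuelle_iterate_preimage hN _ _ (measurableSet_singleton x).compl]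
    simp
  have h2 : ∀ j ∈ Finset.range l, (dualRuelle w m A)^[l] (Measure.dirac x) (bad j) ≤
      ENNReal.ofReal (Real.exp ‖A‖) * m (I j)ᶜ := by
    intro j hj
    obtain ⟨i, rfl⟩ := Nat.exists_eq_add_of_lt (Finset.mem_range.1 hj)
    have hp := isProbabilityMeasure_dualRuelle_iterate hN (Measure.dirac x) i
    have hp' := isProbabilityMeasure_dualRuelle_iterate hN (Measure.dirac x) (i + 1)
    rw [show j + i + 1 = j + (i + 1) by ring, Function.iterate_add_apply, hbad]
    dsimp only
    rw [dualRuelle_iterate_preimage hN _ _ (measurable_coord 0 measurableSet_Icc.compl),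
      Function.iterate_succ_apply']
    exact dualRuelle_coord_zero_le _ measurableSet_Icc.compl
  calc _ ≤ _ := measure_mono hsub
    _ ≤ 0 + ∑ j ∈ Finset.range l, (dualRuelle w m A)^[l] (Measure.dirac x) (bad j) :=
      (measure_union_le _ _).trans (add_le_add h1.le (measure_biUnion_finset_le _ _))
    _ ≤ ∑ j ∈ Finset.range l, ENNReal.ofReal (Real.exp ‖A‖) * m (I j)ᶜ := by
      rw [zero_add]; exact Finset.sum_le_sum h2
    _ ≤ ENNReal.ofReal (Real.exp ‖A‖) * ∑' j, m (I j)ᶜ := by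
      rw [← Finset.mul_sum]
      exact mul_le_mul_right (ENNReal.sum_le_tsum _) _
    _ ≤ ENNReal.ofReal (Real.exp ‖A‖) * (ε / ENNReal.ofReal (Real.exp ‖A‖)) :=
      mul_le_mul_right hκ.le _
    _ = ε := ENNReal.mul_div_cancel hM0 ENNReal.ofReal_ne_top

theorem integral_dualRuelle_iterate (hN : IsNormalized w m A) (f : LipB (SeqSpace p) α ℝ)
    (ν : Measure (SeqSpace p)) [IsProbabilityMeasure ν] (n : ℕ) :
    ∫ x, f x ∂((dualRuelle w m A)^[n] ν) = ∫ x, (ruelleLip ℝ w m A ^ n) f x ∂ν := by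
  induction n generalizing f with
  | zero => rfl
  | succ n ih =>
    have := isProbabilityMeasure_dualRuelle_iterate hN ν n
    rw [Function.iterate_succ_apply', ruelleLip_pow_add n 1, pow_one, ← ih]
    exact integral_dualRuelle w m A.toBCF _ f.toBCF

theorem LipB.integrable (f : LipB (SeqSpace p) α ℝ) (ν : Measure (SeqSpace p))
    [IsFiniteMeasure ν] : Integrable f ν := f.toBCF.integrable ν

theorem ruelleLip_pow_one (hN : IsNormalized w m A) (n : ℕ) (x : SeqSpace p) :
    (ruelleLip ℝ w m A ^ n) (LipB.const _ α ℝ 1) x = 1 := by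
  have h : ruelleLip ℝ w m A (LipB.const _ α ℝ 1) = (1 : ℝ) • LipB.const _ α ℝ 1 := by
    rw [one_smul]
    exact LipB.ext_apply hN
  rw [ruelleLip_pow_eigen h, one_pow, one_smul, LipB.const_apply]

theorem abs_ruelleLip_pow_le (hN : IsNormalized w m A) (f : LipB (SeqSpace p) α ℝ) (n : ℕ)
    (x : SeqSpace p) : |(ruelleLip ℝ w m A ^ n) f x| ≤ ‖f‖ := by
  have hf := fun x => abs_le.1 (f.norm_apply_le x)
  have h1 := ruelleLip_pow_le_of_le (w := w) (m := m) (A := A) (fun x => (hf x).2) n x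
  have h2 := le_ruelleLip_pow_of_le (w := w) (m := m) (A := A) (fun x => (hf x).1) n x
  rw [ruelleLip_pow_one hN, mul_one] at h1 h2
  exact abs_le.2 ⟨h2, h1⟩

theorem equicontinuous_ruelleLip_pow (hα : 0 < α)
    (hd : Summable fun n : ℕ => w.d (n + 1) ^ (-(α : ℝ))) (hN : IsNormalized w m A)
    (f : LipB (SeqSpace p) α ℝ) {ε : ℝ} (hε : 0 < ε) :
    ∃ δ > 0, ∀ n x y, ‖x - y‖ < δ →
      |(ruelleLip ℝ w m A ^ n) f x - (ruelleLip ℝ w m A ^ n) f y| ≤ ε := by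
  obtain ⟨D, hD0, hD⟩ := w.exists_d_inv_le hα hd
  have hα' : (0 : ℝ) < α := hα
  set C₁ : ℝ := ‖A‖ * ∑' n : ℕ, w.d (n + 1) ^ (-(α : ℝ)) with hC₁
  have hC₁0 : 0 ≤ C₁ := mul_nonneg (norm_nonneg _)
    (tsum_nonneg fun _ => Real.rpow_nonneg (w.d_pos _).le _)
  set ω : ℝ → ℝ := fun t => 3 * ‖f‖ * (Real.exp (C₁ * t ^ (α : ℝ)) - 1) +
    Real.exp (C₁ * t ^ (α : ℝ)) * (‖f‖ * (D * t) ^ (α : ℝ)) with hω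
  have hωc : Continuous ω := by
    have h1 : Continuous fun t : ℝ => t ^ (α : ℝ) := Real.continuous_rpow_const hα'.le
    have h2 : Continuous fun t : ℝ => (D * t) ^ (α : ℝ) := h1.comp (continuous_const_mul D)
    fun_prop
  have hω0 : ω 0 = 0 := by simp [hω, Real.zero_rpow hα'.ne']
  have hev := (hωc.tendsto 0).eventually (gt_mem_nhds (show ω 0 < ε by rwa [hω0]))
  obtain ⟨δ, hδ, hδω⟩ := Metric.eventually_nhds_iff.1 hev
  have key : ∀ n x y, ‖x - y‖ < δ →
      (ruelleLip ℝ w m A ^ n) f x - (ruelleLip ℝ w m A ^ n) f y ≤ ε := by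
    intro n x y hxy
    have hE' := distortionBound_holder (w := w) A hd y x
    rw [norm_sub_rev y x] at hE'
    have ht : 0 ≤ ‖x - y‖ ^ (α : ℝ) := Real.rpow_nonneg (norm_nonneg _) _
    have h1 := ruelleLip_pow_sub_le (m := m) (by positivity) (distortionBound_holder A hd x y) hE'
      (K := ‖f‖) (η := ‖f‖ * (D * ‖x - y‖) ^ (α : ℝ)) (by positivity) f.norm_apply_le n
      fun u v huv => by
        refine (f.norm_sub_le u v).trans (mul_le_mul_of_nonneg_left ?_ (norm_nonneg _))
        rw [dist_eq_norm]
        exact Real.rpow_le_rpow (norm_nonneg _) (huv.norm_sub_le.trans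
          (mul_le_mul_of_nonneg_right (hD n) (norm_nonneg _))) hα'.le
    rw [ruelleLip_pow_one hN, mul_one] at h1
    refine h1.trans (hδω (y := ‖x - y‖) ?_).le
    rwa [dist_zero_right, norm_norm]
  exact ⟨δ, hδ, fun n x y hxy => abs_sub_le_iff.2
    ⟨key n x y hxy, key n y x (by rwa [norm_sub_rev])⟩⟩

end Normalized

/-! ### Decay of oscillations -/

section Oscillation

variable {p : ℝ≥0∞} [Fact (1 ≤ p)] {α : ℝ≥0} {w : ShiftWeight} {m : Measure ℝ}
  [IsProbabilityMeasure m] {A : LipB (SeqSpace p) α ℝ}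

/-- Up to probability `t`, the chains of inverse branches started in a ball stay in a larger ball,
whatever their length. -/
theorem exists_ball_of_adaptedTails (hα : 0 < α)
    (hd : Summable fun n : ℕ => w.d (n + 1) ^ (-(α : ℝ))) (hT : AdaptedTails p w m)
    (hN : IsNormalized w m A) {t : ℝ} (ht : 0 < t) (R : ℝ) :
    ∃ R', R ≤ R' ∧ ∀ (l : ℕ) (x : SeqSpace p), ‖x‖ ≤ R →
      ((dualRuelle w m A)^[l] (Measure.dirac x)).real (Metric.closedBall 0 R')ᶜ ≤ t := by
  obtain ⟨κ, hκ⟩ := exists_box_of_adaptedTails hT hN (ENNReal.ofReal_pos.2 ht)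
  obtain ⟨D, hD0, hD⟩ := w.exists_d_inv_le hα hd
  refine ⟨max R (‖κ‖ + D * R), le_max_left _ _, fun l x hx => ENNReal.toReal_le_of_le_ofReal ht.le
    ((measure_mono (compl_subset_compl.2 ?_)).trans (hκ l x))⟩
  rintro z ⟨y, hy, hzy⟩
  rw [mem_closedBall_zero_iff]
  have h1 := SeqSpace.norm_le_of_mem_orderBox hy
  have h2 : (w.d l)⁻¹ * ‖x‖ ≤ D * R := mul_le_mul (hD l) hx (norm_nonneg _) hD0
  have h3 := norm_le_norm_add_norm_sub' z y
  refine le_max_of_le_right ?_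
  linarith

/-- Recurrence: from every bounded set the chain of inverse branches reaches one fixed ball with
probability at least `1 / 2`. -/
theorem exists_recurrent_ball (hα : 0 < α)
    (hd : Summable fun n : ℕ => w.d (n + 1) ^ (-(α : ℝ))) (hT : AdaptedTails p w m)
    (hN : IsNormalized w m A) :
    ∃ R₀, 0 ≤ R₀ ∧ ∀ R, ∃ l, ∀ x : SeqSpace p, ‖x‖ ≤ R →
      1 / 2 ≤ ((dualRuelle w m A)^[l] (Measure.dirac x)).real (Metric.closedBall 0 R₀) := by
  obtain ⟨κ, hκ⟩ := exists_box_of_adaptedTails hT hN (ENNReal.ofReal_pos.2 (one_half_pos (α := ℝ)))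
  refine ⟨‖κ‖ + 1, by positivity, fun R => ?_⟩
  have h1 := (w.tendsto_d_inv hα hd).mul_const R
  rw [zero_mul] at h1
  obtain ⟨l, hl⟩ := (h1.eventually (gt_mem_nhds one_pos)).exists
  refine ⟨l, fun x hx => ?_⟩
  have := isProbabilityMeasure_dualRuelle_iterate hN (Measure.dirac x) l
  have h2 : ((dualRuelle w m A)^[l] (Measure.dirac x)).real
      (Metric.closedBall 0 (‖κ‖ + 1))ᶜ ≤ 1 / 2 := by
    refine ENNReal.toReal_le_of_le_ofReal (by norm_num)
      ((measure_mono (compl_subset_compl.2 ?_)).trans (hκ l x))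
    rintro z ⟨y, hy, hzy⟩
    rw [mem_closedBall_zero_iff]
    have h3 := SeqSpace.norm_le_of_mem_orderBox hy
    have h4 : (w.d l)⁻¹ * ‖x‖ ≤ (w.d l)⁻¹ * R :=
      mul_le_mul_of_nonneg_left hx (inv_pos.2 (w.d_pos l)).le
    have h5 := norm_le_norm_add_norm_sub' z y
    linarith
  rw [probReal_compl_eq_one_sub Metric.isClosed_closedBall.measurableSet] at h2
  linarith

theorem integral_le_add_of_le_on {Ω : Type*} [MeasurableSpace Ω] {ν : Measure Ω}
    [IsFiniteMeasure ν] {f g : Ω → ℝ} (hf : Integrable f ν) (hg : Integrable g ν) {B : Set Ω}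
    (hB : MeasurableSet B) {c t : ℝ} (hc : 0 ≤ c) (h : ∀ x ∈ B, f x ≤ g x)
    (h' : ∀ x, f x ≤ g x + c) (ht : ν.real Bᶜ ≤ t) : ∫ x, f x ∂ν ≤ ∫ x, g x ∂ν + c * t := by
  have hi : Integrable (Bᶜ.indicator fun _ => c) ν := (integrable_const c).indicator hB.compl
  calc ∫ x, f x ∂ν ≤ ∫ x, (g x + Bᶜ.indicator (fun _ => c) x) ∂ν := by
        refine integral_mono hf (hg.add hi) fun x => ?_
        by_cases hx : x ∈ B
        · simpa [hx] using h x hx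
        · simpa [hx] using h' x
    _ = ∫ x, g x ∂ν + c * ν.real Bᶜ := by
        rw [integral_add hg hi, integral_indicator_const _ hB.compl, smul_eq_mul, mul_comm]
    _ ≤ _ := by gcongr

/-- The positive part of `f - c`. -/
noncomputable def LipB.posPartSub (hα : 0 < α) (f : LipB (SeqSpace p) α ℝ) (c : ℝ) :
    LipB (SeqSpace p) α ℝ :=
  LipB.of hα (fun x => max (f x - c) 0) (‖f‖ + |c|) ‖f‖
    (fun x => by
      have h1 := abs_le.1 (f.norm_apply_le x)
      rw [Real.norm_of_nonneg (le_max_right _ _)]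
      exact max_le (by linarith [neg_abs_le c]) (by positivity))
    (fun x y => (abs_max_sub_max_le_abs _ _ _).trans (by
      rw [sub_sub_sub_cancel_right]
      exact f.norm_sub_le x y))

theorem integral_dualRuelle_dirac (hN : IsNormalized w m A) (f : LipB (SeqSpace p) α ℝ) (l : ℕ)
    (x : SeqSpace p) :
    ∫ z, f z ∂((dualRuelle w m A)^[l] (Measure.dirac x)) = (ruelleLip ℝ w m A ^ l) f x := by
  rw [integral_dualRuelle_iterate hN, integral_dirac]

/-- The oscillation of `P^n f` over balls is asymptotically at most `D`. -/
def OscillationBound (w : ShiftWeight) (m : Measure ℝ) [IsProbabilityMeasure m]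
    (A f : LipB (SeqSpace p) α ℝ) (D : ℝ) : Prop :=
  ∀ R ε : ℝ, 0 < ε → ∃ N, ∀ n ≥ N, ∀ x y : SeqSpace p, ‖x‖ ≤ R → ‖y‖ ≤ R →
    (ruelleLip ℝ w m A ^ n) f x - (ruelleLip ℝ w m A ^ n) f y ≤ D + ε

/-- On a fixed ball, the images of two points under the same branches become close, and the
distributions of these branches are comparable: this contracts the oscillation. -/
theorem oscillation_contract_on_ball (hα : 0 < α)
    (hd : Summable fun n : ℕ => w.d (n + 1) ^ (-(α : ℝ))) (hT : AdaptedTails p w m)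
    (hN : IsNormalized w m A) {f : LipB (SeqSpace p) α ℝ} {D : ℝ} (hD : 0 ≤ D)
    (h : OscillationBound w m A f D) {R ε : ℝ} (hR : 0 ≤ R) (hε : 0 < ε) :
    ∃ N, ∀ n ≥ N, ∀ x y : SeqSpace p, ‖x‖ ≤ R → ‖y‖ ≤ R →
      (ruelleLip ℝ w m A ^ n) f x - (ruelleLip ℝ w m A ^ n) f y ≤
        (1 - Real.exp (-(‖A‖ * (∑' n : ℕ, w.d (n + 1) ^ (-(α : ℝ))) * (2 * R) ^ (α : ℝ)))) * D
          + ε := by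
  have hS0 : 0 ≤ ∑' n : ℕ, w.d (n + 1) ^ (-(α : ℝ)) :=
    tsum_nonneg fun _ => Real.rpow_nonneg (w.d_pos _).le _
  set E := ‖A‖ * (∑' n : ℕ, w.d (n + 1) ^ (-(α : ℝ))) * (2 * R) ^ (α : ℝ) with hE
  have hE0 : 0 ≤ E := by positivity
  set θ := Real.exp (-E) with hθ
  have hθ0 : 0 < θ := Real.exp_pos _
  have hθ1 : θ ≤ 1 := Real.exp_le_one_iff.2 (by linarith)
  set K := ‖f‖ with hK
  have hK0 : 0 ≤ K := norm_nonneg _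
  set t := ε / (12 * (K + 1)) with ht
  have ht0 : 0 < t := by positivity
  have hKt : 4 * K * t ≤ ε / 3 := by
    have : 12 * (K + 1) * t = ε := mul_div_cancel₀ _ (by positivity)
    linarith
  obtain ⟨R', hRR', hR'⟩ := exists_ball_of_adaptedTails hα hd hT hN ht0 R
  obtain ⟨δ, hδ, hequi⟩ := equicontinuous_ruelleLip_pow hα hd hN f (ε := ε / 3) (by positivity)
  have hlim := (w.tendsto_d_inv hα hd).mul_const (2 * R)
  rw [zero_mul] at hlim
  obtain ⟨l, hl⟩ := (hlim.eventually (gt_mem_nhds hδ)).exists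
  obtain ⟨N, hN'⟩ := h R' (ε / 3) (by positivity)
  refine ⟨l + N, fun k hk x y hx hy => ?_⟩
  obtain ⟨n, rfl⟩ := Nat.exists_eq_add_of_le ((Nat.le_add_right l N).trans hk)
  have hn : N ≤ n := by omega
  rw [ruelleLip_pow_add]
  set g := (ruelleLip ℝ w m A ^ n) f with hg
  have hgK : ∀ z, -K ≤ g z ∧ g z ≤ K := fun z => abs_le.1 (abs_ruelleLip_pow_le hN f n z)
  set B : Set (SeqSpace p) := Metric.closedBall 0 R' with hB
  have hBm : MeasurableSet B := Metric.isClosed_closedBall.measurableSet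
  have hmemB : ∀ z, z ∈ B ↔ ‖z‖ ≤ R' := fun z => mem_closedBall_zero_iff
  have h0B : (0 : SeqSpace p) ∈ B := (hmemB 0).2 (by rw [norm_zero]; exact hR.trans hRR')
  set b := D + ε / 3 with hb
  have hosc : ∀ u ∈ B, ∀ v ∈ B, g u - g v ≤ b := fun u hu v hv =>
    hN' n hn u v ((hmemB u).1 hu) ((hmemB v).1 hv)
  set i := sInf (g '' B) with hi
  have hbdd : BddBelow (g '' B) := ⟨-K, by rintro _ ⟨z, -, rfl⟩; exact (hgK z).1⟩
  have hne : (g '' B).Nonempty := ⟨_, 0, h0B, rfl⟩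
  have hig : ∀ z ∈ B, i ≤ g z := fun z hz => csInf_le hbdd ⟨z, hz, rfl⟩
  have hgi : ∀ z ∈ B, g z ≤ i + b := fun z hz => by
    have : g z - b ≤ i := le_csInf hne (by rintro _ ⟨v, hv, rfl⟩; linarith [hosc z hz v hv])
    linarith
  have hiK : -K ≤ i := le_csInf hne (by rintro _ ⟨v, -, rfl⟩; exact (hgK v).1)
  have hiK' : i ≤ K := (hig 0 h0B).trans (hgK 0).2
  set g' := g.posPartSub hα i with hg'
  have hg'z : ∀ z, g' z = max (g z - i) 0 := fun z => rfl
  have hnorm : ‖x - y‖ ≤ 2 * R := (norm_sub_le x y).trans (by linarith)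
  have hdist : DistortionBound w A x y E := (distortionBound_holder A hd x y).mono <| by
    refine mul_le_mul_of_nonneg_left ?_ (by positivity)
    exact Real.rpow_le_rpow (norm_nonneg _) hnorm (NNReal.coe_nonneg α)
  have h1 := ruelleLip_pow_le_of_descendant (m := m) hdist (f := g')
    (g := g' + LipB.const _ α ℝ (ε / 3)) (fun z => le_max_right _ _)
    (fun z => add_nonneg (le_max_right _ _) (by positivity : 0 ≤ ε / 3)) l fun u v huv => by
      have h2 : ‖u - v‖ < δ := (huv.norm_sub_le.trans
        (mul_le_mul_of_nonneg_left hnorm (inv_pos.2 (w.d_pos l)).le)).trans_lt hl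
      have h3 := (abs_le.1 (hequi n u v h2)).2
      rw [LipB.add_apply, LipB.const_apply, hg'z, hg'z]
      refine max_le ?_ (by positivity)
      linarith [le_max_left (g v - i) 0]
  rw [map_add, LipB.add_apply, ruelleLip_pow_const, ruelleLip_pow_one hN, mul_one] at h1
  have h1' : θ * (ruelleLip ℝ w m A ^ l) g' x ≤ (ruelleLip ℝ w m A ^ l) g' y + ε / 3 := by
    rw [hθ, Real.exp_neg, inv_mul_le_iff₀ (Real.exp_pos _)]
    exact h1
  have hpx := isProbabilityMeasure_dualRuelle_iterate hN (Measure.dirac x) l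
  have hpy := isProbabilityMeasure_dualRuelle_iterate hN (Measure.dirac y) l
  have h2 : (ruelleLip ℝ w m A ^ l) g' x ≤ b + 2 * K * t := by
    rw [← integral_dualRuelle_dirac hN]
    refine (integral_le_add_of_le_on (g := fun _ => b) (g'.integrable _) (integrable_const _) hBm
      (c := 2 * K) (by positivity) (fun z hz => ?_) (fun z => ?_) (hR' l x hx)).trans ?_
    · rw [hg'z]
      exact max_le (by linarith [hgi z hz]) (by positivity)
    · rw [hg'z]
      exact max_le (by linarith [(hgK z).2, show 0 ≤ b by positivity]) (by positivity)
    · rw [integral_const, probReal_univ, one_smul]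
  have h3 : (ruelleLip ℝ w m A ^ l) g x ≤ (ruelleLip ℝ w m A ^ l) g' x + i := by
    have := ruelleLip_pow_mono (w := w) (m := m) (A := A) (f := g) (g := g' + LipB.const _ α ℝ i)
      (fun z => by
        rw [LipB.add_apply, LipB.const_apply, hg'z]
        linarith [le_max_left (g z - i) 0]) l x
    rwa [map_add, LipB.add_apply, ruelleLip_pow_const, ruelleLip_pow_one hN, mul_one] at this
  have h4 : (ruelleLip ℝ w m A ^ l) g' y ≤ (ruelleLip ℝ w m A ^ l) g y - i + 2 * K * t := by
    rw [← integral_dualRuelle_dirac hN, ← integral_dualRuelle_dirac hN]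
    refine (integral_le_add_of_le_on (g := fun z => g z - i) (g'.integrable _)
      ((g.integrable _).sub (integrable_const _)) hBm
      (c := 2 * K) (by positivity) (fun z hz => ?_) (fun z => ?_) (hR' l y hy)).trans ?_
    · rw [hg'z]
      exact max_le le_rfl (by linarith [hig z hz])
    · rw [hg'z]
      exact max_le (by linarith) (by linarith [(hgK z).1])
    · rw [integral_sub (g.integrable _) (integrable_const _), integral_const, probReal_univ,
        one_smul]
  have h5 := mul_le_mul_of_nonneg_left h2 (sub_nonneg.2 hθ1)
  have h6 : θ * (ε / 3 + 2 * K * t) ≥ 0 := by positivity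
  calc (ruelleLip ℝ w m A ^ l) g x - (ruelleLip ℝ w m A ^ l) g y
      ≤ (1 - θ) * (ruelleLip ℝ w m A ^ l) g' x + ε / 3 + 2 * K * t := by linarith
    _ ≤ (1 - θ) * (b + 2 * K * t) + ε / 3 + 2 * K * t := by linarith
    _ ≤ (1 - θ) * D + ε := by rw [hb]; linarith

/-- With probability at least `1 / 2` the chain enters the fixed ball, where the oscillation is
contracted by `oscillation_contract_on_ball`; elsewhere it does not grow. The ball, and with it the
factor `q`, does not depend on the radius `R` of the set over which the oscillation is taken. -/
theorem OscillationBound.contract (hα : 0 < α)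
    (hd : Summable fun n : ℕ => w.d (n + 1) ^ (-(α : ℝ))) (hT : AdaptedTails p w m)
    (hN : IsNormalized w m A) (f : LipB (SeqSpace p) α ℝ) :
    ∃ q : ℝ, 0 ≤ q ∧ q < 1 ∧ ∀ D, 0 ≤ D → OscillationBound w m A f D →
      OscillationBound w m A f (q * D) := by
  obtain ⟨R₀, hR₀, hrec⟩ := exists_recurrent_ball hα hd hT hN
  have hS0 : 0 ≤ ∑' n : ℕ, w.d (n + 1) ^ (-(α : ℝ)) :=
    tsum_nonneg fun _ => Real.rpow_nonneg (w.d_pos _).le _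
  set θ := Real.exp (-(‖A‖ * (∑' n : ℕ, w.d (n + 1) ^ (-(α : ℝ))) * (2 * R₀) ^ (α : ℝ))) with hθ
  have hθ0 : 0 < θ := Real.exp_pos _
  have hθ1 : θ ≤ 1 := Real.exp_le_one_iff.2 (neg_nonpos.2 (by positivity))
  refine ⟨1 - θ / 2, by linarith, by linarith, fun D hD h R ε hε => ?_⟩
  set K := ‖f‖ with hK
  have hK0 : 0 ≤ K := norm_nonneg _
  set t := ε / (12 * (K + 1)) with ht
  have ht0 : 0 < t := by positivity
  have hKt : 4 * K * t ≤ ε / 3 := by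
    have : 12 * (K + 1) * t = ε := mul_div_cancel₀ _ (by positivity)
    linarith
  obtain ⟨l, hl⟩ := hrec R
  obtain ⟨R', hRR', hR'⟩ := exists_ball_of_adaptedTails hα hd hT hN ht0 (max R R₀)
  obtain ⟨N₁, hN₁⟩ := oscillation_contract_on_ball hα hd hT hN hD h hR₀ (ε := ε / 3) (by positivity)
  obtain ⟨N₂, hN₂⟩ := h R' (ε / 3) (by positivity)
  refine ⟨l + max N₁ N₂, fun k hk x y hx hy => ?_⟩
  obtain ⟨n, rfl⟩ := Nat.exists_eq_add_of_le ((Nat.le_add_right l _).trans hk)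
  have hn : max N₁ N₂ ≤ n := by omega
  rw [ruelleLip_pow_add]
  set g := (ruelleLip ℝ w m A ^ n) f with hg
  have hgK : ∀ z, -K ≤ g z ∧ g z ≤ K := fun z => abs_le.1 (abs_ruelleLip_pow_le hN f n z)
  set B : Set (SeqSpace p) := Metric.closedBall 0 R' with hB
  set B₀ : Set (SeqSpace p) := Metric.closedBall 0 R₀ with hB₀
  have hBm : MeasurableSet B := Metric.isClosed_closedBall.measurableSet
  have hB₀m : MeasurableSet B₀ := Metric.isClosed_closedBall.measurableSet
  have hmemB : ∀ z, z ∈ B ↔ ‖z‖ ≤ R' := fun z => mem_closedBall_zero_iff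
  have hmemB₀ : ∀ z, z ∈ B₀ ↔ ‖z‖ ≤ R₀ := fun z => mem_closedBall_zero_iff
  have hsub : B₀ ⊆ B := Metric.closedBall_subset_closedBall ((le_max_right _ _).trans hRR')
  have h0B₀ : (0 : SeqSpace p) ∈ B₀ := (hmemB₀ 0).2 (by rw [norm_zero]; exact hR₀)
  have h0B := hsub h0B₀
  set b := D + ε / 3 with hb
  set b₀ := (1 - θ) * D + ε / 3 with hb₀
  have hosc : ∀ u ∈ B, ∀ v ∈ B, g u - g v ≤ b := fun u hu v hv =>
    hN₂ n ((le_max_right _ _).trans hn) u v ((hmemB u).1 hu) ((hmemB v).1 hv)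
  have hosc₀ : ∀ u ∈ B₀, ∀ v ∈ B₀, g u - g v ≤ b₀ := fun u hu v hv =>
    hN₁ n ((le_max_left _ _).trans hn) u v ((hmemB₀ u).1 hu) ((hmemB₀ v).1 hv)
  have hbelow : ∀ S : Set (SeqSpace p), BddBelow (g '' S) := fun S =>
    ⟨-K, by rintro _ ⟨z, -, rfl⟩; exact (hgK z).1⟩
  have habove : ∀ S : Set (SeqSpace p), BddAbove (g '' S) := fun S =>
    ⟨K, by rintro _ ⟨z, -, rfl⟩; exact (hgK z).2⟩
  have hne₀ : (g '' B₀).Nonempty := ⟨_, 0, h0B₀, rfl⟩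
  have hne : (g '' B).Nonempty := ⟨_, 0, h0B, rfl⟩
  set i := sInf (g '' B) with hi
  set i₀ := sInf (g '' B₀) with hi₀
  set s₀ := sSup (g '' B₀) with hs₀
  have hig : ∀ z ∈ B, i ≤ g z := fun z hz => csInf_le (hbelow B) ⟨z, hz, rfl⟩
  have hig₀ : ∀ z ∈ B₀, i₀ ≤ g z := fun z hz => csInf_le (hbelow B₀) ⟨z, hz, rfl⟩
  have hgs₀ : ∀ z ∈ B₀, g z ≤ s₀ := fun z hz => le_csSup (habove B₀) ⟨z, hz, rfl⟩
  have hgi : ∀ z ∈ B, g z ≤ i + b := fun z hz => by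
    have : g z - b ≤ i := le_csInf hne (by rintro _ ⟨v, hv, rfl⟩; linarith [hosc z hz v hv])
    linarith
  have hii₀ : i ≤ i₀ := csInf_le_csInf (hbelow B) hne₀ (image_mono hsub)
  have hs₀b : s₀ ≤ i + b := csSup_le hne₀ (by rintro _ ⟨v, hv, rfl⟩; exact hgi v (hsub hv))
  have hsi₀ : s₀ ≤ i₀ + b₀ := csSup_le hne₀ (by
    rintro _ ⟨u, hu, rfl⟩
    have : g u - b₀ ≤ i₀ := le_csInf hne₀ (by rintro _ ⟨v, hv, rfl⟩; linarith [hosc₀ u hu v hv])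
    linarith)
  have hK1 := hgK 0
  have hK2 := hig 0 h0B
  have hK3 := hig₀ 0 h0B₀
  have hK4 := hgs₀ 0 h0B₀
  have hK5 : -K ≤ i := le_csInf hne (by rintro _ ⟨v, -, rfl⟩; exact (hgK v).1)
  have hpx := isProbabilityMeasure_dualRuelle_iterate hN (Measure.dirac x) l
  have hpy := isProbabilityMeasure_dualRuelle_iterate hN (Measure.dirac y) l
  have hind : ∀ (ν : Measure (SeqSpace p)) [IsProbabilityMeasure ν] (c e : ℝ),
      Integrable (fun z => c + B₀.indicator (fun _ => e) z) ν ∧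
      ∫ z, (c + B₀.indicator (fun _ => e) z) ∂ν = c + ν.real B₀ * e := by
    intro ν _ c e
    have h1 : Integrable (B₀.indicator fun _ => e) ν := (integrable_const e).indicator hB₀m
    refine ⟨(integrable_const c).add h1, ?_⟩
    rw [integral_add (integrable_const c) h1, integral_indicator_const _ hB₀m, integral_const,
      probReal_univ, one_smul, smul_eq_mul]
  have h1 : (ruelleLip ℝ w m A ^ l) g x ≤ (i + b + s₀) / 2 + 2 * K * t := by
    rw [← integral_dualRuelle_dirac hN]
    obtain ⟨h2, h3⟩ := hind ((dualRuelle w m A)^[l] (Measure.dirac x)) (i + b) (s₀ - (i + b))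
    refine (integral_le_add_of_le_on (g.integrable _) h2 hBm (c := 2 * K) (by positivity)
      (fun z hz => ?_) (fun z => ?_) (hR' l x (hx.trans (le_max_left _ _)))).trans ?_
    · by_cases hz₀ : z ∈ B₀
      · simpa [hz₀] using hgs₀ z hz₀
      · simpa [hz₀] using hgi z hz
    · by_cases hz₀ : z ∈ B₀
      · simp only [hz₀, indicator_of_mem]
        linarith [(hgK z).2]
      · simp only [hz₀, not_false_eq_true, indicator_of_notMem]
        linarith [(hgK z).2]
    · rw [h3]
      have := mul_le_mul_of_nonneg_right (hl x hx) (sub_nonneg.2 hs₀b)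
      linarith
  have h2 : (i + i₀) / 2 ≤ (ruelleLip ℝ w m A ^ l) g y + 2 * K * t := by
    rw [← integral_dualRuelle_dirac hN]
    obtain ⟨h2, h3⟩ := hind ((dualRuelle w m A)^[l] (Measure.dirac y)) i (i₀ - i)
    refine le_trans ?_ (integral_le_add_of_le_on h2 (g.integrable _) hBm (c := 2 * K)
      (by positivity) (fun z hz => ?_) (fun z => ?_) (hR' l y (hy.trans (le_max_left _ _))))
    · rw [h3]
      have := mul_le_mul_of_nonneg_right (hl y hy) (sub_nonneg.2 hii₀)
      linarith
    · by_cases hz₀ : z ∈ B₀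
      · simpa [hz₀] using hig₀ z hz₀
      · simpa [hz₀] using hig z hz
    · by_cases hz₀ : z ∈ B₀
      · simp only [hz₀, indicator_of_mem]
        linarith [(hgK z).1]
      · simp only [hz₀, not_false_eq_true, indicator_of_notMem]
        linarith [(hgK z).1]
  calc _ ≤ (i + b + s₀) / 2 - (i + i₀) / 2 + 4 * K * t := by linarith
    _ ≤ (b + b₀) / 2 + ε / 3 := by linarith
    _ ≤ (1 - θ / 2) * D + ε := by rw [hb, hb₀]; linarith

/-- The iterates of a normalized operator flatten every Hölder function pointwise. -/
theorem tendsto_ruelleLip_pow_sub (hα : 0 < α)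
    (hd : Summable fun n : ℕ => w.d (n + 1) ^ (-(α : ℝ))) (hT : AdaptedTails p w m)
    (hN : IsNormalized w m A) (f : LipB (SeqSpace p) α ℝ) (x y : SeqSpace p) :
    Tendsto (fun n => (ruelleLip ℝ w m A ^ n) f x - (ruelleLip ℝ w m A ^ n) f y) atTop (𝓝 0) := by
  obtain ⟨q, hq0, hq1, hq⟩ := OscillationBound.contract hα hd hT hN f
  have hall : ∀ k : ℕ, OscillationBound w m A f (q ^ k * (2 * ‖f‖)) := by
    intro k
    induction k with
    | zero =>
      refine fun R ε hε => ⟨0, fun n _ x y _ _ => ?_⟩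
      have h1 := abs_le.1 (abs_ruelleLip_pow_le hN f n x)
      have h2 := abs_le.1 (abs_ruelleLip_pow_le hN f n y)
      linarith
    | succ k ih =>
      rw [pow_succ', mul_assoc]
      exact hq _ (by positivity) ih
  rw [Metric.tendsto_atTop]
  intro ε hε
  have hlim := (tendsto_pow_atTop_nhds_zero_of_lt_one hq0 hq1).mul_const (2 * ‖f‖)
  rw [zero_mul] at hlim
  obtain ⟨k, hk⟩ := (hlim.eventually (gt_mem_nhds (show 0 < ε / 2 by positivity))).exists
  obtain ⟨N, hN'⟩ := hall k (max ‖x‖ ‖y‖) (ε / 3) (by positivity)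
  refine ⟨N, fun n hn => ?_⟩
  rw [dist_zero_right, Real.norm_eq_abs, abs_lt]
  have h1 := hN' n hn x y (le_max_left _ _) (le_max_right _ _)
  have h2 := hN' n hn y x (le_max_right _ _) (le_max_left _ _)
  constructor <;> linarith

end Oscillation

/-! ### The attracting Gibbs measure of a normalized potential -/

section Attraction

theorem IsMixing.ergodic {Ω : Type*} [MeasurableSpace Ω] {T : Ω → Ω} {μ : Measure Ω}
    [IsProbabilityMeasure μ]
    (h : IsMixing T μ) : Ergodic T μ := by
  refine { h.1 with aeconst_set := fun s hs hTs => ?_ }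
  have h1 := h.2 s s hs hs
  have h2 : ∀ n : ℕ, T^[n] ⁻¹' s = s := by
    intro n
    induction n with
    | zero => rfl
    | succ n ih => rw [Function.iterate_succ, preimage_comp, ih, hTs]
  simp only [h2, inter_self] at h1
  have h3 : μ s = μ s * μ s := tendsto_nhds_unique tendsto_const_nhds h1
  rw [eventuallyConst_set']
  rcases eq_or_ne (μ s) 0 with h0 | h0
  · exact Or.inl (ae_eq_empty.2 h0)
  · right
    have h4 : μ s = 1 := by
      have h5 : μ s * 1 = μ s * μ s := by rw [mul_one]; exact h3
      exact ((ENNReal.mul_right_inj h0 (measure_ne_top μ s)).1 h5).symm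
    rw [ae_eq_univ, prob_compl_eq_zero_iff hs]
    exact h4

variable {X : Type*} [MetricSpace X]

/-- A bounded Lipschitz function is `α`-Hölder for every `α ≤ 1`: at distances at most `1` use the
Lipschitz bound, at larger distances the bound on the oscillation. -/
theorem LipB.exists_eq_of_lipschitz {α : ℝ≥0} (hα : 0 < α) (hα1 : α ≤ 1) {f : X → ℝ} {C : ℝ}
    (hC : ∀ x y, dist (f x) (f y) ≤ C) {K : ℝ≥0} (hK : LipschitzWith K f) :
    ∃ g : LipB X α ℝ, ∀ x, g x = f x := by
  rcases isEmpty_or_nonempty X with hX | ⟨⟨x₀⟩⟩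
  · exact ⟨0, fun x => (hX.false x).elim⟩
  have hC0 : 0 ≤ C := dist_nonneg.trans (hC x₀ x₀)
  refine ⟨LipB.of hα f (|f x₀| + C) (max C K) (fun x => ?_) (fun x y => ?_), fun x => rfl⟩
  · have h1 := hC x x₀
    rw [Real.dist_eq] at h1
    have h2 := abs_sub_abs_le_abs_sub (f x) (f x₀)
    rw [Real.norm_eq_abs]
    linarith
  · rw [← dist_eq_norm]
    rcases le_total (dist x y) 1 with h | h
    · calc dist (f x) (f y) ≤ K * dist x y := hK.dist_le_mul x y
        _ ≤ max C K * dist x y ^ (α : ℝ) := by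
          refine mul_le_mul (le_max_right _ _) ?_ dist_nonneg (hC0.trans (le_max_left _ _))
          exact Real.self_le_rpow_of_le_one dist_nonneg h (by exact_mod_cast hα1)
    · calc dist (f x) (f y) ≤ C * 1 := by rw [mul_one]; exact hC x y
        _ ≤ max C K * dist x y ^ (α : ℝ) := by
          refine mul_le_mul (le_max_left _ _) ?_ zero_le_one (hC0.trans (le_max_left _ _))
          exact Real.one_le_rpow h α.2

variable [MeasurableSpace X] [BorelSpace X] {α : ℝ≥0}

/-- Bounded Hölder functions are enough to test weak convergence of probability measures. -/
theorem tendsto_probabilityMeasure_of_lipB (hα : 0 < α) (hα1 : α ≤ 1)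
    {μs : ℕ → ProbabilityMeasure X} {μ : ProbabilityMeasure X}
    (h : ∀ f : LipB X α ℝ,
      Tendsto (fun n => ∫ x, f x ∂(μs n : Measure X)) atTop (𝓝 (∫ x, f x ∂(μ : Measure X)))) :
    Tendsto μs atTop (𝓝 μ) := by
  refine tendsto_iff_forall_lipschitz_integral_tendsto.2 ?_
  rintro f ⟨C, hC⟩ ⟨K, hK⟩
  obtain ⟨g, hg⟩ := LipB.exists_eq_of_lipschitz hα hα1 hC hK
  simpa only [hg] using h g

theorem measure_eq_of_lipB (hα : 0 < α) (hα1 : α ≤ 1) {μ ν : Measure X}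
    [hμ : IsProbabilityMeasure μ] [hν : IsProbabilityMeasure ν]
    (h : ∀ f : LipB X α ℝ, ∫ x, f x ∂μ = ∫ x, f x ∂ν) : μ = ν := by
  let μ' : ProbabilityMeasure X := ⟨μ, hμ⟩
  let ν' : ProbabilityMeasure X := ⟨ν, hν⟩
  have h1 : Tendsto (fun _ : ℕ => μ') atTop (𝓝 ν') := by
    refine tendsto_probabilityMeasure_of_lipB hα hα1 fun f => ?_
    change Tendsto (fun _ => ∫ x, f x ∂μ) atTop (𝓝 (∫ x, f x ∂ν))
    rw [h f]
    exact tendsto_const_nhds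
  have h2 := tendsto_nhds_unique tendsto_const_nhds h1
  exact congrArg (fun ρ : ProbabilityMeasure X => (ρ : Measure X)) h2

/-- Mixing of a measure preserving map follows from the convergence of the integrals of bounded
continuous functions over the preimages of a set, since bounded continuous functions are dense in
`L¹`. -/
theorem isMixing_of_tendsto_setIntegral {T : X → X} {μ : Measure X} [IsProbabilityMeasure μ]
    (hT : MeasurePreserving T μ μ)
    (h : ∀ (U : Set X), MeasurableSet U → ∀ g : X →ᵇ ℝ,
      Tendsto (fun n => ∫ x in T^[n] ⁻¹' U, g x ∂μ) atTop (𝓝 (μ.real U * ∫ x, g x ∂μ))) :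
    IsMixing T μ := by
  refine ⟨hT, fun S U hS hU => ?_⟩
  have hreal : Tendsto (fun n => μ.real (S ∩ T^[n] ⁻¹' U)) atTop (𝓝 (μ.real S * μ.real U)) := by
    refine Metric.tendsto_atTop.2 fun ε hε => ?_
    set f : X → ℝ := S.indicator 1 with hf
    have hfi : Integrable f μ := (integrable_const (1 : ℝ)).indicator hS
    obtain ⟨g, hg, hgi⟩ := hfi.exists_boundedContinuous_integral_sub_le (ε := ε / 4) (by positivity)
    have hfg := (hfi.sub hgi).norm
    obtain ⟨N, hN⟩ := Metric.tendsto_atTop.1 (h U hU g) (ε / 4) (by positivity)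
    refine ⟨N, fun n hn => ?_⟩
    have e1 : μ.real (S ∩ T^[n] ⁻¹' U) = ∫ x in T^[n] ⁻¹' U, f x ∂μ := by
      rw [hf, integral_indicator_one hS, measureReal_restrict_apply hS]
    have e2 : μ.real S = ∫ x, f x ∂μ := by rw [hf, integral_indicator_one hS]
    have b1 : |(∫ x in T^[n] ⁻¹' U, f x ∂μ) - ∫ x in T^[n] ⁻¹' U, g x ∂μ| ≤ ε / 4 := by
      rw [← integral_sub hfi.integrableOn hgi.integrableOn]
      calc _ ≤ ∫ x in T^[n] ⁻¹' U, ‖f x - g x‖ ∂μ := norm_integral_le_integral_norm _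
        _ ≤ ∫ x, ‖f x - g x‖ ∂μ :=
          setIntegral_le_integral hfg (Eventually.of_forall fun x => norm_nonneg _)
        _ ≤ ε / 4 := hg
    have b2 : |(∫ x, f x ∂μ) - ∫ x, g x ∂μ| ≤ ε / 4 := by
      rw [← integral_sub hfi hgi]
      exact (norm_integral_le_integral_norm _).trans hg
    have b3 := hN n hn
    have b4 : |(∫ x, g x ∂μ) * μ.real U - (∫ x, f x ∂μ) * μ.real U| ≤ ε / 4 := by
      rw [← sub_mul, abs_mul, abs_of_nonneg (measureReal_nonneg (μ := μ) (s := U)), abs_sub_comm]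
      exact (mul_le_of_le_one_right (abs_nonneg _) measureReal_le_one).trans b2
    rw [Real.dist_eq] at b3 ⊢
    rw [e1, e2]
    have h1 := abs_le.1 b1
    have h3 := abs_lt.1 b3
    have h4 := abs_le.1 b4
    rw [abs_lt]
    constructor <;> linarith [mul_comm (μ.real U) (∫ x, g x ∂μ)]
  have h1 := ENNReal.tendsto_ofReal hreal
  rw [ENNReal.ofReal_mul measureReal_nonneg] at h1
  simpa only [ofReal_measureReal (measure_ne_top μ _)] using h1

end Attraction

section GibbsMeasure

variable {p : ℝ≥0∞} [Fact (1 ≤ p)] {α : ℝ≥0} {w : ShiftWeight} {m : Measure ℝ}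
  [IsProbabilityMeasure m] {A : LipB (SeqSpace p) α ℝ}

theorem tendsto_integral_ruelleLip_pow_sub (hα : 0 < α)
    (hd : Summable fun n : ℕ => w.d (n + 1) ^ (-(α : ℝ))) (hT : AdaptedTails p w m)
    (hN : IsNormalized w m A) (f : LipB (SeqSpace p) α ℝ) (ν : Measure (SeqSpace p))
    [IsProbabilityMeasure ν] :
    Tendsto (fun n => (∫ x, (ruelleLip ℝ w m A ^ n) f x ∂ν) - (ruelleLip ℝ w m A ^ n) f 0) atTop
      (𝓝 0) := by
  have h1 : Tendsto (fun n : ℕ =>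
      ∫ x, ((ruelleLip ℝ w m A ^ n) f x - (ruelleLip ℝ w m A ^ n) f 0) ∂ν) atTop
      (𝓝 (∫ _x, (0 : ℝ) ∂ν)) := by
    refine tendsto_integral_of_dominated_convergence (fun _ => ‖f‖ + ‖f‖) (fun n => ?_)
      (integrable_const _) (fun n => Eventually.of_forall fun x => ?_)
      (Eventually.of_forall fun x => tendsto_ruelleLip_pow_sub hα hd hT hN f x 0)
    · exact ((LipB.integrable _ ν).sub (integrable_const _)).aestronglyMeasurable
    · exact (norm_sub_le _ _).trans
        (add_le_add (abs_ruelleLip_pow_le hN f n x) (abs_ruelleLip_pow_le hN f n 0))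
  rw [integral_zero] at h1
  refine h1.congr fun n => ?_
  rw [integral_sub (LipB.integrable _ ν) (integrable_const _)]
  simp

/-- A fixed probability measure of the dual operator exists: the adapted tails make the images of
the Dirac measure at `0` tight, and by the decay of oscillations every limit point is fixed. -/
theorem exists_isGibbs (hα : 0 < α) (hα1 : α ≤ 1)
    (hd : Summable fun n : ℕ => w.d (n + 1) ^ (-(α : ℝ))) (hT : AdaptedTails p w m)
    (hN : IsNormalized w m A) : ∃ μ : Measure (SeqSpace p), IsGibbs w m A μ := by
  set ν : ℕ → ProbabilityMeasure (SeqSpace p) := fun n =>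
    ⟨(dualRuelle w m A)^[n] (Measure.dirac 0), isProbabilityMeasure_dualRuelle_iterate hN _ n⟩
    with hν
  have htight : IsTightMeasureSet {((μ : ProbabilityMeasure (SeqSpace p)) : Measure (SeqSpace p)) |
      μ ∈ range ν} := by
    refine isTightMeasureSet_iff_exists_isCompact_measure_compl_le.2 fun ε hε => ?_
    obtain ⟨κ, hκ⟩ := exists_box_of_adaptedTails hT hN hε
    refine ⟨SeqSpace.orderBox κ, SeqSpace.isCompact_orderBox κ, ?_⟩
    rintro _ ⟨_, ⟨n, rfl⟩, rfl⟩
    refine (measure_mono (compl_subset_compl.2 ?_)).trans (hκ n 0)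
    rintro z ⟨y, hy, hzy⟩
    rw [norm_zero, mul_zero] at hzy
    rwa [sub_eq_zero.1 (norm_le_zero_iff.1 hzy)]
  have hcomp := isCompact_closure_of_isTightMeasureSet htight
  obtain ⟨μ, -, hμ⟩ := hcomp.ultrafilter_le_nhds ((hyperfilter ℕ).map ν) (by
    rw [le_principal_iff]
    exact Filter.mem_map.2 (Eventually.of_forall fun n => subset_closure (mem_range_self n)))
  have hconv : ∀ f : LipB (SeqSpace p) α ℝ, Tendsto (fun n => (ruelleLip ℝ w m A ^ n) f 0)
      (hyperfilter ℕ : Filter ℕ) (𝓝 (∫ x, f x ∂(μ : Measure (SeqSpace p)))) := by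
    intro f
    have h1 := ProbabilityMeasure.tendsto_iff_forall_integral_tendsto.1
      (show Tendsto ν (hyperfilter ℕ : Filter ℕ) (𝓝 μ) from hμ) f.toBCF
    refine h1.congr fun n => ?_
    exact integral_dualRuelle_dirac hN f n 0
  have hle : (hyperfilter ℕ : Filter ℕ) ≤ atTop := by
    rw [← Nat.cofinite_eq_atTop]
    exact hyperfilter_le_cofinite
  have := isProbabilityMeasure_dualRuelle hN (μ : Measure (SeqSpace p))
  refine ⟨μ, inferInstance, measure_eq_of_lipB hα hα1 fun f => ?_⟩
  have e1 : ∫ x, f x ∂(dualRuelle w m A μ) =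
      ∫ x, ruelleLip ℝ w m A f x ∂(μ : Measure (SeqSpace p)) := by
    simpa using integral_dualRuelle_iterate hN f (μ : Measure (SeqSpace p)) 1
  rw [e1]
  refine tendsto_nhds_unique (hconv (ruelleLip ℝ w m A f)) ?_
  have := isProbabilityMeasure_dualRuelle hN (Measure.dirac (0 : SeqSpace p))
  have h2 := ((tendsto_integral_ruelleLip_pow_sub hα hd hT hN f
    (dualRuelle w m A (Measure.dirac 0))).mono_left hle).add (hconv f)
  rw [zero_add] at h2
  refine h2.congr fun n => ?_
  rw [sub_add_cancel, ← integral_dualRuelle_iterate hN, ← Function.iterate_succ_apply,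
    integral_dualRuelle_dirac hN f, pow_succ]
  rfl

theorem dualRuelle_smul (c : ℝ≥0∞) (ν : Measure (SeqSpace p)) [SFinite ν] :
    dualRuelle w m A (c • ν) = c • dualRuelle w m A ν := by
  unfold dualRuelle
  rw [Measure.prod_smul_left, Measure.map_smul, withDensity_smul_measure]

theorem IsGibbs.tendsto_integral (hα : 0 < α) (hα1 : α ≤ 1)
    (hd : Summable fun n : ℕ => w.d (n + 1) ^ (-(α : ℝ))) (hT : AdaptedTails p w m)
    (hN : IsNormalized w m A) {μ : Measure (SeqSpace p)} (hμ : IsGibbs w m A μ)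
    (ν : Measure (SeqSpace p)) [IsProbabilityMeasure ν] (f : SeqSpace p →ᵇ ℝ) :
    Tendsto (fun n => ∫ x, f x ∂((dualRuelle w m A)^[n] ν)) atTop (𝓝 (∫ x, f x ∂μ)) := by
  have hμ1 := hμ.1
  let νs : ℕ → ProbabilityMeasure (SeqSpace p) := fun n =>
    ⟨(dualRuelle w m A)^[n] ν, isProbabilityMeasure_dualRuelle_iterate hN ν n⟩
  let μ' : ProbabilityMeasure (SeqSpace p) := ⟨μ, hμ.1⟩
  have h : Tendsto νs atTop (𝓝 μ') := by
    refine tendsto_probabilityMeasure_of_lipB hα hα1 fun f => ?_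
    have h1 := ((tendsto_integral_ruelleLip_pow_sub hα hd hT hN f ν).sub
      (tendsto_integral_ruelleLip_pow_sub hα hd hT hN f μ)).add_const (∫ x, f x ∂μ)
    rw [sub_zero, zero_add] at h1
    refine h1.congr fun n => ?_
    rw [← integral_dualRuelle_iterate hN f μ, ← integral_dualRuelle_iterate hN f ν,
      Function.iterate_fixed hμ.2]
    change _ = ∫ x, f x ∂((dualRuelle w m A)^[n] ν)
    ring
  exact ProbabilityMeasure.tendsto_iff_forall_integral_tendsto.1 h f

theorem IsGibbs.measurePreserving (hN : IsNormalized w m A) {μ : Measure (SeqSpace p)}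
    (hμ : IsGibbs w m A μ) :
    MeasurePreserving (weightedShift w : SeqSpace p → SeqSpace p) μ μ := by
  have := hμ.1
  refine ⟨measurable_weightedShift w, Measure.ext fun U hU => ?_⟩
  rw [Measure.map_apply (measurable_weightedShift w) hU]
  have h := dualRuelle_preimage hN μ hU
  rwa [hμ.2] at h

/-- Mixing: the conditional measure of `μ` given `L^{-n} U` is the image of the conditional measure
given `U` under the `n`-th iterate of the dual operator, hence converges to `μ`. -/
theorem IsGibbs.isMixing (hα : 0 < α) (hα1 : α ≤ 1)
    (hd : Summable fun n : ℕ => w.d (n + 1) ^ (-(α : ℝ))) (hT : AdaptedTails p w m)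
    (hN : IsNormalized w m A) {μ : Measure (SeqSpace p)} (hμ : IsGibbs w m A μ) :
    IsMixing (weightedShift w : SeqSpace p → SeqSpace p) μ := by
  have := hμ.1
  have hLμ := hμ.measurePreserving hN
  refine isMixing_of_tendsto_setIntegral hLμ fun U hU g => ?_
  rcases eq_or_ne (μ U) 0 with h0 | h0
  · have h1 : ∀ n : ℕ, μ ((weightedShift w)^[n] ⁻¹' U) = 0 := fun n => by
      rw [(hLμ.iterate n).measure_preimage hU.nullMeasurableSet, h0]
    simp [Measure.restrict_eq_zero.2 (h1 _), measureReal_def, h0]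
  have hc : (μ U)⁻¹ ≠ ∞ := ENNReal.inv_ne_top.2 h0
  have hprob : IsProbabilityMeasure ((μ U)⁻¹ • μ.restrict U) := ⟨by
    rw [Measure.smul_apply, Measure.restrict_apply_univ, smul_eq_mul,
      ENNReal.inv_mul_cancel h0 (measure_ne_top μ U)]⟩
  have hiter : ∀ n : ℕ, (dualRuelle w m A)^[n] ((μ U)⁻¹ • μ.restrict U) =
      (μ U)⁻¹ • μ.restrict ((weightedShift w)^[n] ⁻¹' U) := by
    intro n
    induction n with
    | zero => rfl
    | succ n ih =>
      rw [Function.iterate_succ_apply', ih, dualRuelle_smul,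
        dualRuelle_restrict _ ((measurable_weightedShift w).iterate n hU), hμ.2,
        Function.iterate_succ, preimage_comp]
  have h1 := (hμ.tendsto_integral hα hα1 hd hT hN ((μ U)⁻¹ • μ.restrict U) g).const_mul (μ.real U)
  refine h1.congr fun n => ?_
  have hU0 : μ.real U ≠ 0 := (measureReal_ne_zero_iff (measure_ne_top μ U)).2 h0
  rw [hiter, integral_smul_measure, ENNReal.toReal_inv, smul_eq_mul, ← measureReal_def,
    mul_inv_cancel_left₀ hU0]

theorem hasAttractingMixingGibbs (hα : 0 < α) (hα1 : α ≤ 1)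
    (hd : Summable fun n : ℕ => w.d (n + 1) ^ (-(α : ℝ))) (hT : AdaptedTails p w m)
    (hN : IsNormalized w m A) : HasAttractingMixingGibbs w m A := by
  obtain ⟨μ, hμ⟩ := exists_isGibbs hα hα1 hd hT hN
  have := hμ.1
  have hmix := hμ.isMixing hα hα1 hd hT hN
  refine ⟨μ, hμ, fun ν hν => ?_, fun ν hν f => hμ.tendsto_integral hα hα1 hd hT hN ν f,
    hmix.1, hmix, hmix.1.conservative, hmix.ergodic⟩
  have := hν.1
  refine measure_eq_of_lipB hα hα1 fun f => ?_
  have h1 := hμ.tendsto_integral hα hα1 hd hT hN ν f.toBCF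
  simp only [Function.iterate_fixed hν.2] at h1
  exact tendsto_nhds_unique tendsto_const_nhds h1

end GibbsMeasure

/-! ### Normalization of a potential -/

section HolderOperations

variable {X : Type*} [MetricSpace X] {α : ℝ≥0}

theorem Real.abs_log_sub_log_le {a b δ : ℝ} (hδ : 0 < δ) (ha : δ ≤ a) (hb : δ ≤ b) :
    |Real.log a - Real.log b| ≤ δ⁻¹ * |a - b| := by
  wlog hab : b ≤ a generalizing a b
  · rw [abs_sub_comm, abs_sub_comm a]
    exact this hb ha (le_of_not_ge hab)
  have ha0 := hδ.trans_le ha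
  have hb0 := hδ.trans_le hb
  rw [abs_of_nonneg (sub_nonneg.2 (Real.log_le_log hb0 hab)), abs_of_nonneg (sub_nonneg.2 hab),
    ← Real.log_div ha0.ne' hb0.ne']
  calc Real.log (a / b) ≤ a / b - 1 := Real.log_le_sub_one_of_pos (div_pos ha0 hb0)
    _ = b⁻¹ * (a - b) := by field_simp
    _ ≤ δ⁻¹ * (a - b) :=
      mul_le_mul_of_nonneg_right (inv_anti₀ hδ hb) (sub_nonneg.2 hab)

theorem LipB.exists_eq_log (hα : 0 < α) {ψ : LipB X α ℝ} {δ : ℝ} (hδ : 0 < δ)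
    (hψ : ∀ x, δ ≤ ψ x) : ∃ g : LipB X α ℝ, ∀ x, g x = Real.log (ψ x) := by
  refine ⟨LipB.of hα (fun x => Real.log (ψ x)) (|Real.log δ| + δ⁻¹ * (‖ψ‖ + δ)) (δ⁻¹ * ‖ψ‖)
    (fun x => ?_) (fun x y => ?_), fun x => rfl⟩
  · have h1 := Real.abs_log_sub_log_le hδ (hψ x) le_rfl
    have h2 : |ψ x - δ| ≤ ‖ψ‖ + δ :=
      (abs_sub _ _).trans (add_le_add (ψ.norm_apply_le x) (abs_of_pos hδ).le)
    have h3 := abs_sub_abs_le_abs_sub (Real.log (ψ x)) (Real.log δ)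
    have h4 := mul_le_mul_of_nonneg_left h2 (inv_pos.2 hδ).le
    rw [Real.norm_eq_abs]
    linarith
  · refine (Real.abs_log_sub_log_le hδ (hψ x) (hψ y)).trans ?_
    rw [mul_assoc]
    exact mul_le_mul_of_nonneg_left (ψ.norm_sub_le x y) (inv_pos.2 hδ).le

theorem LipB.exists_eq_comp (hα : 0 < α) (f : LipB X α ℝ) {T : X → X} {K : ℝ≥0}
    (hT : LipschitzWith K T) : ∃ g : LipB X α ℝ, ∀ x, g x = f (T x) := by
  refine ⟨LipB.of hα (fun x => f (T x)) ‖f‖ (‖f‖ * (K : ℝ) ^ (α : ℝ))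
    (fun x => f.norm_apply_le _) (fun x y => (f.norm_sub_le _ _).trans ?_), fun x => rfl⟩
  rw [mul_assoc, ← Real.mul_rpow (NNReal.coe_nonneg K) dist_nonneg]
  exact mul_le_mul_of_nonneg_left
    (Real.rpow_le_rpow dist_nonneg (hT.dist_le_mul x y) α.2) (norm_nonneg _)

end HolderOperations

section Normalization

variable {p : ℝ≥0∞} [Fact (1 ≤ p)] {α : ℝ≥0} {w : ShiftWeight} {m : Measure ℝ}

theorem exists_lipB_eq_normalization (hα : 0 < α) (w : ShiftWeight)
    (A : LipB (SeqSpace p) α ℝ) {ψ : LipB (SeqSpace p) α ℝ} {δ : ℝ} (hδ : 0 < δ)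
    (hψ : ∀ x, δ ≤ ψ x) (lam : ℝ) :
    ∃ B : LipB (SeqSpace p) α ℝ, (B : SeqSpace p → ℝ) = normalization w A ψ lam := by
  obtain ⟨g, hg⟩ := LipB.exists_eq_log hα hδ hψ
  obtain ⟨k, hk⟩ := LipB.exists_eq_comp hα g
    (weightedShift w : SeqSpace p →L[ℝ] SeqSpace p).lipschitz
  refine ⟨A + g - k - LipB.const _ α ℝ (Real.log lam), funext fun x => ?_⟩
  rw [LipB.sub_apply, LipB.sub_apply, LipB.add_apply, hk, hg, hg, LipB.const_apply]
  rfl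

theorem isNormalized_normalization {A ψ : SeqSpace p → ℝ} {lam : ℝ} (hlam : 0 < lam)
    (hψ : ∀ x, 0 < ψ x) (h : ∀ x, ruelle w m A ψ x = lam * ψ x) :
    IsNormalized w m (normalization w A ψ lam) := by
  intro x
  have h1 : ∀ r, Real.exp (normalization w A ψ lam (branch w r x)) • (1 : ℝ) =
      (lam * ψ x)⁻¹ * (Real.exp (A (branch w r x)) • ψ (branch w r x)) := fun r => by
    rw [normalization, weightedShift_branch, Real.exp_sub, Real.exp_sub, Real.exp_add,
      Real.exp_log (hψ _), Real.exp_log (hψ _), Real.exp_log hlam, smul_eq_mul, smul_eq_mul]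
    field_simp
  unfold ruelle
  simp only [h1]
  rw [integral_const_mul]
  have h2 := h x
  unfold ruelle at h2
  rw [h2]
  exact inv_mul_cancel₀ (mul_pos hlam (hψ x)).ne'

end Normalization

/-! ### Support of the fixed measures -/

section Support

variable {p : ℝ≥0∞} [Fact (1 ≤ p)] {w : ShiftWeight} {m : Measure ℝ} {A : SeqSpace p → ℝ}
  {μ : Measure (SeqSpace p)}

/-- The support of a fixed measure is invariant under all inverse branches of `L`, because the dual
operator has a positive density with respect to the image of `μ × m`. -/
theorem branch_mem_support [SFinite m] [SFinite μ] (hA : Measurable A) (hm : m.support = univ)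
    (hμ : dualRuelle w m A μ = μ) {y : SeqSpace p} (hy : y ∈ μ.support) (r : ℝ) :
    branch w r y ∈ μ.support := by
  rw [Measure.mem_support_iff_forall]
  intro U hU
  obtain ⟨O, hOU, hO, hyO⟩ := mem_nhds_iff.1 hU
  refine lt_of_lt_of_le (pos_iff_ne_zero.2 fun h0 => ?_) (measure_mono hOU)
  have hcont : Continuous fun z : SeqSpace p × ℝ => branch w z.2 z.1 := by
    have : (fun z : SeqSpace p × ℝ => branch w z.2 z.1) =
        fun z => z.2 • branch w 1 0 + branch w 0 z.1 := funext fun z => branch_eq w z.2 z.1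
    rw [this]
    exact (continuous_snd.smul continuous_const).add
      ((continuous_branch_right w 0).comp continuous_fst)
  have hac : (μ.prod m).map (fun z => branch w z.2 z.1) ≪ dualRuelle w m A μ :=
    withDensity_absolutelyContinuous' hA.exp.ennreal_ofReal.aemeasurable
      (Eventually.of_forall fun v => (ENNReal.ofReal_pos.2 (Real.exp_pos _)).ne')
  rw [hμ] at hac
  have h1 := hac h0
  rw [Measure.map_apply (measurable_branch w) hO.measurableSet] at h1
  have h2 : (fun z : SeqSpace p × ℝ => branch w z.2 z.1) ⁻¹' O ∈ 𝓝 (y, r) :=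
    hcont.continuousAt.preimage_mem_nhds (hO.mem_nhds hyO)
  obtain ⟨V, hV, I, hI, hVI⟩ := mem_nhds_prod_iff.1 h2
  have h3 := measure_mono_null hVI h1
  rw [Measure.prod_prod] at h3
  have hr : r ∈ m.support := hm ▸ mem_univ r
  exact mul_ne_zero ((Measure.mem_support_iff_forall _).1 hy V hV).ne'
    ((Measure.mem_support_iff_forall _).1 hr I hI).ne' h3

theorem exists_preimage_of_branch_mem {S : Set (SeqSpace p)}
    (hS : ∀ y ∈ S, ∀ r, branch w r y ∈ S) {y : SeqSpace p} (hy : y ∈ S) (n : ℕ)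
    (x : SeqSpace p) :
    ∃ z ∈ S, (∀ i < n, z.coord i = x.coord i) ∧ (weightedShift w)^[n] z = y := by
  induction n generalizing x with
  | zero => exact ⟨y, hy, by simp, rfl⟩
  | succ n ih =>
    obtain ⟨z, hz, hzx, hzy⟩ := ih (weightedShift w x)
    refine ⟨branch w (x.coord 0) z, hS z hz _, fun i hi => ?_, ?_⟩
    · cases i with
      | zero => rfl
      | succ i =>
        rw [branch_coord_succ, hzx i (by omega), weightedShift_coord,
          mul_div_cancel_left₀ _ (w.val_pos i).ne']
    · rw [Function.iterate_succ_apply, weightedShift_branch, hzy]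

/-- A nonempty set that is invariant under all inverse branches is dense, because the shift expands:
a point with prescribed first `n` coordinates and prescribed image `y` under `L^n` has a tail of
norm at most `d_n⁻¹ ‖y‖`. -/
theorem dense_of_branch_mem (hd : Tendsto (fun n => (w.d n)⁻¹) atTop (𝓝 0))
    {S : Set (SeqSpace p)} (hS : ∀ y ∈ S, ∀ r, branch w r y ∈ S) (hne : S.Nonempty) : Dense S := by
  obtain ⟨y, hy⟩ := hne
  intro x
  choose z hz hzx hzy using fun n => exists_preimage_of_branch_mem hS hy n x
  refine mem_closure_of_tendsto (f := z) (b := atTop) (tendsto_iff_norm_sub_tendsto_zero.2 ?_)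
    (Eventually.of_forall hz)
  have h1 := (hd.mul_const ‖y‖).add (SeqSpace.tendsto_norm_tail x)
  rw [zero_mul, zero_add] at h1
  refine squeeze_zero (fun n => norm_nonneg _) (fun n => ?_) h1
  have h2 : z n - x = SeqSpace.tail n (z n) - SeqSpace.tail n x := by
    refine SeqSpace.ext_coord fun i => ?_
    rw [SeqSpace.coord_sub, SeqSpace.coord_sub, SeqSpace.tail_coord, SeqSpace.tail_coord]
    split_ifs with hi
    · rw [hzx n i hi, sub_self, sub_self]
    · rfl
  rw [h2]
  refine (norm_sub_le _ _).trans (add_le_add ?_ le_rfl)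
  have h3 := norm_tail_le w n (z n)
  rwa [hzy] at h3

theorem gibbsFullSupport [SFinite m] (hA : Measurable A) (hm : m.support = univ)
    (hd : Tendsto (fun n => (w.d n)⁻¹) atTop (𝓝 0)) : GibbsFullSupport w m A := by
  intro μ hμ
  have := hμ.1
  have h : μ.support = univ := by
    have h1 := dense_of_branch_mem hd
      (fun y hy r => branch_mem_support hA hm hμ.2 hy r)
      (Measure.nonempty_support (IsProbabilityMeasure.ne_zero μ))
    rw [← Measure.isClosed_support.closure_eq]
    exact h1.closure_eq
  exact ⟨h ▸ subset_univ _, h⟩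

end Support

theorem theorem1 (p : ℝ≥0∞) [Fact (1 ≤ p)] (w : ShiftWeight) (α : ℝ≥0) (hα0 : 0 < α)
    (hα1 : α ≤ 1) (hd : Summable fun n : ℕ => w.d (n + 1) ^ (-(α : ℝ)))
    (m : Measure ℝ) [IsProbabilityMeasure m] (hm : m.support = Set.univ)
    (A : LipB (SeqSpace p) α ℝ) :
    -- the eigenfunction, and the normalization of `A` that it defines
    (SummableVariation A → ∃ (lam : ℝ) (ψ : LipB (SeqSpace p) α ℝ),
      0 < lam ∧ (∃ δ : ℝ, 0 < δ ∧ ∀ x, δ ≤ ψ x) ∧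
      (∀ x, ruelle w m A ψ x = lam * ψ x) ∧
      Tendsto (fun n : ℕ => ‖ruelleLip ℝ w m A ^ n‖ ^ (1 / (n : ℝ))) atTop (𝓝 lam) ∧
      spectralRadius ℂ (ruelleLip ℂ w m A) = ENNReal.ofReal lam ∧
      (∀ (φ : LipB (SeqSpace p) α ℝ) (ρ : ℝ), (∀ x, 0 < φ x) →
        (∀ x, ruelle w m A φ x = ρ * φ x) → ∃ t : ℝ, ∀ x, φ x = t * ψ x) ∧
      -- Gibbs measure of the normalization
      (AdaptedTails p w m → IsNormalized w m (normalization w A ψ lam) ∧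
        HasAttractingMixingGibbs w m (normalization w A ψ lam)) ∧
      -- full support
      GibbsFullSupport w m (normalization w A ψ lam) ∧
      (IsNormalized w m A → GibbsFullSupport w m A)) ∧
    -- Gibbs measure of a normalized potential
    (AdaptedTails p w m → IsNormalized w m A → HasAttractingMixingGibbs w m A) := by
  refine ⟨fun hA => ?_, fun hT hN => hasAttractingMixingGibbs hα0 hα1 hd hT hN⟩
  obtain ⟨V, hV0, hV⟩ := exists_distortionBound_of_summableVariation hA w
  obtain ⟨lam, ψ, hlam, ⟨δ, hδ, hψ⟩, h⟩ := exists_eigenfunction (m := m) hα0 hd hV0 hV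
  have heig : ∀ x, ruelle w m A ψ x = lam * ψ x := fun x => congrArg (fun f => f x) h
  obtain ⟨B, hB⟩ := exists_lipB_eq_normalization hα0 w A hδ hψ lam
  have hBN : IsNormalized w m (normalization w A ψ lam) :=
    isNormalized_normalization hlam (fun x => hδ.trans_le (hψ x)) heig
  have hd' := w.tendsto_d_inv hα0 hd
  refine ⟨lam, ψ, hlam, ⟨δ, hδ, hψ⟩, heig,
    tendsto_norm_ruelleLip_pow ℝ hα0 hd hV0 hV hδ hψ hlam h,
    spectralRadius_ruelleLip hα0 hd hV0 hV hδ hψ hlam h, fun φ ρ hφ hφρ => ?_,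
    fun hT => ⟨hBN, ?_⟩, ?_, fun _ => gibbsFullSupport A.measurable hm hd'⟩
  · exact pos_eigenfunction_unique hα0 hα1 hd hV hδ hψ hlam h hφ (LipB.ext_apply hφρ)
  · rw [← hB] at hBN ⊢
    exact hasAttractingMixingGibbs hα0 hα1 hd hT hBN
  · rw [← hB]
    exact gibbsFullSupport B.measurable hm hd'
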